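/- Let $\mathcal H,\mathcal K$ be complex separable Hilbert spaces and let $P=(P_t)_{t\ge0}$ on $\mathcal H$ and $\tilde P=(e^{-t\tilde A})_{t\ge0}$ on $\mathcal K$ be strongly continuous contraction semigroups ($-\tilde A$ being the generator of $\tilde P$). Suppose that $\tilde A$ is normal, with resolution of the identity $E$, and has spectral gap $\gamma_1>0$, i.e. $$\gamma_1=\inf\{\operatorname{Re}\gamma:\gamma\in\sigma(\tilde A),\ \operatorname{Re}\gamma>0\}=\inf\Big\{\tfrac{\operatorname{Re}\langle\tilde Af,f\rangle}{\|f\|^2}:0\ne f\in D(\tilde A),\ f\perp\ker\tilde A\Big\}>0 .$$ Let $\Lambda:\mathcal K\to\mathcal H$ and $\tilde\Lambda:\mathcal H\to\mathcal K$ be bounded operators with dense range such that $P_t\Lambda=\Lambda\tilde P_t$ and $\tilde P_t\tilde\Lambda=\tilde\Lambda P_t$ for all $t\ge0$, and such that $E_\Omega\big(\overline{\operatorname{ran}\Lambda^*}\big)\subseteq\overline{\operatorname{ran}\Lambda^*}$ for every Borel set $\Omega\subseteq\mathbb C$. Let $F_\Omega=\Lambda E_\Omega\Lambda^\dagger$,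 with domain $\operatorname{ran}\Lambda$, be the induced resolution of the identity ($\Lambda^\dagger$ the pseudo-inverse of $\Lambda$), let $P_\infty$ be the orthogonal projection onto $\{f:P_tf=f\ \forall t\ge0\}$, let $L^\infty(\sigma(\tilde A))$ be the space of bounded complex Borel functions on $\sigma(\tilde A)$ with the uniform norm $\|\cdot\|_\infty$, and define $m(\tilde A)$ by the Borel functional calculus of $\tilde A$. 1. If $m\in L^\infty(\sigma(\tilde A))$ satisfies $m(\tilde A)=\tilde\Lambda\Lambda$, then $\bar m:=m/(\|\Lambda\|\,\|\tilde\Lambda\|)$ satisfies $$\text{(a)}\qquad\int_{\sigma(\tilde A)}|\bar m(\gamma)|\,d|\langle F_\gamma f,g\rangle|\le\|f\|\,\|g\|\qquad\text{for all }f\in\operatorname{ran}\Lambda,\ g\in\mathcal H .$$ 2. If $\tilde A$ has simple spectrum, i.e. there is $v\in\mathcal K$ lying in $D(\tilde A^{*k}\tilde A^l)$ for all $k,l\ge0$ such that $\mathcal K$ is the closed linear span of $\{\tilde A^{*k}\tilde A^lv:k,l\ge0\}$, then there exists $m\in L^\infty(\sigma(\tilde A))$ with $m(\tilde A)=\tilde\Lambda\Lambda$.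 3. Let $m\in L^\infty(\sigma(\tilde A))$ satisfy $m(\tilde A)=\tilde\Lambda\Lambda$ and, for some constant $T_m>0$, condition (b): $m$ has no zero on $\sigma(\tilde A)$ and $\gamma\mapsto e^{-\gamma t}/m(\gamma)$ belongs to $L^\infty(\sigma(\tilde A))$ for every $t>T_m$. Put $\bar m=m/(\|\Lambda\|\,\|\tilde\Lambda\|)$ and $M_t(\gamma)=\frac{e^{-\gamma t}}{\bar m(\gamma)}\mathbf 1_{\{\operatorname{Re}\gamma\ge\gamma_1\}}$ for $\gamma\in\sigma(\tilde A)$. Then for every $t>T_m$: - the operator $\int_{\sigma(\tilde A)}e^{-\gamma t}\,dF_\gamma$ on $\operatorname{ran}\Lambda$ (defined weakly by $\langle\cdot f,g\rangle=\int_{\sigma(\tilde A)} e^{-\gamma t}\,d\langle F_\gamma f,g\rangle$) extends to a bounded linear operator on $\mathcal H$; - $\|P_tf-P_\infty f\|\le\|M_t\|_\infty\,\|f-P_\infty f\|$ for all $f\in\mathcal H$; - if $\gamma_1\in\sigma(\tilde A)$ and $|M_t|$ attains its supremum over $\sigma(\tilde A)$ at $\gamma_1$, then $\|P_tf-P_\infty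 f\|\le\frac{1}{|\bar m(\gamma_1)|}e^{-\gamma_1t}\|f-P_\infty f\|$ for all $f\in\mathcal H$. -/

import Mathlib

open MeasureTheory Filter Topology
open scoped NNReal ENNReal InnerProductSpace

noncomputable section

/-! ### Contraction semigroups and their generators -/

/-- A strongly continuous contraction semigroup `(P_t)_{t ≥ 0}` on a complex Hilbert space. -/
structure ContractionSemigroup (H : Type*) [NormedAddCommGroup H] [InnerProductSpace ℂ H] where
  op : ℝ≥0 → (H →L[ℂ] H)
  op_zero : op 0 = ContinuousLinearMap.id ℂ H
  op_add : ∀ t s : ℝ≥0, op (t + s) = op t ∘L op s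
  norm_op_le : ∀ t : ℝ≥0, ‖op t‖ ≤ 1
  strong_cont : ∀ f : H, Tendsto (fun t : ℝ≥0 => op t f) (𝓝 0) (𝓝 f)

namespace ContractionSemigroup

variable {H : Type*} [NormedAddCommGroup H] [InnerProductSpace ℂ H]

/-- The difference quotient `(P_t f - f) / t`. -/
def diffQuot (P : ContractionSemigroup H) (f : H) (t : ℝ≥0) : H :=
  (((t : ℝ) : ℂ))⁻¹ • (P.op t f - f)

/-- The operator `A` such that `-A` is the generator of the semigroup, i.e. `P_t = e^{-tA}`: its
domain consists of the `f` for which `lim_{t → 0+} (P_t f - f) / t` exists, and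
`A f = - lim_{t → 0+} (P_t f - f) / t`. -/
def negGenerator (P : ContractionSemigroup H) : H →ₗ.[ℂ] H where
  domain :=
    { carrier := {f | ∃ g : H, Tendsto (P.diffQuot f) (𝓝[>] 0) (𝓝 g)}
      zero_mem' := ⟨0, tendsto_const_nhds.congr fun t => by simp [diffQuot]⟩
      add_mem' := by
        rintro f₁ f₂ ⟨g₁, h₁⟩ ⟨g₂, h₂⟩
        refine ⟨g₁ + g₂, (h₁.add h₂).congr fun t => ?_⟩
        simp only [diffQuot, map_add, ← smul_add]
        congr 1
        abel
      smul_mem' := by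
        rintro c f ⟨g, h⟩
        refine ⟨c • g, (h.const_smul c).congr fun t => ?_⟩
        simp only [diffQuot, map_smul, ← smul_sub]
        rw [smul_comm] }
  toFun :=
    { toFun := fun f => - Classical.choose f.2
      map_add' := by
        intro f₁ f₂
        have h := (Classical.choose_spec f₁.2).add (Classical.choose_spec f₂.2)
        have h' := Classical.choose_spec (f₁ + f₂).2
        have := tendsto_nhds_unique h' (h.congr fun t => by
          simp only [diffQuot, Submodule.coe_add, map_add, ← smul_add]
          congr 1
          abel)
        rw [this, neg_add]
      map_smul' := by
        intro c f
        have h := (Classical.choose_spec f.2).const_smul c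
        have h' := Classical.choose_spec (c • f).2
        have := tendsto_nhds_unique h' (h.congr fun t => by
          simp only [diffQuot, Submodule.coe_smul, map_smul, ← smul_sub]
          rw [smul_comm])
        rw [this, RingHom.id_apply, smul_neg] }

theorem negGenerator_tendsto (P : ContractionSemigroup H) (f : P.negGenerator.domain) :
    Tendsto (P.diffQuot f) (𝓝[>] 0) (𝓝 (- P.negGenerator f)) := by
  have h := Classical.choose_spec f.2
  have e : - P.negGenerator f = Classical.choose f.2 := neg_neg _
  rw [e]
  exact h

/-- The closed subspace of vectors with `P_t f = f` for all `t ≥ 0`. -/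
def invariants (P : ContractionSemigroup H) : ClosedSubmodule ℂ H where
  carrier := {f | ∀ t : ℝ≥0, P.op t f = f}
  zero_mem' := fun t => map_zero _
  add_mem' := fun ha hb t => by rw [map_add, ha t, hb t]
  smul_mem' := fun c f hf t => by rw [map_smul, hf t]
  isClosed' := by
    have : {f : H | ∀ t : ℝ≥0, P.op t f = f} = ⋂ t : ℝ≥0, {f : H | P.op t f = f} := by
      ext f
      simp
    change IsClosed {f : H | ∀ t : ℝ≥0, P.op t f = f}
    rw [this]
    exact isClosed_iInter fun t => isClosed_eq (P.op t).continuous continuous_id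

/-- `P_∞`, the orthogonal projection onto the subspace of invariant vectors. -/
def equilibrium [CompleteSpace H] (P : ContractionSemigroup H) : H →L[ℂ] H :=
  P.invariants.toSubmodule.starProjection

end ContractionSemigroup

/-- `Λ : K → H` intertwines `P` (on `H`) and `Q` (on `K`): `P_t Λ = Λ Q_t` for all `t ≥ 0`. -/
def Intertwines {H K : Type*} [NormedAddCommGroup H] [InnerProductSpace ℂ H]
    [NormedAddCommGroup K] [InnerProductSpace ℂ K]
    (P : ContractionSemigroup H) (Λ : K →L[ℂ] H) (Q : ContractionSemigroup K) : Prop :=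
  ∀ t : ℝ≥0, P.op t ∘L Λ = Λ ∘L Q.op t

/-! ### Unbounded operators -/

namespace UnboundedOp

variable {K : Type*} [NormedAddCommGroup K] [InnerProductSpace ℂ K]

/-- The product `B A` of unbounded operators, with domain `{x ∈ D(A) : A x ∈ D(B)}`. -/
def mul (B A : K →ₗ.[ℂ] K) : K →ₗ.[ℂ] K :=
  B.comp (A.domRestrict ((B.domain.comap A.toFun).map A.domain.subtype)) (by
    rintro ⟨x, ⟨y, hy, rfl⟩, hx⟩
    exact hy)

theorem mem_mul_domain (B A : K →ₗ.[ℂ] K) (x : K) :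
    x ∈ (mul B A).domain ↔ ∃ hx : x ∈ A.domain, A ⟨x, hx⟩ ∈ B.domain := by
  constructor
  · rintro ⟨⟨y, hy, rfl⟩, hx⟩
    exact ⟨hx, hy⟩
  · rintro ⟨hx, h⟩
    exact ⟨⟨⟨x, hx⟩, h, rfl⟩, hx⟩

theorem mul_apply (B A : K →ₗ.[ℂ] K) (x : K) (h : x ∈ (mul B A).domain) (hx : x ∈ A.domain)
    (hAx : A ⟨x, hx⟩ ∈ B.domain) : mul B A ⟨x, h⟩ = B ⟨A ⟨x, hx⟩, hAx⟩ := rfl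

/-- The powers `A^n` of an unbounded operator, with their natural domains. -/
def pow (A : K →ₗ.[ℂ] K) : ℕ → (K →ₗ.[ℂ] K)
  | 0 => LinearMap.id.toPMap ⊤
  | n + 1 => mul A (pow A n)

/-- The spectrum: the complement of the set of `z` for which `z - A : D(A) → K` is a bijection
with bounded inverse. -/
def spectrum (A : K →ₗ.[ℂ] K) : Set ℂ :=
  {z | ∃ R : K →L[ℂ] K,
    (∀ x : K, ∃ y : A.domain, (y : K) = R x ∧ z • (y : K) - A y = x) ∧
    ∀ y : A.domain, R (z • (y : K) - A y) = y}ᶜ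

/-- Normal operators: densely defined, closed, with `A A* = A* A` (equality of unbounded
operators, domains included). -/
def IsNormal [CompleteSpace K] (A : K →ₗ.[ℂ] K) : Prop :=
  Dense (A.domain : Set K) ∧ A.IsClosed ∧ mul A A.adjoint = mul A.adjoint A

/-- `γ₁` is the spectral gap of `A`: `γ₁ > 0`, and `γ₁` is both the infimum of the positive real
parts of points of the spectrum and the infimum of the numbers `Re ⟨A f, f⟩ / ‖f‖²` over the
nonzero `f ∈ D(A)` that are orthogonal to the kernel of `A`. -/
def IsSpectralGap (A : K →ₗ.[ℂ] K) (γ₁ : ℝ) : Prop :=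
  0 < γ₁ ∧
  IsGLB {r : ℝ | ∃ γ ∈ spectrum A, 0 < γ.re ∧ r = γ.re} γ₁ ∧
  IsGLB {r : ℝ | ∃ f : A.domain, (f : K) ≠ 0 ∧
    (∀ x : A.domain, A x = 0 → inner ℂ (x : K) (f : K) = 0) ∧
    r = (inner ℂ (f : K) (A f)).re / ‖(f : K)‖ ^ 2} γ₁

/-- Simple spectrum: there is `v` in the domain of every `(A*)^k A^l` such that the closed linear
span of the vectors `(A*)^k A^l v` is the whole space. -/
def HasSimpleSpectrum [CompleteSpace K] (A : K →ₗ.[ℂ] K) : Prop :=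
  ∃ (v : K) (hv : ∀ k l : ℕ, v ∈ (mul (pow A.adjoint k) (pow A l)).domain),
    (Submodule.span ℂ (Set.range fun p : ℕ × ℕ =>
      mul (pow A.adjoint p.1) (pow A p.2) ⟨v, hv p.1 p.2⟩)).topologicalClosure = ⊤

end UnboundedOp

/-! ### Resolutions of the identity and the Borel functional calculus -/

/-- A (self-adjoint) resolution of the identity on the Borel sets of `ℂ`. By convention it takes
the value `0` on sets that are not Borel. -/
structure ResolutionOfIdentity (K : Type*) [NormedAddCommGroup K] [InnerProductSpace ℂ K]
    [CompleteSpace K] where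
  proj : Set ℂ → (K →L[ℂ] K)
  isStarProjection : ∀ Ω, MeasurableSet Ω → IsStarProjection (proj Ω)
  not_measurable : ∀ Ω, ¬ MeasurableSet Ω → proj Ω = 0
  empty : proj ∅ = 0
  univ : proj Set.univ = ContinuousLinearMap.id ℂ K
  inter : ∀ Ω₁ Ω₂, MeasurableSet Ω₁ → MeasurableSet Ω₂ →
    proj (Ω₁ ∩ Ω₂) = proj Ω₁ ∘L proj Ω₂
  iUnion : ∀ Ω : ℕ → Set ℂ, (∀ i, MeasurableSet (Ω i)) →
    Pairwise (Function.onFun Disjoint Ω) →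
    ∀ h : K, HasSum (fun i => proj (Ω i) h) (proj (⋃ i, Ω i) h)

/-- Integral of a complex function over `S` against a complex measure. -/
def complexIntegral (S : Set ℂ) (m : ℂ → ℂ) (μ : ComplexMeasure ℂ) : ℂ :=
  VectorMeasure.integral (μ.restrict S) m (ContinuousLinearMap.mul ℝ ℂ)

/-- `m` is a bounded Borel function on `S`, i.e. `m ∈ L^∞(S)` with the uniform norm. -/
def IsBoundedBorelOn (S : Set ℂ) (m : ℂ → ℂ) : Prop :=
  Measurable (S.domRestrict m) ∧ ∃ C : ℝ, ∀ γ ∈ S, ‖m γ‖ ≤ C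

/-- The uniform norm over `S`. -/
def supNormOn (S : Set ℂ) (m : ℂ → ℂ) : ℝ := ⨆ γ : S, ‖m γ‖

namespace ResolutionOfIdentity

variable {K : Type*} [NormedAddCommGroup K] [InnerProductSpace ℂ K] [CompleteSpace K]

/-- The complex measure `Ω ↦ ⟨E_Ω h, k⟩` (linear in `h`). -/
def scalarMeasure (E : ResolutionOfIdentity K) (h k : K) : ComplexMeasure ℂ where
  measureOf' Ω := inner ℂ k (E.proj Ω h)
  empty' := by simp [E.empty]
  not_measurable' Ω hΩ := by simp [E.not_measurable Ω hΩ]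
  m_iUnion' Ω hΩ hd := (E.iUnion Ω hΩ hd h).mapL (innerSL ℂ k)

/-- `E` is the resolution of the identity of `A`: `A = ∫ γ dE_γ`, that is, the domain of `A` is
`{h : ∫ |γ|² d⟨E_γ h, h⟩ < ∞}` and `⟨A h, k⟩ = ∫ γ d⟨E_γ h, k⟩` for `h ∈ D(A)`, `k ∈ K`. -/
def IsResolutionOf (E : ResolutionOfIdentity K) (A : K →ₗ.[ℂ] K) : Prop :=
  (∀ h : K, h ∈ A.domain ↔ ∫⁻ γ, ‖γ‖ₑ ^ 2 ∂(E.scalarMeasure h h).variation < ∞) ∧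
  ∀ (h : A.domain) (k : K),
    inner ℂ k (A h) = complexIntegral Set.univ (fun γ => γ) (E.scalarMeasure h k)

open Classical in
/-- The resolution of the identity concentrated at the origin. -/
def atZero (K : Type*) [NormedAddCommGroup K] [InnerProductSpace ℂ K] [CompleteSpace K] :
    ResolutionOfIdentity K where
  proj Ω := if MeasurableSet Ω ∧ (0 : ℂ) ∈ Ω then ContinuousLinearMap.id ℂ K else 0
  isStarProjection Ω _ := by
    split_ifs
    · exact IsStarProjection.one (K →L[ℂ] K)
    · exact IsStarProjection.zero (K →L[ℂ] K)
  not_measurable Ω hΩ := by simp [hΩ]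
  empty := by simp
  univ := by simp
  inter Ω₁ Ω₂ h₁ h₂ := by
    by_cases a : (0 : ℂ) ∈ Ω₁ <;> by_cases b : (0 : ℂ) ∈ Ω₂ <;> simp [h₁, h₂, a, b, h₁.inter h₂]
  iUnion Ω hΩ hd h := by
    by_cases a : ∃ i, (0 : ℂ) ∈ Ω i
    · obtain ⟨i, hi⟩ := a
      have hu : (0 : ℂ) ∈ ⋃ i, Ω i := Set.mem_iUnion.2 ⟨i, hi⟩
      have hne : ∀ j, j ≠ i → (0 : ℂ) ∉ Ω j := fun j hj h0 =>
        Set.disjoint_left.1 (hd hj) h0 hi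
      have := hasSum_single (f := fun j =>
        (if MeasurableSet (Ω j) ∧ (0 : ℂ) ∈ Ω j then ContinuousLinearMap.id ℂ K else 0) h) i
        (fun j hj => by simp [hne j hj])
      simpa only [hΩ i, hi, hu, MeasurableSet.iUnion hΩ, and_self, if_true] using this
    · have hu : (0 : ℂ) ∉ ⋃ i, Ω i := fun h0 => a (Set.mem_iUnion.1 h0)
      have hz : ∀ i, (0 : ℂ) ∉ Ω i := fun i h0 => a ⟨i, h0⟩
      simp [hu, hz]

instance : Nonempty (ResolutionOfIdentity K) := ⟨atZero K⟩

end ResolutionOfIdentity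

/-- The resolution of the identity of `A` (it exists and is unique when `A` is normal). -/
def spectralResolution {K : Type*} [NormedAddCommGroup K] [InnerProductSpace ℂ K]
    [CompleteSpace K] (A : K →ₗ.[ℂ] K) : ResolutionOfIdentity K :=
  Classical.epsilon fun E => E.IsResolutionOf A

/-- `m(A) = M` in the Borel functional calculus of a normal operator `A` with resolution of the
identity `E`: `⟨M h, k⟩ = ∫_{σ(A)} m(γ) d⟨E_γ h, k⟩` for all `h`, `k`. -/
def IsBorelFunctionOf {K : Type*} [NormedAddCommGroup K] [InnerProductSpace ℂ K]
    [CompleteSpace K] (A : K →ₗ.[ℂ] K) (m : ℂ → ℂ) (M : K →L[ℂ] K) : Prop :=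
  ∀ h k : K, inner ℂ k (M h) =
    complexIntegral (UnboundedOp.spectrum A) m ((spectralResolution A).scalarMeasure h k)

/-! ### Proper intertwining operators and the induced resolution -/

section Induced

variable {H K : Type*} [NormedAddCommGroup H] [InnerProductSpace ℂ H] [CompleteSpace H]
  [NormedAddCommGroup K] [InnerProductSpace ℂ K] [CompleteSpace K]

/-- `Λ` is proper with respect to `E`: its range is dense, and the closure of the range of `Λ*` is
invariant under every `E_Ω`. -/
def IsProper (E : ResolutionOfIdentity K) (Λ : K →L[ℂ] H) : Prop :=
  DenseRange Λ ∧
  ∀ Ω : Set ℂ, MeasurableSet Ω →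
    ∀ x ∈ closure (Set.range (ContinuousLinearMap.adjoint Λ)),
      E.proj Ω x ∈ closure (Set.range (ContinuousLinearMap.adjoint Λ))

/-- The pseudo-inverse `Λ†` on `ran Λ` (its whole domain when `ran Λ` is dense): `Λ† f` is the
unique `h` orthogonal to `ker Λ` with `Λ h = f`, see `pseudoInverse_spec`. -/
def pseudoInverse (Λ : K →L[ℂ] H) : LinearMap.range (Λ : K →ₗ[ℂ] H) →ₗ[ℂ] K :=
  (Submodule.liftQ (LinearMap.ker (Λ : K →ₗ[ℂ] H))
    ((LinearMap.ker (Λ : K →ₗ[ℂ] H))ᗮ.starProjection : K →ₗ[ℂ] K)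
    (fun x hx => by
      have hx' : x ∈ (LinearMap.ker (Λ : K →ₗ[ℂ] H))ᗮᗮ :=
        Submodule.le_orthogonal_orthogonal _ hx
      exact (Submodule.starProjection_apply_eq_zero_iff _).2 hx')) ∘ₗ
  ((LinearMap.quotKerEquivRange (Λ : K →ₗ[ℂ] H)).symm :
    LinearMap.range (Λ : K →ₗ[ℂ] H) →ₗ[ℂ] K ⧸ LinearMap.ker (Λ : K →ₗ[ℂ] H))

theorem pseudoInverse_spec (Λ : K →L[ℂ] H) (f : LinearMap.range (Λ : K →ₗ[ℂ] H)) :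
    Λ (pseudoInverse Λ f) = f ∧ pseudoInverse Λ f ∈ (LinearMap.ker (Λ : K →ₗ[ℂ] H))ᗮ := by
  obtain ⟨x, rfl⟩ := (LinearMap.quotKerEquivRange (Λ : K →ₗ[ℂ] H)).surjective f
  obtain ⟨x, rfl⟩ := Submodule.mkQ_surjective _ x
  have e : pseudoInverse Λ (LinearMap.quotKerEquivRange (Λ : K →ₗ[ℂ] H)
      (Submodule.mkQ (LinearMap.ker (Λ : K →ₗ[ℂ] H)) x)) =
      (LinearMap.ker (Λ : K →ₗ[ℂ] H))ᗮ.starProjection x := by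
    rw [pseudoInverse, LinearMap.comp_apply, LinearEquiv.coe_coe, LinearEquiv.symm_apply_apply]
    exact Submodule.liftQ_apply _ _ _
  rw [e]
  refine ⟨?_, Submodule.starProjection_apply_mem _ _⟩
  have hm := Submodule.sub_starProjection_mem_orthogonal
    (K := (LinearMap.ker (Λ : K →ₗ[ℂ] H))ᗮ) x
  rw [Submodule.orthogonal_orthogonal] at hm
  have h0 : Λ (x - (LinearMap.ker (Λ : K →ₗ[ℂ] H))ᗮ.starProjection x) = 0 := hm
  rw [map_sub, sub_eq_zero] at h0
  exact h0.symm

/-- The operator `F_Ω = Λ E_Ω Λ†` with domain `ran Λ`, the value at `Ω` of the non-self-adjoint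
resolution of the identity induced by the intertwining. -/
def inducedResolution (E : ResolutionOfIdentity K) (Λ : K →L[ℂ] H) (Ω : Set ℂ) :
    LinearMap.range (Λ : K →ₗ[ℂ] H) →ₗ[ℂ] H :=
  ((Λ ∘L E.proj Ω : K →L[ℂ] H) : K →ₗ[ℂ] H) ∘ₗ pseudoInverse Λ

/-- The complex measure `Ω ↦ ⟨F_Ω f, g⟩`, for `f ∈ ran Λ` and `g ∈ H`. -/
def inducedMeasure (E : ResolutionOfIdentity K) (Λ : K →L[ℂ] H)
    (f : LinearMap.range (Λ : K →ₗ[ℂ] H)) (g : H) : ComplexMeasure ℂ where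
  measureOf' Ω := inner ℂ g (inducedResolution E Λ Ω f)
  empty' := by
    change inner ℂ g (Λ (E.proj ∅ (pseudoInverse Λ f))) = 0
    simp [E.empty]
  not_measurable' Ω hΩ := by
    change inner ℂ g (Λ (E.proj Ω (pseudoInverse Λ f))) = 0
    simp [E.not_measurable Ω hΩ]
  m_iUnion' Ω hΩ hd := (E.iUnion Ω hΩ hd (pseudoInverse Λ f)).mapL (innerSL ℂ g ∘L Λ)

/-- Condition (a): `∫_{σ(A)} |m(γ)| d|⟨F_γ f, g⟩| ≤ ‖f‖ ‖g‖` for `f ∈ ran Λ`, `g ∈ H`. -/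
def ConditionA (A : K →ₗ.[ℂ] K) (Λ : K →L[ℂ] H) (m : ℂ → ℂ) : Prop :=
  ∀ (f : LinearMap.range (Λ : K →ₗ[ℂ] H)) (g : H),
    ∫⁻ γ in UnboundedOp.spectrum A, ‖m γ‖ₑ
        ∂(inducedMeasure (spectralResolution A) Λ f g).variation ≤
      ENNReal.ofReal (‖(f : H)‖ * ‖g‖)

/-- Condition (b): `m` has no zero on `σ(A)`, and `γ ↦ e^{-γ t} / m(γ)` is a bounded Borel function
on `σ(A)` for every `t > T`. -/
def ConditionB (A : K →ₗ.[ℂ] K) (m : ℂ → ℂ) (T : ℝ) : Prop :=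
  (∀ γ ∈ UnboundedOp.spectrum A, m γ ≠ 0) ∧
  ∀ t : ℝ, T < t →
    IsBoundedBorelOn (UnboundedOp.spectrum A) fun γ => Complex.exp (-γ * t) / m γ

open Classical in
/-- The function `M_t(γ) = e^{-γ t} / m(γ)` if `Re γ ≥ γ₁`, and `0` otherwise. -/
def gapMultiplier (m : ℂ → ℂ) (γ₁ t : ℝ) (γ : ℂ) : ℂ :=
  if γ₁ ≤ γ.re then Complex.exp (-γ * t) / m γ else 0

/-- The conclusions of the general convergence theorem for the function `m`: for all `t > T`,
* `∫_{σ(A)} e^{-γ t} dF_γ` extends to a bounded operator on `H`;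
* `‖P_t f - P_∞ f‖ ≤ ‖M_t‖_∞ ‖f - P_∞ f‖` for all `f`, the sup norm being over `σ(A)`;
* if `|M_t|` attains its supremum over `σ(A)` at `γ₁`, then
  `‖P_t f - P_∞ f‖ ≤ |m(γ₁)|⁻¹ e^{-γ₁ t} ‖f - P_∞ f‖` for all `f`. -/
def ConvergenceConclusions (P : ContractionSemigroup H) (A : K →ₗ.[ℂ] K) (Λ : K →L[ℂ] H)
    (γ₁ : ℝ) (m : ℂ → ℂ) (T : ℝ) : Prop :=
  ∀ t : ℝ≥0, T < t →
    (∃ L : H →L[ℂ] H, ∀ (f : LinearMap.range (Λ : K →ₗ[ℂ] H)) (g : H),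
      inner ℂ g (L f) =
        complexIntegral (UnboundedOp.spectrum A) (fun γ => Complex.exp (-γ * (t : ℝ)))
          (inducedMeasure (spectralResolution A) Λ f g)) ∧
    (∀ f : H, ‖P.op t f - P.equilibrium f‖ ≤
      supNormOn (UnboundedOp.spectrum A) (gapMultiplier m γ₁ t) * ‖f - P.equilibrium f‖) ∧
    ((γ₁ : ℂ) ∈ UnboundedOp.spectrum A →
      (∀ γ ∈ UnboundedOp.spectrum A,
        ‖gapMultiplier m γ₁ t γ‖ ≤ ‖gapMultiplier m γ₁ t (γ₁ : ℂ)‖) →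
      ∀ f : H, ‖P.op t f - P.equilibrium f‖ ≤
        1 / ‖m (γ₁ : ℂ)‖ * Real.exp (-γ₁ * t) * ‖f - P.equilibrium f‖)

end Induced

end

open MeasureTheory Filter Topology
open scoped NNReal ENNReal InnerProductSpace

noncomputable section

/-! ### Integration against a complex measure -/

section ComplexIntegral

variable {μ ν : ComplexMeasure ℂ} {f g : ℂ → ℂ}

/-! Write `E` for the resolution of the identity of the generator of `Q` and φ(E)h for ∫ φ dE h
(`vec`). Moving `Λ` across the inner product gives ⟨F_Ω f, g⟩ = ⟨E_Ω h, Λ* g⟩ with h = Λ† f, so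
every statement about the non-self-adjoint F becomes one about E.

Condition (a) is the inequality ∫ |φ| d|⟨E h, k⟩| ≤ ‖φ(E)h‖ ‖k‖ (`lintegral_variation_le_norm_vec`)
for φ = m/(‖Λ‖‖Λ'‖) and k = Λ* g: as m(E) = Λ'Λ and Λh = f, the vector φ(E)h is Λ'f divided by
‖Λ‖‖Λ'‖.

Existence of m: Λ'Λ commutes with the semigroup `Q`, hence with its generator, hence with E
(`apply_proj_of_commute`). Given a cyclic vector v, an operator commuting with E is φ(E), where φ is
the Radon–Nikodym density of ⟨M E_Ω v, v⟩ against ‖E_Ω v‖² (`exists_eq_vec_of_commute`).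

Convergence: the gap forces Q_t → E_{0} strongly, so P_∞Λ = ΛE_{0} and (P_t - P_∞)Λ = Λ(Q_t -
E_{0}). Off an E-null set, e^{-γt} - 1_{0} = φm with φ = e^{-γt}/m on Re γ ≥ γ₁ and 0 elsewhere.
Thus (P_t - P_∞)Λ = Λφ(E)Λ'Λ, and density of ran Λ removes the last factor (`op_sub_equilibrium`).
The norm is at most ‖Λ‖‖Λ'‖ sup|φ|, which is the sup of the normalised multiplier. The bounded
extension of ∫ e^{-γt} dF is P_t itself.

What remains is the spectral theorem. For a bounded normal operator the continuous calculus f ↦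
f(a)h is an isometry from L²(ν_h) on continuous functions, which extends to indicators. An accretive
normal A equals R⁻¹ - 1 for the bounded normal R = (1 + A)⁻¹, so its resolution is an image of that
of R. Two further facts connect this to the hypotheses: the resolution is unique, so commutation
properties pass to the chosen one, and a contraction semigroup is determined by its generator, so
Q_t = ∫ e^{-γt} dE. -/

theorem complexIntegral_univ (f : ℂ → ℂ) (μ : ComplexMeasure ℂ) :
    complexIntegral Set.univ f μ =
      VectorMeasure.integral μ f (ContinuousLinearMap.mul ℝ ℂ) := by
  rw [complexIntegral, VectorMeasure.restrict_univ]

theorem complexIntegral_eq_indicator {S : Set ℂ} (hS : MeasurableSet S) (f : ℂ → ℂ)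
    (μ : ComplexMeasure ℂ) :
    complexIntegral S f μ = complexIntegral Set.univ (S.indicator f) μ := by
  rw [complexIntegral_univ, complexIntegral, VectorMeasure.integral_indicator hS]

theorem complexIntegral_add (hf : Integrable f μ.variation) (hg : Integrable g μ.variation) :
    complexIntegral Set.univ (fun x => f x + g x) μ =
      complexIntegral Set.univ f μ + complexIntegral Set.univ g μ := by
  simp only [complexIntegral_univ]
  exact VectorMeasure.integral_fun_add hf hg

theorem complexIntegral_const_mul (c : ℂ) (hf : Integrable f μ.variation) :
    complexIntegral Set.univ (fun x => c * f x) μ = c * complexIntegral Set.univ f μ := by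
  simp only [complexIntegral_univ]
  have h₁ := VectorMeasure.continuousLinearMap_apply_integral (μ := μ) (f := f)
    (B := ContinuousLinearMap.mul ℝ ℂ) (C := ContinuousLinearMap.mul ℝ ℂ c) hf
  have h₂ := VectorMeasure.integral_continuousLinearMap_comp (μ := μ) (f := f)
    (B := ContinuousLinearMap.mul ℝ ℂ) (C := ContinuousLinearMap.mul ℝ ℂ c) hf
  simp only [ContinuousLinearMap.mul_apply'] at h₁ h₂
  rw [h₁, h₂]
  congr 1
  ext x y
  simp [mul_assoc]

theorem complexIntegral_smul_measure (c : ℂ) (hf : Integrable f μ.variation) :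
    complexIntegral Set.univ f (c • μ) = c * complexIntegral Set.univ f μ := by
  simp only [complexIntegral_univ]
  have h₁ := VectorMeasure.continuousLinearMap_apply_integral (μ := μ) (f := f)
    (B := ContinuousLinearMap.mul ℝ ℂ) (C := ContinuousLinearMap.mul ℝ ℂ c) hf
  simp only [ContinuousLinearMap.mul_apply'] at h₁
  rw [h₁, VectorMeasure.integral_eq_setToFun, VectorMeasure.integral_eq_setToFun]
  have e : ((c • μ).transpose (ContinuousLinearMap.mul ℝ ℂ) : Set ℂ → ℂ →L[ℝ] ℂ) =
      μ.transpose ((ContinuousLinearMap.compL ℝ ℂ ℂ ℂ (ContinuousLinearMap.mul ℝ ℂ c)) ∘L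
        ContinuousLinearMap.mul ℝ ℂ) := by
    funext s
    refine ContinuousLinearMap.ext fun x => ?_
    change x * (c * μ s) = c * (x * μ s)
    ring
  -- The two integrals are `setToFun` of the same set function over different control measures. The
  -- variation of `c • μ` is ‖c‖ times that of `μ`, so the value is the same over either.
  have key : DominatedFinMeasAdditive (c • μ).variation
      (μ.transpose ((ContinuousLinearMap.compL ℝ ℂ ℂ ℂ (ContinuousLinearMap.mul ℝ ℂ c)) ∘L
        ContinuousLinearMap.mul ℝ ℂ)) ‖ContinuousLinearMap.mul ℝ ℂ‖ := by
    rw [← e]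
    exact dominatedFinMeasAdditive_cbmApplyMeasure (c • μ) _
  have h := setToFun_congr_measure_of_integrable (μ := μ.variation) (μ' := (c • μ).variation)
    (‖c‖₊ : ℝ≥0∞) (by simp)
    (by rw [VectorMeasure.variation_smul]; exact le_of_eq (by ext s hs; simp))
    (dominatedFinMeasAdditive_cbmApplyMeasure μ _) key f hf
  rw [h]
  congr 1

theorem complexIntegral_add_measure (hμ : Integrable f μ.variation)
    (hν : Integrable f ν.variation) :
    complexIntegral Set.univ f (μ + ν) =
      complexIntegral Set.univ f μ + complexIntegral Set.univ f ν := by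
  simp only [complexIntegral_univ]
  exact VectorMeasure.integral_add_vectorMeasure hμ hν

theorem complexIntegral_indicator_one (S : Set ℂ) (hS : MeasurableSet S)
    [IsFiniteMeasure μ.variation] :
    complexIntegral Set.univ (S.indicator fun _ => 1) μ = μ S := by
  rw [complexIntegral_univ, VectorMeasure.integral_indicator_const _ hS]
  simp

theorem enorm_complexIntegral_le :
    ‖complexIntegral Set.univ f μ‖ₑ ≤ ∫⁻ x, ‖f x‖ₑ ∂μ.variation := by
  rw [complexIntegral_univ]
  refine VectorMeasure.enorm_integral_le_lintegral_enorm.trans ?_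
  have : ‖ContinuousLinearMap.mul ℝ ℂ‖ₑ ≤ 1 := by
    rw [← ofReal_norm]
    exact ENNReal.ofReal_le_one.2 (ContinuousLinearMap.opNorm_mul_le ℝ ℂ)
  calc _ ≤ 1 * ∫⁻ x, ‖f x‖ₑ ∂μ.variation := by gcongr
    _ = _ := one_mul _

theorem complexIntegral_congr_ae (h : f =ᵐ[μ.variation] g) :
    complexIntegral Set.univ f μ = complexIntegral Set.univ g μ := by
  simp only [complexIntegral_univ]
  exact VectorMeasure.integral_congr_ae h

end ComplexIntegral

namespace ResolutionOfIdentity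

variable {K : Type*} [NormedAddCommGroup K] [InnerProductSpace ℂ K] [CompleteSpace K]
  (E : ResolutionOfIdentity K)

/-! ### The scalar measures of a resolution of the identity -/

theorem scalarMeasure_apply (h k : K) (Ω : Set ℂ) :
    E.scalarMeasure h k Ω = inner ℂ k (E.proj Ω h) := rfl

theorem isStarProjection' (Ω : Set ℂ) : IsStarProjection (E.proj Ω) := by
  by_cases hΩ : MeasurableSet Ω
  · exact E.isStarProjection Ω hΩ
  · rw [E.not_measurable Ω hΩ]
    exact IsStarProjection.zero _

theorem proj_proj_same (Ω : Set ℂ) (h : K) : E.proj Ω (E.proj Ω h) = E.proj Ω h :=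
  DFunLike.congr_fun (E.isStarProjection' Ω).isIdempotentElem h

theorem inner_proj_left (Ω : Set ℂ) (h k : K) :
    inner ℂ (E.proj Ω h) k = inner ℂ h (E.proj Ω k) := by
  have := (E.isStarProjection' Ω).isSelfAdjoint
  rw [← ContinuousLinearMap.adjoint_inner_left]
  rw [← ContinuousLinearMap.star_eq_adjoint, this.star_eq]

theorem inner_proj_proj (Ω : Set ℂ) (h k : K) :
    inner ℂ (E.proj Ω h) (E.proj Ω k) = inner ℂ h (E.proj Ω k) := by
  rw [inner_proj_left, proj_proj_same]

theorem proj_proj {Ω₁ Ω₂ : Set ℂ} (h₁ : MeasurableSet Ω₁) (h₂ : MeasurableSet Ω₂) (h : K) :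
    E.proj Ω₁ (E.proj Ω₂ h) = E.proj (Ω₁ ∩ Ω₂) h := by
  rw [E.inter _ _ h₁ h₂]; rfl

/-- The positive measure `Ω ↦ ‖E_Ω h‖²`. -/
def measure (h : K) : Measure ℂ := (E.scalarMeasure h h).variation

theorem norm_proj_sq (Ω : Set ℂ) (h : K) :
    ((‖E.proj Ω h‖ ^ 2 : ℝ) : ℂ) = inner ℂ h (E.proj Ω h) := by
  rw [← inner_proj_proj, inner_self_eq_norm_sq_to_K]
  norm_cast

/-- Since E_Ω is a projection, ⟨E_Ω h, h⟩ = ‖E_Ω h‖² is already a positive measure; it dominates its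
own values and therefore its variation. -/
theorem measure_apply {Ω : Set ℂ} (hΩ : MeasurableSet Ω) (h : K) :
    E.measure h Ω = ‖E.proj Ω h‖ₑ ^ 2 := by
  have key : ∀ Ω, ‖E.scalarMeasure h h Ω‖ₑ = ‖E.proj Ω h‖ₑ ^ 2 := fun Ω => by
    rw [scalarMeasure_apply, ← norm_proj_sq, ← ofReal_norm, ← ofReal_norm,
      ← ENNReal.ofReal_pow (norm_nonneg _), Complex.norm_real, Real.norm_of_nonneg (by positivity)]
  refine le_antisymm ?_ ?_
  · let m : Measure ℂ := Measure.ofMeasurable (fun Ω _ => ‖E.proj Ω h‖ₑ ^ 2) (by simp [E.empty])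
      (fun Ω hΩ hd => by
        have h₁ := (E.iUnion Ω hΩ hd h).mapL (innerSL ℂ h)
        simp only [innerSL_apply_apply, ← norm_proj_sq] at h₁
        have h₂ := Complex.hasSum_ofReal.1 h₁
        have := ENNReal.ofReal_tsum_of_nonneg (fun n => by positivity) h₂.summable
        rw [h₂.tsum_eq] at this
        simpa only [ENNReal.ofReal_pow (norm_nonneg _), ofReal_norm] using this)
    have hm : ∀ Ω, MeasurableSet Ω → m Ω = ‖E.proj Ω h‖ₑ ^ 2 := fun Ω hΩ =>
      Measure.ofMeasurable_apply Ω hΩ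
    rw [← hm Ω hΩ]
    exact VectorMeasure.variation_apply_le_of_forall_enorm_le hΩ
      fun Ω' hΩ' _ => by rw [hm Ω' hΩ', key]
  · rw [← key]
    exact VectorMeasure.enorm_measure_le_variation _ _

theorem measure_univ (h : K) : E.measure h Set.univ = ‖h‖ₑ ^ 2 := by
  rw [E.measure_apply MeasurableSet.univ, E.univ]; rfl

instance (h : K) : IsFiniteMeasure (E.measure h) := ⟨by rw [measure_univ]; simp⟩

omit [CompleteSpace K] in
theorem enorm_inner_le (h k : K) : ‖inner ℂ k h‖ₑ ≤ ‖h‖ₑ * ‖k‖ₑ := by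
  rw [← ofReal_norm, ← ofReal_norm, ← ofReal_norm, ← ENNReal.ofReal_mul (norm_nonneg _), mul_comm]
  exact ENNReal.ofReal_le_ofReal (norm_inner_le_norm _ _)

theorem sum_mul_le_sqrt {ι : Type*} (s : Finset ι) (f g : ι → ℝ≥0∞) :
    ∑ i ∈ s, f i * g i ≤
      (∑ i ∈ s, f i ^ 2) ^ (1 / 2 : ℝ) * (∑ i ∈ s, g i ^ 2) ^ (1 / 2 : ℝ) := by
  have := ENNReal.inner_le_Lp_mul_Lq s f g (p := 2) (q := 2)
    ((Real.holderConjugate_iff).2 ⟨by norm_num, by norm_num⟩)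
  simpa only [ENNReal.rpow_two] using this

theorem sq_rpow_half (a : ℝ≥0∞) : (a ^ 2) ^ (1 / 2 : ℝ) = a := by
  rw [← ENNReal.rpow_two, ← ENNReal.rpow_mul]; norm_num

/-- On each piece p of a partition, |⟨E_p h, k⟩| = |⟨E_p h, E_p k⟩| ≤ ‖E_p h‖ ‖E_p k‖.
Cauchy–Schwarz over the pieces then reduces to additivity of ‖E_p h‖² and ‖E_p k‖². -/
theorem variation_scalarMeasure_le {Ω : Set ℂ} (hΩ : MeasurableSet Ω) (h k : K) :
    (E.scalarMeasure h k).variation Ω ≤ ‖E.proj Ω h‖ₑ * ‖E.proj Ω k‖ₑ := by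
  refine le_of_forall_lt fun a ha => ?_
  obtain ⟨P, hP₁, hP₂, hP₃, hP₄⟩ := VectorMeasure.exists_lt_sum_of_lt_variation _ hΩ ha
  have hs : ∀ x : K, (∑ p ∈ P, ‖E.proj p x‖ₑ ^ 2) ^ (1 / 2 : ℝ) ≤ ‖E.proj Ω x‖ₑ := fun x => by
    rw [← sq_rpow_half ‖E.proj Ω x‖ₑ, ← E.measure_apply hΩ]
    gcongr
    rw [← Finset.sum_congr rfl fun p hp => E.measure_apply (hP₃ p hp) x]
    exact (measure_biUnion_finset hP₂ hP₃).symm.trans_le (measure_mono (Set.iUnion₂_subset hP₁))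
  calc a < ∑ p ∈ P, ‖E.scalarMeasure h k p‖ₑ := hP₄
    _ ≤ ∑ p ∈ P, ‖E.proj p h‖ₑ * ‖E.proj p k‖ₑ := by
        gcongr with p
        rw [scalarMeasure_apply, ← inner_proj_proj]
        exact enorm_inner_le _ _
    _ ≤ _ := sum_mul_le_sqrt _ _ _
    _ ≤ _ := mul_le_mul' (hs h) (hs k)

theorem variation_univ_le (h k : K) :
    (E.scalarMeasure h k).variation Set.univ ≤ ‖h‖ₑ * ‖k‖ₑ := by
  simpa [E.univ] using E.variation_scalarMeasure_le MeasurableSet.univ h k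

instance (h k : K) : IsFiniteMeasure (E.scalarMeasure h k).variation :=
  ⟨(E.variation_univ_le h k).trans_lt (by finiteness)⟩

theorem variation_absolutelyContinuous (h k : K) :
    (E.scalarMeasure h k).variation ≪ E.measure h := by
  refine Measure.AbsolutelyContinuous.mk fun Ω hΩ h0 => ?_
  rw [E.measure_apply hΩ] at h0
  have h0 : ‖E.proj Ω h‖ₑ = 0 := by simpa using h0
  simpa [h0] using E.variation_scalarMeasure_le hΩ h k

/-- The same Cauchy–Schwarz argument, run over the level sets of simple functions increasing to `f`,
with the value on each level attached to the factor of `h`. -/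
theorem lintegral_variation_le_of_measurable {f : ℂ → ℝ≥0∞} (hf : Measurable f) (h k : K) :
    ∫⁻ x, f x ∂(E.scalarMeasure h k).variation ≤
      (∫⁻ x, f x ^ 2 ∂E.measure h) ^ (1 / 2 : ℝ) * ‖k‖ₑ := by
  rw [lintegral_eq_iSup_eapprox_lintegral hf]
  refine iSup_le fun n => ?_
  set g := SimpleFunc.eapprox f n
  have hm : ∀ x, MeasurableSet (g ⁻¹' {x}) := fun x => g.measurableSet_preimage _
  rw [SimpleFunc.lintegral]
  calc ∑ x ∈ g.range, x * (E.scalarMeasure h k).variation (g ⁻¹' {x})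
      ≤ ∑ x ∈ g.range, (x * ‖E.proj (g ⁻¹' {x}) h‖ₑ) * ‖E.proj (g ⁻¹' {x}) k‖ₑ := by
        refine Finset.sum_le_sum fun x _ => ?_
        rw [mul_assoc]
        exact mul_le_mul_right (E.variation_scalarMeasure_le (hm x) h k) _
    _ ≤ _ := sum_mul_le_sqrt _ _ _
    _ ≤ _ := by
        refine mul_le_mul' ?_ ?_
        · gcongr
          calc ∑ x ∈ g.range, (x * ‖E.proj (g ⁻¹' {x}) h‖ₑ) ^ 2
              = ∑ x ∈ g.range, x ^ 2 * E.measure h (g ⁻¹' {x}) := by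
                refine Finset.sum_congr rfl fun x _ => ?_
                rw [mul_pow, E.measure_apply (hm x)]
            _ = (g.map fun x => x ^ 2).lintegral (E.measure h) :=
                (SimpleFunc.map_lintegral _ _).symm
            _ = ∫⁻ x, (g x) ^ 2 ∂E.measure h := by
                rw [← SimpleFunc.lintegral_eq_lintegral]; rfl
            _ ≤ _ := by
                gcongr with x
                exact (le_iSup (fun n => SimpleFunc.eapprox f n x) n).trans_eq
                  (SimpleFunc.iSup_eapprox_apply hf x)
        · rw [← sq_rpow_half ‖k‖ₑ, ← E.measure_univ]
          gcongr
          rw [← Finset.sum_congr rfl fun x _ => E.measure_apply (hm x) k,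
            ← SimpleFunc.sum_range_measure_preimage_singleton g]

end ResolutionOfIdentity

/-! ### L² norms as integrals of squares -/

theorem eLpNorm_two_eq_lintegral {α F : Type*} [MeasurableSpace α] [NormedAddCommGroup F]
    (f : α → F) (μ : Measure α) :
    eLpNorm f 2 μ = (∫⁻ x, ‖f x‖ₑ ^ 2 ∂μ) ^ (1 / 2 : ℝ) := by
  rw [eLpNorm_eq_lintegral_rpow_enorm_toReal (by norm_num) (by norm_num)]
  simp only [ENNReal.toReal_ofNat, ENNReal.rpow_two]

theorem eLpNorm_two_sq {α F : Type*} [MeasurableSpace α] [NormedAddCommGroup F]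
    (f : α → F) (μ : Measure α) :
    eLpNorm f 2 μ ^ 2 = ∫⁻ x, ‖f x‖ₑ ^ 2 ∂μ := by
  rw [eLpNorm_two_eq_lintegral, ← ENNReal.rpow_two, ← ENNReal.rpow_mul]; norm_num

theorem eLpNorm_two_withDensity {φ χ : ℂ → ℂ} (hφ : Measurable φ) (hχ : Measurable χ)
    (μ : Measure ℂ) :
    eLpNorm χ 2 (μ.withDensity fun x => ‖φ x‖ₑ ^ 2) = eLpNorm (fun x => χ x * φ x) 2 μ := by
  rw [eLpNorm_two_eq_lintegral, eLpNorm_two_eq_lintegral,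
    lintegral_withDensity_eq_lintegral_mul _ (by fun_prop) (by fun_prop)]
  simp only [Pi.mul_apply, enorm_mul, mul_pow, mul_comm]

namespace ResolutionOfIdentity

variable {K : Type*} [NormedAddCommGroup K] [InnerProductSpace ℂ K] [CompleteSpace K]
  (E : ResolutionOfIdentity K)

/-! ### Integration of square integrable functions against a resolution of the identity -/

theorem lintegral_variation_le {φ : ℂ → ℂ} {h : K} (hφ : AEStronglyMeasurable φ (E.measure h))
    (k : K) :
    ∫⁻ x, ‖φ x‖ₑ ∂(E.scalarMeasure h k).variation ≤ eLpNorm φ 2 (E.measure h) * ‖k‖ₑ := by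
  have e := hφ.ae_eq_mk
  have e' : (fun x => ‖φ x‖ₑ) =ᵐ[(E.scalarMeasure h k).variation] fun x => ‖hφ.mk φ x‖ₑ := by
    filter_upwards [(E.variation_absolutelyContinuous h k).ae_le e] with x hx
    rw [hx]
  rw [eLpNorm_congr_ae e, lintegral_congr_ae e', eLpNorm_two_eq_lintegral]
  exact E.lintegral_variation_le_of_measurable hφ.stronglyMeasurable_mk.measurable.enorm h k

theorem integrable_variation {φ : ℂ → ℂ} {h : K} (hφ : MemLp φ 2 (E.measure h)) (k : K) :
    Integrable φ (E.scalarMeasure h k).variation :=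
  ⟨hφ.1.mono_ac (E.variation_absolutelyContinuous h k),
    (E.lintegral_variation_le hφ.1 k).trans_lt (ENNReal.mul_lt_top hφ.2 (by simp))⟩

theorem enorm_complexIntegral_scalarMeasure_le {φ : ℂ → ℂ} {h : K}
    (hφ : MemLp φ 2 (E.measure h)) (k : K) :
    ‖complexIntegral Set.univ φ (E.scalarMeasure h k)‖ₑ ≤ eLpNorm φ 2 (E.measure h) * ‖k‖ₑ :=
  enorm_complexIntegral_le.trans (E.lintegral_variation_le hφ.1 k)

theorem scalarMeasure_add_right (h k k' : K) :
    E.scalarMeasure h (k + k') = E.scalarMeasure h k + E.scalarMeasure h k' := by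
  ext Ω _
  simp [scalarMeasure_apply]

theorem scalarMeasure_smul_right (c : ℂ) (h k : K) :
    E.scalarMeasure h (c • k) = (starRingEnd ℂ c) • E.scalarMeasure h k := by
  ext Ω _
  simp [scalarMeasure_apply, mul_comm]

theorem scalarMeasure_add_left (h h' k : K) :
    E.scalarMeasure (h + h') k = E.scalarMeasure h k + E.scalarMeasure h' k := by
  ext Ω _
  simp [scalarMeasure_apply]

theorem scalarMeasure_smul_left (c : ℂ) (h k : K) :
    E.scalarMeasure (c • h) k = c • E.scalarMeasure h k := by
  ext Ω _
  simp [scalarMeasure_apply]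

/-- The integral is conjugate-linear in `k` and bounded by the L² norm of `φ` times ‖k‖, so its
conjugate is a bounded functional and Fréchet–Riesz supplies the vector. -/
theorem exists_vec {φ : ℂ → ℂ} {h : K} (hφ : MemLp φ 2 (E.measure h)) :
    ∃ x : K, ∀ k, inner ℂ k x = complexIntegral Set.univ φ (E.scalarMeasure h k) := by
  let L : K →ₗ[ℂ] ℂ :=
    { toFun := fun k => starRingEnd ℂ (complexIntegral Set.univ φ (E.scalarMeasure h k))
      map_add' := fun k k' => by
        rw [scalarMeasure_add_right, complexIntegral_add_measure (E.integrable_variation hφ k)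
          (E.integrable_variation hφ k'), map_add]
      map_smul' := fun c k => by
        rw [scalarMeasure_smul_right, complexIntegral_smul_measure _
          (E.integrable_variation hφ k), map_mul, RingHomCompTriple.comp_apply]
        rfl }
  let L' : K →L[ℂ] ℂ := L.mkContinuous (eLpNorm φ 2 (E.measure h)).toReal fun k => by
    have := ENNReal.toReal_mono (ENNReal.mul_lt_top hφ.2 (by simp)).ne
      (E.enorm_complexIntegral_scalarMeasure_le hφ k)
    simpa [L, ENNReal.toReal_mul] using this
  refine ⟨(InnerProductSpace.toDual ℂ K).symm L', fun k => ?_⟩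
  rw [← inner_conj_symm, InnerProductSpace.toDual_symm_apply]
  exact Complex.conj_conj _

open Classical in
/-- The vector `φ(E) h = ∫ φ(γ) dE_γ h`, for `φ` square integrable with respect to
`d⟨E_γ h, h⟩`. -/
def vec (φ : ℂ → ℂ) (h : K) : K :=
  if hφ : MemLp φ 2 (E.measure h) then (E.exists_vec hφ).choose else 0

theorem inner_vec {φ : ℂ → ℂ} {h : K} (hφ : MemLp φ 2 (E.measure h)) (k : K) :
    inner ℂ k (E.vec φ h) = complexIntegral Set.univ φ (E.scalarMeasure h k) := by
  rw [vec, dif_pos hφ]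
  exact (E.exists_vec hφ).choose_spec k

theorem eq_vec {φ : ℂ → ℂ} {h x : K} (hφ : MemLp φ 2 (E.measure h))
    (hx : ∀ k, inner ℂ k x = complexIntegral Set.univ φ (E.scalarMeasure h k)) :
    x = E.vec φ h :=
  ext_inner_left ℂ fun k => by rw [hx, E.inner_vec hφ]

/-- Test the weak bound against k = φ(E)h and cancel one factor of its norm. -/
theorem enorm_vec_le (φ : ℂ → ℂ) (h : K) : ‖E.vec φ h‖ₑ ≤ eLpNorm φ 2 (E.measure h) := by
  by_cases hφ : MemLp φ 2 (E.measure h)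
  · have h₁ := E.enorm_complexIntegral_scalarMeasure_le hφ (E.vec φ h)
    rw [← E.inner_vec hφ] at h₁
    rcases eq_or_ne (E.vec φ h) 0 with h0 | h0
    · simp [h0]
    · have h₂ : ‖inner ℂ (E.vec φ h) (E.vec φ h)‖ₑ = ‖E.vec φ h‖ₑ * ‖E.vec φ h‖ₑ := by
        rw [← ofReal_norm, ← ofReal_norm, ← ENNReal.ofReal_mul (norm_nonneg _)]
        simp [inner_self_eq_norm_sq_to_K, sq]
      rw [h₂] at h₁
      exact (ENNReal.mul_le_mul_iff_left (by simpa using h0) (by simp)).1 h₁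
  · simp [vec, hφ]

theorem memLp_of_bound {φ : ℂ → ℂ} (hφ : Measurable φ) {C : ℝ} (hC : ∀ x, ‖φ x‖ ≤ C) (h : K) :
    MemLp φ 2 (E.measure h) :=
  MemLp.of_bound hφ.aestronglyMeasurable C (Eventually.of_forall hC)

theorem norm_vec_le {φ : ℂ → ℂ} {C : ℝ} (hC : ∀ x, ‖φ x‖ ≤ C) (h : K) :
    ‖E.vec φ h‖ ≤ C * ‖h‖ := by
  have h0 : 0 ≤ C := (norm_nonneg _).trans (hC 0)
  have h₁ : ‖E.vec φ h‖ₑ ≤ ‖h‖ₑ * ENNReal.ofReal C := by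
    refine (E.enorm_vec_le φ h).trans ((eLpNorm_le_of_ae_bound (Eventually.of_forall hC)).trans ?_)
    have e : (‖h‖ₑ ^ 2) ^ (ENNReal.toReal 2)⁻¹ = ‖h‖ₑ := by
      have := sq_rpow_half ‖h‖ₑ
      rwa [one_div] at this
    rw [measure_univ, e]
  have := ENNReal.toReal_mono (by finiteness) h₁
  simpa [ENNReal.toReal_mul, h0, mul_comm] using this

theorem vec_congr_ae {φ ψ : ℂ → ℂ} {h : K} (e : φ =ᵐ[E.measure h] ψ) :
    E.vec φ h = E.vec ψ h := by
  by_cases hφ : MemLp φ 2 (E.measure h)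
  · have hψ := (memLp_congr_ae e).1 hφ
    refine E.eq_vec hψ fun k => ?_
    rw [E.inner_vec hφ]
    exact complexIntegral_congr_ae ((E.variation_absolutelyContinuous h k).ae_le e)
  · have hψ : ¬ MemLp ψ 2 (E.measure h) := fun hψ => hφ ((memLp_congr_ae e).2 hψ)
    simp [vec, hφ, hψ]

theorem vec_add {φ ψ : ℂ → ℂ} {h : K} (hφ : MemLp φ 2 (E.measure h))
    (hψ : MemLp ψ 2 (E.measure h)) :
    E.vec (fun x => φ x + ψ x) h = E.vec φ h + E.vec ψ h := by
  refine (E.eq_vec (hφ.add hψ) fun k => ?_).symm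
  rw [inner_add_right, E.inner_vec hφ, E.inner_vec hψ]
  exact (complexIntegral_add (E.integrable_variation hφ k) (E.integrable_variation hψ k)).symm

theorem vec_const_mul {φ : ℂ → ℂ} {h : K} (c : ℂ) (hφ : MemLp φ 2 (E.measure h)) :
    E.vec (fun x => c * φ x) h = c • E.vec φ h := by
  refine (E.eq_vec (hφ.const_mul c) fun k => ?_).symm
  rw [inner_smul_right, E.inner_vec hφ]
  exact (complexIntegral_const_mul c (E.integrable_variation hφ k)).symm

theorem vec_sub {φ ψ : ℂ → ℂ} {h : K} (hφ : MemLp φ 2 (E.measure h))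
    (hψ : MemLp ψ 2 (E.measure h)) :
    E.vec (fun x => φ x - ψ x) h = E.vec φ h - E.vec ψ h := by
  have := E.vec_add hφ (hψ.const_mul (-1))
  rw [E.vec_const_mul (-1) hψ, neg_one_smul, ← sub_eq_add_neg] at this
  simpa only [neg_one_mul, ← sub_eq_add_neg] using this

theorem vec_indicator_one {Ω : Set ℂ} (hΩ : MeasurableSet Ω) (h : K) :
    E.vec (Ω.indicator fun _ => 1) h = E.proj Ω h := by
  refine (E.eq_vec ((memLp_const 1).indicator hΩ) fun k => ?_).symm
  rw [complexIntegral_indicator_one Ω hΩ, scalarMeasure_apply]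

theorem vec_one (h : K) : E.vec (fun _ => 1) h = h := by
  have := E.vec_indicator_one MeasurableSet.univ h
  rwa [Set.indicator_univ, E.univ] at this

theorem vec_add_right {φ : ℂ → ℂ} {h h' : K} (hφ : MemLp φ 2 (E.measure h))
    (hφ' : MemLp φ 2 (E.measure h')) (hφ'' : MemLp φ 2 (E.measure (h + h'))) :
    E.vec φ (h + h') = E.vec φ h + E.vec φ h' := by
  refine (E.eq_vec hφ'' fun k => ?_).symm
  rw [inner_add_right, E.inner_vec hφ, E.inner_vec hφ', scalarMeasure_add_left,
    complexIntegral_add_measure (E.integrable_variation hφ k) (E.integrable_variation hφ' k)]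

theorem vec_smul_right {φ : ℂ → ℂ} {h : K} (c : ℂ) (hφ : MemLp φ 2 (E.measure h))
    (hφ' : MemLp φ 2 (E.measure (c • h))) :
    E.vec φ (c • h) = c • E.vec φ h := by
  refine (E.eq_vec hφ' fun k => ?_).symm
  rw [inner_smul_right, E.inner_vec hφ, scalarMeasure_smul_left,
    complexIntegral_smul_measure _ (E.integrable_variation hφ k)]

theorem scalarMeasure_proj_right {Ω : Set ℂ} (hΩ : MeasurableSet Ω) (h k : K) :
    E.scalarMeasure h (E.proj Ω k) = (E.scalarMeasure h k).restrict Ω := by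
  ext Ω' hΩ'
  rw [VectorMeasure.restrict_apply _ hΩ hΩ', scalarMeasure_apply, scalarMeasure_apply,
    inner_proj_left, E.proj_proj hΩ hΩ', Set.inter_comm]

theorem proj_vec {φ : ℂ → ℂ} {h : K} (hφ : MemLp φ 2 (E.measure h)) {Ω : Set ℂ}
    (hΩ : MeasurableSet Ω) : E.proj Ω (E.vec φ h) = E.vec (Ω.indicator φ) h := by
  refine E.eq_vec (hφ.indicator hΩ) fun k => ?_
  rw [← inner_proj_left, E.inner_vec hφ, scalarMeasure_proj_right _ hΩ,
    ← complexIntegral_eq_indicator hΩ, complexIntegral_univ, complexIntegral]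

/-- E_Ω φ(E)h = (1_Ω φ)(E)h, whose squared norm is at most ∫_Ω |φ|². Domination suffices for
multiplicativity; equality of the measures is never needed. -/
theorem measure_vec_le {φ : ℂ → ℂ} {h : K} (hφ : MemLp φ 2 (E.measure h)) :
    E.measure (E.vec φ h) ≤ (E.measure h).withDensity fun x => ‖φ x‖ₑ ^ 2 := by
  refine Measure.le_intro fun Ω hΩ _ => ?_
  rw [E.measure_apply hΩ, E.proj_vec hφ hΩ, withDensity_apply _ hΩ, ← eLpNorm_two_sq,
    ← eLpNorm_indicator_eq_eLpNorm_restrict hΩ]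
  gcongr
  exact E.enorm_vec_le _ _

theorem vec_simpleFunc {φ : ℂ → ℂ} {h : K} (hφ : MemLp φ 2 (E.measure h)) (s : SimpleFunc ℂ ℂ) :
    MemLp (fun x => s x * φ x) 2 (E.measure h) ∧
      E.vec s (E.vec φ h) = E.vec (fun x => s x * φ x) h := by
  have hs : ∀ (s : SimpleFunc ℂ ℂ) (g : K), MemLp s 2 (E.measure g) := fun s g =>
    s.memLp_of_isFiniteMeasure 2 _
  induction s using SimpleFunc.induction with
  | const c hΩ =>
    rename_i Ω
    have e : (fun x => (SimpleFunc.piecewise Ω hΩ (SimpleFunc.const ℂ c)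
        (SimpleFunc.const ℂ 0)) x * φ x) = fun x => c * Ω.indicator φ x := by
      funext x
      by_cases hx : x ∈ Ω <;> simp [hx]
    have e' : ((SimpleFunc.piecewise Ω hΩ (SimpleFunc.const ℂ c)
        (SimpleFunc.const ℂ 0)) : ℂ → ℂ) = fun x => c * Ω.indicator (fun _ => 1) x := by
      funext x
      by_cases hx : x ∈ Ω <;> simp [hx]
    rw [e, e', E.vec_const_mul c (hφ.indicator hΩ),
      E.vec_const_mul c ((memLp_const 1).indicator hΩ), E.vec_indicator_one hΩ, E.proj_vec hφ hΩ]
    exact ⟨(hφ.indicator hΩ).const_mul c, rfl⟩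
  | add hd h₁ h₂ =>
    rename_i f g
    have e : (fun x => (f + g) x * φ x) = fun x => f x * φ x + g x * φ x := by
      funext x; simp [add_mul]
    rw [e, E.vec_add h₁.1 h₂.1, ← h₁.2, ← h₂.2]
    exact ⟨h₁.1.add h₂.1, E.vec_add (hs f _) (hs g _)⟩

theorem memLp_vec {φ ψ : ℂ → ℂ} {h : K} (hφm : Measurable φ) (hψm : Measurable ψ)
    (hφ : MemLp φ 2 (E.measure h)) (hψφ : MemLp (fun x => ψ x * φ x) 2 (E.measure h)) :
    MemLp ψ 2 (E.measure (E.vec φ h)) :=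
  ⟨hψm.aestronglyMeasurable, (eLpNorm_mono_measure ψ (E.measure_vec_le hφ)).trans_lt
    (by rw [eLpNorm_two_withDensity hφm hψm]; exact hψφ.2)⟩

/-- For simple ψ this is linearity and `proj_vec`. In general, approximate ψ by a simple `s` in
L²(|φ|² dE_h): this single choice controls (ψ - s)(E)φ(E)h, by `measure_vec_le`, and also ((ψ -
s)φ)(E)h. -/
theorem vec_vec {φ ψ : ℂ → ℂ} {h : K} (hφm : Measurable φ) (hψm : Measurable ψ)
    (hφ : MemLp φ 2 (E.measure h)) (hψφ : MemLp (fun x => ψ x * φ x) 2 (E.measure h)) :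
    E.vec ψ (E.vec φ h) = E.vec (fun x => ψ x * φ x) h := by
  set ρ := (E.measure h).withDensity fun x => ‖φ x‖ₑ ^ 2
  have hρ : MemLp ψ 2 ρ :=
    ⟨hψm.aestronglyMeasurable, by rw [eLpNorm_two_withDensity hφm hψm]; exact hψφ.2⟩
  rw [← sub_eq_zero, ← enorm_eq_zero, ← nonpos_iff_eq_zero]
  refine ENNReal.le_of_forall_pos_le_add fun ε hε _ => ?_
  have hε' : (ε / 2 : ℝ≥0∞) ≠ 0 := by
    simpa using hε.ne'
  obtain ⟨s, hs, -⟩ := hρ.exists_simpleFunc_eLpNorm_sub_lt (by norm_num) hε'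
  obtain ⟨hsφ, hv⟩ := E.vec_simpleFunc hφ s
  have e : E.vec ψ (E.vec φ h) - E.vec (fun x => ψ x * φ x) h =
      E.vec (fun x => ψ x - s x) (E.vec φ h) - E.vec (fun x => ψ x * φ x - s x * φ x) h := by
    rw [E.vec_sub (E.memLp_vec hφm hψm hφ hψφ) (s.memLp_of_isFiniteMeasure 2 _),
      E.vec_sub hψφ hsφ, hv]
    abel
  have h₁ : eLpNorm (fun x => ψ x - s x) 2 ρ ≤ ε / 2 := hs.le
  have h₂ : eLpNorm (fun x => ψ x * φ x - s x * φ x) 2 (E.measure h) ≤ ε / 2 := by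
    simp only [← sub_mul]
    rwa [eLpNorm_two_withDensity (χ := fun x => ψ x - s x) hφm (hψm.sub s.measurable)] at h₁
  rw [e, zero_add, ← ENNReal.add_halves (ε : ℝ≥0∞)]
  refine enorm_sub_le.trans (add_le_add ?_ ?_)
  · exact (E.enorm_vec_le _ _).trans
      ((eLpNorm_mono_measure _ (E.measure_vec_le hφ)).trans h₁)
  · exact (E.enorm_vec_le _ _).trans h₂

theorem vec_proj {φ : ℂ → ℂ} {h : K} (hφm : Measurable φ) {Ω : Set ℂ} (hΩ : MeasurableSet Ω)
    (hφ : MemLp (Ω.indicator φ) 2 (E.measure h)) :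
    MemLp φ 2 (E.measure (E.proj Ω h)) ∧ E.vec φ (E.proj Ω h) = E.vec (Ω.indicator φ) h := by
  have e : (fun x => φ x * Ω.indicator (fun _ => 1) x) = Ω.indicator φ := by
    funext x
    by_cases hx : x ∈ Ω <;> simp [hx]
  have hm : Measurable (Ω.indicator fun _ => (1 : ℂ)) := measurable_const.indicator hΩ
  have h₁ : MemLp (Ω.indicator fun _ => (1 : ℂ)) 2 (E.measure h) :=
    (memLp_const 1).indicator hΩ
  rw [← E.vec_indicator_one hΩ]
  rw [← e] at hφ ⊢
  exact ⟨E.memLp_vec hm hφm h₁ hφ, E.vec_vec hm hφm h₁ hφ⟩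

/-! ### The total variation of `⟨E_Ω h, k⟩` -/

/-- A plain Cauchy–Schwarz bound would give the L² norm of φ; what is needed is the norm of the
vector g = φ(E)h. Recovering h from g through 1/φ on {φ ≠ 0} shows that |⟨E h, k⟩| has density at
most 1/|φ| there with respect to |⟨E g, k⟩|. Multiplying by |φ| leaves only the total variation of
⟨E g, k⟩, which is at most ‖g‖ ‖k‖. -/
theorem lintegral_variation_le_norm_vec {φ : ℂ → ℂ} {h : K} (hφm : Measurable φ)
    (hφ : MemLp φ 2 (E.measure h)) (k : K) :
    ∫⁻ x, ‖φ x‖ₑ ∂(E.scalarMeasure h k).variation ≤ ‖E.vec φ h‖ₑ * ‖k‖ₑ := by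
  set g := E.vec φ h with hg
  let ψ : ℂ → ℂ := fun x => (φ x)⁻¹
  have hψm : Measurable ψ := hφm.inv
  let Ω : Set ℂ := {x | φ x ≠ 0}
  have hΩ : MeasurableSet Ω := (hφm (MeasurableSet.singleton 0)).compl
  have e : (fun x => ψ x * φ x) = Ω.indicator fun _ => 1 := by
    funext x
    by_cases hx : φ x = 0 <;> simp [ψ, Ω, hx]
  have h1 : MemLp (fun x => ψ x * φ x) 2 (E.measure h) := by
    rw [e]; exact (memLp_const 1).indicator hΩ
  have hψ : MemLp ψ 2 (E.measure g) := E.memLp_vec hφm hψm hφ h1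
  have hv : E.vec ψ g = E.proj Ω h := by
    rw [hg, E.vec_vec hφm hψm hφ h1, e, E.vec_indicator_one hΩ]
  -- E_Ω h = ψ(E)g, so each value of the left measure is an integral of ψ against ⟨E g, k⟩ over the
  -- set in question.
  have hle : (E.scalarMeasure (E.proj Ω h) k).variation ≤
      (E.scalarMeasure g k).variation.withDensity fun x => ‖ψ x‖ₑ := by
    refine VectorMeasure.variation_le_of_forall_enorm_le fun Ω' hΩ' => ?_
    rw [scalarMeasure_apply, ← hv, E.proj_vec hψ hΩ', E.inner_vec (hψ.indicator hΩ'),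
      withDensity_apply _ hΩ', ← lintegral_indicator hΩ']
    refine enorm_complexIntegral_le.trans (le_of_eq ?_)
    simp only [enorm_indicator_eq_indicator_enorm]
  have hres : (E.scalarMeasure h k).variation.restrict Ω =
      (E.scalarMeasure (E.proj Ω h) k).variation := by
    rw [← VectorMeasure.variation_restrict hΩ, ← E.scalarMeasure_proj_right hΩ]
    congr 1
    ext Ω' hΩ'
    rw [scalarMeasure_apply, scalarMeasure_apply, inner_proj_left, E.proj_proj hΩ hΩ',
      E.proj_proj hΩ' hΩ, Set.inter_comm]
  calc ∫⁻ x, ‖φ x‖ₑ ∂(E.scalarMeasure h k).variation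
      = ∫⁻ x in Ω, ‖φ x‖ₑ ∂(E.scalarMeasure h k).variation := by
        rw [← lintegral_indicator hΩ]
        refine lintegral_congr fun x => ?_
        by_cases hx : φ x = 0 <;> simp [Ω, hx]
    _ ≤ ∫⁻ x, ‖φ x‖ₑ ∂(E.scalarMeasure g k).variation.withDensity fun x => ‖ψ x‖ₑ := by
        rw [hres]
        exact lintegral_mono' hle le_rfl
    _ = ∫⁻ x, ‖ψ x‖ₑ * ‖φ x‖ₑ ∂(E.scalarMeasure g k).variation :=
        lintegral_withDensity_eq_lintegral_mul _ hψm.enorm hφm.enorm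
    _ ≤ ∫⁻ _, 1 ∂(E.scalarMeasure g k).variation := by
        refine lintegral_mono fun x => ?_
        rw [← enorm_mul]
        by_cases hx : φ x = 0 <;> simp [ψ, hx]
    _ ≤ _ := by
        rw [lintegral_one]
        exact E.variation_univ_le g k

end ResolutionOfIdentity

/-! ### The spectral theorem for bounded normal operators -/

section BoundedNormal

variable {K : Type*} [NormedAddCommGroup K] [InnerProductSpace ℂ K] [CompleteSpace K]

theorem norm_sq_eq_re_inner_star_mul (b : K →L[ℂ] K) (h : K) :
    ‖b h‖ ^ 2 = (inner ℂ h ((star b * b) h)).re := by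
  rw [ContinuousLinearMap.star_eq_adjoint, mul_apply_eq_comp,
    ContinuousLinearMap.adjoint_inner_right, inner_self_eq_norm_sq_to_K]
  norm_cast

/-- For a bounded normal operator `a` and a vector `h` there is a finite measure `ν` such that
`‖f(a) h‖² = ∫ |f|² dν` for all continuous functions `f`. -/
theorem exists_measure_enorm_cfc (a : K →L[ℂ] K) [ha : IsStarNormal a] (h : K) :
    ∃ ν : Measure ℂ, IsFiniteMeasure ν ∧
      ∀ f : ℂ → ℂ, Continuous f → ‖cfc f a h‖ₑ = eLpNorm f 2 ν := by
  let X := spectrum ℂ a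
  let c : C(X, ℝ) → C(X, ℂ) := fun f => ⟨fun x => (f x : ℂ), by fun_prop⟩
  have hpos : ∀ f : C(X, ℂ), (inner ℂ h (cfcHom ha (star f * f) h)).re = ‖cfcHom ha f h‖ ^ 2 :=
    fun f => by rw [norm_sq_eq_re_inner_star_mul, map_mul, map_star]
  -- Riesz–Markov is applied to f ↦ Re⟨h, f(a)h⟩ on C(σ(a)). It is positive because f = |√f|² turns
  -- its value into ‖(√f)(a)h‖². The resulting measure is pushed forward from σ(a) to ℂ.
  let Λ : CompactlySupportedContinuousMap X ℝ →ₚ[ℝ] ℝ := PositiveLinearMap.mk₀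
    { toFun := fun f => (inner ℂ h (cfcHom ha (c f) h)).re
      map_add' := fun f g => by
        have e : c (f + g : CompactlySupportedContinuousMap X ℝ) = c f + c g := by
          ext x; simp [c]
        rw [e, map_add, add_apply, inner_add_right, Complex.add_re]
      map_smul' := fun r f => by
        have e : c (r • f : CompactlySupportedContinuousMap X ℝ) = (r : ℂ) • c f := by
          ext x; simp [c]
        rw [e, map_smul, smul_apply, inner_smul_right, Complex.re_ofReal_mul]
        rfl }
    (fun f hf => by
      have e : c f = star (⟨fun x => (Real.sqrt (f x) : ℂ), by fun_prop⟩ : C(X, ℂ)) *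
          ⟨fun x => (Real.sqrt (f x) : ℂ), by fun_prop⟩ := by
        ext x
        have : Real.sqrt (f x) * Real.sqrt (f x) = f x := Real.mul_self_sqrt (hf x)
        simp only [c, ContinuousMap.coe_mk, ContinuousMap.mul_apply, ContinuousMap.star_apply,
          RCLike.star_def, Complex.conj_ofReal]
        exact_mod_cast this.symm
      change 0 ≤ (inner ℂ h (cfcHom ha (c f) h)).re
      rw [e, hpos]
      positivity)
  let μ := RealRMK.rieszMeasure Λ
  have hfin : IsFiniteMeasure μ := by
    refine ⟨(RealRMK.rieszMeasure_le_of_eq_one Λ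
      (f := CompactlySupportedContinuousMap.continuousMapEquiv 1) (fun x => ?_)
      isCompact_univ (fun x _ => ?_)).trans_lt ENNReal.ofReal_lt_top⟩
    · exact zero_le_one
    · rfl
  refine ⟨μ.map Subtype.val, inferInstance, fun f hf => ?_⟩
  have hc := hf.comp (continuous_subtype_val (p := fun x => x ∈ X))
  let F : C(X, ℂ) := ⟨f ∘ Subtype.val, hc⟩
  let g : CompactlySupportedContinuousMap X ℝ :=
    CompactlySupportedContinuousMap.continuousMapEquiv ⟨fun x => ‖f x‖ ^ 2, by fun_prop⟩
  have hcfc : cfc f a = cfcHom ha F := cfc_apply f a ha hf.continuousOn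
  have hgF : c g = star F * F := by
    ext x
    have := Complex.normSq_eq_conj_mul_self (z := f x)
    rw [Complex.normSq_eq_norm_sq] at this
    exact this
  have h1 : ∫ x, ‖f x‖ ^ 2 ∂μ = ‖cfc f a h‖ ^ 2 := by
    rw [hcfc, ← hpos, ← hgF]
    exact RealRMK.integral_rieszMeasure Λ g
  have hint : Integrable (fun x : X => ‖f x‖ ^ 2) μ :=
    g.continuous.integrable_of_hasCompactSupport g.hasCompactSupport
  have h2 : ‖cfc f a h‖ₑ ^ 2 = ∫⁻ x : X, ‖f x‖ₑ ^ 2 ∂μ := by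
    rw [← ofReal_norm, ← ENNReal.ofReal_pow (norm_nonneg _), ← h1,
      ofReal_integral_eq_lintegral_ofReal hint (Eventually.of_forall fun x => by positivity)]
    refine lintegral_congr fun x => ?_
    rw [ENNReal.ofReal_pow (norm_nonneg _), ofReal_norm]
  rw [← ResolutionOfIdentity.sq_rpow_half ‖cfc f a h‖ₑ, h2, eLpNorm_two_eq_lintegral,
    lintegral_map (by fun_prop) measurable_subtype_coe]

variable (a : K →L[ℂ] K) [ha : IsStarNormal a]

/-- The measure `ν` with `‖f(a) h‖² = ∫ |f|² dν` for all continuous `f`. -/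
def cfcMeasure (h : K) : Measure ℂ := (exists_measure_enorm_cfc a h).choose

instance (h : K) : IsFiniteMeasure (cfcMeasure a h) :=
  (exists_measure_enorm_cfc a h).choose_spec.1

theorem enorm_cfc_apply {f : ℂ → ℂ} (hf : Continuous f) (h : K) :
    ‖cfc f a h‖ₑ = eLpNorm f 2 (cfcMeasure a h) :=
  (exists_measure_enorm_cfc a h).choose_spec.2 f hf

/-- `x = φ(a) h`, where `φ(a) h` is defined by approximation of `φ` in `L²` by bounded continuous
functions. -/
def IsBorelCalc (φ : ℂ → ℂ) (h x : K) : Prop :=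
  ∀ f : ℂ → ℂ, Continuous f →
    ‖cfc f a h - x‖ₑ ≤ eLpNorm (fun z => f z - φ z) 2 (cfcMeasure a h)

theorem exists_seq_tendsto_eLpNorm {φ : ℂ → ℂ} {ν : Measure ℂ} [IsFiniteMeasure ν]
    (hφ : MemLp φ 2 ν) :
    ∃ f : ℕ → BoundedContinuousFunction ℂ ℂ,
      Tendsto (fun n => eLpNorm (fun z => f n z - φ z) 2 ν) atTop (𝓝 0) := by
  have hε : ∀ n : ℕ, ((n : ℝ≥0∞) + 1)⁻¹ ≠ 0 := fun n => by simp
  choose f hf _ using fun n => hφ.exists_boundedContinuous_eLpNorm_sub_le (by norm_num) (hε n)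
  refine ⟨f, tendsto_of_tendsto_of_tendsto_of_le_of_le tendsto_const_nhds
    (h := fun n : ℕ => ((n : ℝ≥0∞) + 1)⁻¹) ?_ (fun _ => zero_le) fun n => ?_⟩
  · exact_mod_cast (ENNReal.tendsto_inv_nat_nhds_zero.comp (tendsto_add_atTop_nat 1))
  · have : (fun z => f n z - φ z) = -(φ - f n) := by ext z; simp
    dsimp only
    rw [this, eLpNorm_neg]
    exact hf n

theorem eLpNorm_sub_le_add {f g φ : ℂ → ℂ} {ν : Measure ℂ} (hf : AEStronglyMeasurable f ν)
    (hg : AEStronglyMeasurable g ν) (hφ : AEStronglyMeasurable φ ν) :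
    eLpNorm (fun z => f z - g z) 2 ν ≤
      eLpNorm (fun z => f z - φ z) 2 ν + eLpNorm (fun z => g z - φ z) 2 ν := by
  have e : (fun z => f z - g z) = (fun z => f z - φ z) - fun z => g z - φ z := by
    ext z; simp
  rw [e]
  exact eLpNorm_sub_le (hf.sub hφ) (hg.sub hφ) (by norm_num)

theorem enorm_cfc_sub_cfc {f g : ℂ → ℂ} (hf : Continuous f) (hg : Continuous g) (h : K) :
    ‖cfc f a h - cfc g a h‖ₑ = eLpNorm (fun z => f z - g z) 2 (cfcMeasure a h) := by
  rw [← enorm_cfc_apply a (by fun_prop), cfc_sub f g a]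
  rfl

theorem IsBorelCalc.tendsto {φ : ℂ → ℂ} {h x : K} (hx : IsBorelCalc a φ h x)
    {f : ℕ → BoundedContinuousFunction ℂ ℂ}
    (hf : Tendsto (fun n => eLpNorm (fun z => f n z - φ z) 2 (cfcMeasure a h)) atTop (𝓝 0)) :
    Tendsto (fun n => cfc (f n) a h) atTop (𝓝 x) := by
  rw [tendsto_iff_edist_tendsto_0]
  refine tendsto_of_tendsto_of_tendsto_of_le_of_le tendsto_const_nhds hf (fun _ => zero_le)
    fun n => ?_
  dsimp only
  rw [edist_eq_enorm_sub]
  exact hx (f n) (f n).continuous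

theorem isBorelCalc_of_tendsto {φ : ℂ → ℂ} {h x : K}
    (hφ : MemLp φ 2 (cfcMeasure a h)) {f : ℕ → BoundedContinuousFunction ℂ ℂ}
    (hf : Tendsto (fun n => eLpNorm (fun z => f n z - φ z) 2 (cfcMeasure a h)) atTop (𝓝 0))
    (hx : Tendsto (fun n => cfc (f n) a h) atTop (𝓝 x)) : IsBorelCalc a φ h x := by
  intro g hg
  have h1 : Tendsto (fun n => ‖cfc g a h - cfc (f n) a h‖ₑ) atTop (𝓝 ‖cfc g a h - x‖ₑ) :=
    (tendsto_const_nhds.sub hx).enorm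
  have h2 := (tendsto_const_nhds (x := eLpNorm (fun z => g z - φ z) 2 (cfcMeasure a h))).add hf
  rw [add_zero] at h2
  refine le_of_tendsto_of_tendsto' h1 h2 fun n => ?_
  rw [enorm_cfc_sub_cfc a hg (f n).continuous]
  exact eLpNorm_sub_le_add (by fun_prop) (by fun_prop) hφ.1

/-- By `enorm_cfc_sub_cfc`, f ↦ f(a)h is isometric for the L² norm on continuous functions, so an
L²-approximation of φ yields a Cauchy sequence in `K`. -/
theorem exists_isBorelCalc {φ : ℂ → ℂ} {h : K} (hφ : MemLp φ 2 (cfcMeasure a h)) :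
    ∃ x, IsBorelCalc a φ h x := by
  obtain ⟨f, hf⟩ := exists_seq_tendsto_eLpNorm hφ
  have hc : CauchySeq fun n => cfc (f n) a h := by
    rw [EMetric.cauchySeq_iff]
    intro ε hε
    have h2 : (0 : ℝ≥0∞) < ε / 2 := ENNReal.half_pos hε.ne'
    obtain ⟨N, hN⟩ := (eventually_atTop.1 (hf.eventually (gt_mem_nhds h2)))
    refine ⟨N, fun m hm n hn => ?_⟩
    rw [edist_eq_enorm_sub, enorm_cfc_sub_cfc a (f m).continuous (f n).continuous]
    calc _ ≤ _ := eLpNorm_sub_le_add (by fun_prop) (by fun_prop) hφ.1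
      _ < ε / 2 + ε / 2 := ENNReal.add_lt_add (hN m hm) (hN n hn)
      _ = ε := ENNReal.add_halves ε
  obtain ⟨x, hx⟩ := cauchySeq_tendsto_of_complete hc
  exact ⟨x, isBorelCalc_of_tendsto a hφ hf hx⟩

theorem IsBorelCalc.unique {φ : ℂ → ℂ} {h x y : K} (hφ : MemLp φ 2 (cfcMeasure a h))
    (hx : IsBorelCalc a φ h x) (hy : IsBorelCalc a φ h y) : x = y := by
  obtain ⟨f, hf⟩ := exists_seq_tendsto_eLpNorm hφ
  exact tendsto_nhds_unique (hx.tendsto a hf) (hy.tendsto a hf)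

theorem isBorelCalc_cfc {f : ℂ → ℂ} (hf : Continuous f) (h : K) :
    IsBorelCalc a f h (cfc f a h) := fun _ hg => (enorm_cfc_sub_cfc a hg hf h).le

theorem IsBorelCalc.enorm_le {φ : ℂ → ℂ} {h x : K} (hx : IsBorelCalc a φ h x) :
    ‖x‖ₑ ≤ eLpNorm φ 2 (cfcMeasure a h) := by
  have := hx (fun _ => 0) continuous_const
  have e : (fun z => 0 - φ z) = -φ := by ext z; simp
  rw [e, eLpNorm_neg, cfc_const_zero] at this
  simpa using this

theorem IsBorelCalc.add_smul {φ ψ : ℂ → ℂ} {h x y : K} (c : ℂ) (hφ : MemLp φ 2 (cfcMeasure a h))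
    (hψ : MemLp ψ 2 (cfcMeasure a h)) (hx : IsBorelCalc a φ h x) (hy : IsBorelCalc a ψ h y) :
    IsBorelCalc a (fun z => φ z + c * ψ z) h (x + c • y) := by
  obtain ⟨f, hf⟩ := exists_seq_tendsto_eLpNorm hφ
  obtain ⟨g, hg⟩ := exists_seq_tendsto_eLpNorm hψ
  refine isBorelCalc_of_tendsto a (f := fun n => f n + c • g n) (hφ.add (hψ.const_mul c)) ?_ ?_
  · have h2 := hf.add (ENNReal.Tendsto.const_mul hg (Or.inr (enorm_ne_top (x := c))))
    rw [mul_zero, add_zero] at h2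
    refine tendsto_of_tendsto_of_tendsto_of_le_of_le tendsto_const_nhds h2 (fun _ => zero_le)
      fun n => ?_
    have e : (fun z => (f n + c • g n) z - (φ z + c * ψ z)) =
        (fun z => f n z - φ z) + c • fun z => g n z - ψ z := by ext z; simp; ring
    dsimp only
    rw [e, ← eLpNorm_const_smul]
    exact eLpNorm_add_le ((f n).continuous.aestronglyMeasurable.sub hφ.1)
      (((g n).continuous.aestronglyMeasurable.sub hψ.1).const_smul c) (by norm_num)
  · refine ((hx.tendsto a hf).add ((hy.tendsto a hg).const_smul c)).congr fun n => ?_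
    have h1 := cfc_add a (f n) (c • g n)
    have h2 := cfc_smul c (g n) a
    exact ((DFunLike.congr_fun h1 h).trans
      (congrArg (cfc (f n) a h + ·) (DFunLike.congr_fun h2 h))).symm

/-! #### The spectral projections -/

theorem memLp_indicator_one {Ω : Set ℂ} (hΩ : MeasurableSet Ω) (ν : Measure ℂ)
    [IsFiniteMeasure ν] : MemLp (Ω.indicator fun _ => (1 : ℂ)) 2 ν :=
  (memLp_const 1).indicator hΩ

/-- Approximating in L² of the sum of the measures gives one sequence that works for all of them.
This is how identities involving several vectors, such as additivity in `h`, pass to the limit. -/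
theorem exists_seq_tendsto_of_le {φ : ℂ → ℂ} {ι : Type*} (s : Finset ι) (ν : ι → Measure ℂ)
    [∀ i, IsFiniteMeasure (ν i)] (hφ : ∀ μ : Measure ℂ, IsFiniteMeasure μ → MemLp φ 2 μ) :
    ∃ f : ℕ → BoundedContinuousFunction ℂ ℂ,
      ∀ i ∈ s, Tendsto (fun n => eLpNorm (fun z => f n z - φ z) 2 (ν i)) atTop (𝓝 0) := by
  obtain ⟨f, hf⟩ := exists_seq_tendsto_eLpNorm (hφ (∑ i ∈ s, ν i) inferInstance)
  refine ⟨f, fun i hi => tendsto_of_tendsto_of_tendsto_of_le_of_le tendsto_const_nhds hf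
    (fun _ => zero_le) fun n => eLpNorm_mono_measure _ ?_⟩
  exact Finset.single_le_sum (f := ν) (fun _ _ => Measure.zero_le _) hi

open Classical in
/-- The value at `h` of the spectral projection of `a` for `Ω`. -/
def spectralProjFun (Ω : Set ℂ) (h : K) : K :=
  if hΩ : MeasurableSet Ω then
    (exists_isBorelCalc a (memLp_indicator_one hΩ (cfcMeasure a h))).choose
  else 0

theorem isBorelCalc_spectralProjFun {Ω : Set ℂ} (hΩ : MeasurableSet Ω) (h : K) :
    IsBorelCalc a (Ω.indicator fun _ => 1) h (spectralProjFun a Ω h) := by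
  rw [spectralProjFun, dif_pos hΩ]
  exact (exists_isBorelCalc a (memLp_indicator_one hΩ (cfcMeasure a h))).choose_spec

theorem exists_seq_tendsto_spectralProjFun {Ω : Set ℂ} (hΩ : MeasurableSet Ω) (s : Finset K) :
    ∃ f : ℕ → BoundedContinuousFunction ℂ ℂ, ∀ h ∈ s,
      Tendsto (fun n => eLpNorm (fun z => f n z - Ω.indicator (fun _ => 1) z) 2 (cfcMeasure a h))
        atTop (𝓝 0) ∧
      Tendsto (fun n => cfc (f n) a h) atTop (𝓝 (spectralProjFun a Ω h)) := by
  obtain ⟨f, hf⟩ := exists_seq_tendsto_of_le s (cfcMeasure a)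
    (fun μ _ => memLp_indicator_one hΩ μ)
  exact ⟨f, fun h hh => ⟨hf h hh, (isBorelCalc_spectralProjFun a hΩ h).tendsto a (hf h hh)⟩⟩

/-- The spectral projection of `a` for `Ω`. -/
def spectralProj (Ω : Set ℂ) : K →L[ℂ] K :=
  LinearMap.mkContinuous
    { toFun := spectralProjFun a Ω
      map_add' := fun h k => by
        classical
        by_cases hΩ : MeasurableSet Ω
        · obtain ⟨f, hf⟩ := exists_seq_tendsto_spectralProjFun a hΩ {h, k, h + k}
          refine tendsto_nhds_unique (hf (h + k) (by simp)).2 ?_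
          refine ((hf h (by simp)).2.add (hf k (by simp)).2).congr fun n => ?_
          rw [map_add]
        · simp [spectralProjFun, hΩ]
      map_smul' := fun c h => by
        classical
        by_cases hΩ : MeasurableSet Ω
        · obtain ⟨f, hf⟩ := exists_seq_tendsto_spectralProjFun a hΩ {h, c • h}
          refine tendsto_nhds_unique (hf (c • h) (by simp)).2 ?_
          refine ((hf h (by simp)).2.const_smul c).congr fun n => ?_
          rw [map_smul]
        · simp [spectralProjFun, hΩ] }
    1 fun h => by
      by_cases hΩ : MeasurableSet Ω
      · have h1 := (isBorelCalc_spectralProjFun a hΩ h).enorm_le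
        have h2 : eLpNorm (Ω.indicator fun _ => (1 : ℂ)) 2 (cfcMeasure a h) ≤ ‖h‖ₑ := by
          have h3 := enorm_cfc_apply a (continuous_const (y := (1 : ℂ))) h
          rw [cfc_const_one ℂ a] at h3
          exact (eLpNorm_indicator_le _).trans h3.ge
        have := ENNReal.toReal_mono (by simp) (h1.trans h2)
        simpa using this
      · simp [spectralProjFun, hΩ]

theorem spectralProj_apply (Ω : Set ℂ) (h : K) : spectralProj a Ω h = spectralProjFun a Ω h := rfl

theorem isBorelCalc_spectralProj {Ω : Set ℂ} (hΩ : MeasurableSet Ω) (h : K) :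
    IsBorelCalc a (Ω.indicator fun _ => 1) h (spectralProj a Ω h) :=
  isBorelCalc_spectralProjFun a hΩ h

omit ha in
theorem cfc_apply_cfc_apply (f g : BoundedContinuousFunction ℂ ℂ) (h : K) :
    cfc f a (cfc g a h) = cfc (f * g : BoundedContinuousFunction ℂ ℂ) a h :=
  (DFunLike.congr_fun (cfc_mul f g a) h).symm

/-- An iterated limit: for fixed `m` the factor `g m` is bounded, so n → ∞ can be taken first, and m
→ ∞ afterwards. The splitting is f g - 1_{Ω₁∩Ω₂} = g (f - 1_{Ω₁}) + 1_{Ω₁} (g - 1_{Ω₂}). -/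
theorem spectralProj_inter {Ω₁ Ω₂ : Set ℂ} (h₁ : MeasurableSet Ω₁) (h₂ : MeasurableSet Ω₂)
    (h : K) : spectralProj a (Ω₁ ∩ Ω₂) h = spectralProj a Ω₁ (spectralProj a Ω₂ h) := by
  classical
  obtain ⟨g, hg⟩ := exists_seq_tendsto_spectralProjFun a h₂ {h}
  obtain ⟨hg1, hg2⟩ := hg h (by simp)
  refine tendsto_nhds_unique ?_ (((spectralProj a Ω₁).continuous.tendsto _).comp hg2)
  rw [tendsto_iff_edist_tendsto_0]
  refine tendsto_of_tendsto_of_tendsto_of_le_of_le tendsto_const_nhds hg1 (fun _ => zero_le)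
    fun m => ?_
  dsimp only [Function.comp_apply]
  rw [edist_eq_enorm_sub]
  obtain ⟨f, hf⟩ := exists_seq_tendsto_spectralProjFun a h₁ {h, cfc (g m) a h}
  have t1 : Tendsto (fun n => ‖cfc (f n) a (cfc (g m) a h) - spectralProj a (Ω₁ ∩ Ω₂) h‖ₑ) atTop
      (𝓝 ‖spectralProj a Ω₁ (cfc (g m) a h) - spectralProj a (Ω₁ ∩ Ω₂) h‖ₑ) :=
    ((hf (cfc (g m) a h) (by simp)).2.sub_const _).enorm
  have t2 : Tendsto (fun n => ENNReal.ofReal ‖g m‖ *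
      eLpNorm (fun z => f n z - Ω₁.indicator (fun _ => 1) z) 2 (cfcMeasure a h) +
      eLpNorm (fun z => g m z - Ω₂.indicator (fun _ => 1) z) 2 (cfcMeasure a h)) atTop
      (𝓝 (ENNReal.ofReal ‖g m‖ * 0 +
        eLpNorm (fun z => g m z - Ω₂.indicator (fun _ => 1) z) 2 (cfcMeasure a h))) :=
    (ENNReal.Tendsto.const_mul (hf h (by simp)).1 (Or.inr ENNReal.ofReal_ne_top)).add
      tendsto_const_nhds
  rw [mul_zero, zero_add] at t2
  refine le_of_tendsto_of_tendsto' t1 t2 fun n => ?_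
  rw [cfc_apply_cfc_apply]
  refine (isBorelCalc_spectralProj a (h₁.inter h₂) h _ (f n * g m).continuous).trans ?_
  have e : (fun z => (f n * g m) z - (Ω₁ ∩ Ω₂).indicator (fun _ => (1 : ℂ)) z) =
      (fun z => g m z * (f n z - Ω₁.indicator (fun _ => 1) z)) +
        Ω₁.indicator fun z => g m z - Ω₂.indicator (fun _ => 1) z := by
    ext z
    by_cases z1 : z ∈ Ω₁ <;> by_cases z2 : z ∈ Ω₂ <;> simp [z1, z2] <;> ring
  have m1 : Measurable (Ω₁.indicator fun _ => (1 : ℂ)) := measurable_const.indicator h₁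
  have m2 : Measurable (Ω₂.indicator fun _ => (1 : ℂ)) := measurable_const.indicator h₂
  have mf := (f n).continuous.measurable
  have mg := (g m).continuous.measurable
  rw [e]
  refine (eLpNorm_add_le (mg.mul (mf.sub m1)).aestronglyMeasurable
    ((mg.sub m2).indicator h₁).aestronglyMeasurable (by norm_num)).trans
    (add_le_add ?_ (eLpNorm_indicator_le _))
  refine eLpNorm_le_mul_eLpNorm_of_ae_le_mul (Eventually.of_forall fun z => ?_) 2
  rw [Pi.mul_apply, norm_mul]
  exact mul_le_mul_of_nonneg_right ((g m).norm_coe_le_norm z) (norm_nonneg _)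

/-- Indicators are real, so the conjugates of an approximating sequence approximate as well, and the
continuous calculus turns conjugates into adjoints. -/
theorem spectralProj_symm {Ω : Set ℂ} (hΩ : MeasurableSet Ω) (h k : K) :
    inner ℂ (spectralProj a Ω h) k = inner ℂ h (spectralProj a Ω k) := by
  classical
  obtain ⟨f, hf⟩ := exists_seq_tendsto_spectralProjFun a hΩ {h, k}
  have t1 : Tendsto (fun n => inner ℂ (cfc (f n) a h) k) atTop
      (𝓝 (inner ℂ (spectralProj a Ω h) k)) := (hf h (by simp)).2.inner tendsto_const_nhds
  have hs : Tendsto (fun n => cfc (star (f n) : BoundedContinuousFunction ℂ ℂ) a k) atTop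
      (𝓝 (spectralProj a Ω k)) := by
    refine (isBorelCalc_spectralProj a hΩ k).tendsto a ((hf k (by simp)).1.congr fun n => ?_)
    refine eLpNorm_congr_norm_ae (Eventually.of_forall fun z => ?_)
    have e : (star (f n)) z - Ω.indicator (fun _ => (1 : ℂ)) z =
        star (f n z - Ω.indicator (fun _ => (1 : ℂ)) z) := by
      by_cases hz : z ∈ Ω <;> simp [hz]
    rw [e, norm_star]
  have t2 : Tendsto (fun n => inner ℂ h (cfc (star (f n) : BoundedContinuousFunction ℂ ℂ) a k))
      atTop (𝓝 (inner ℂ h (spectralProj a Ω k))) := tendsto_const_nhds.inner hs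
  refine tendsto_nhds_unique t1 (t2.congr fun n => ?_)
  have e : cfc (star (f n) : BoundedContinuousFunction ℂ ℂ) a = star (cfc (f n) a) :=
    cfc_star (f n) a
  rw [e, ContinuousLinearMap.star_eq_adjoint, ContinuousLinearMap.adjoint_inner_right]

theorem spectralProj_univ (h : K) : spectralProj a Set.univ h = h := by
  refine (isBorelCalc_spectralProj a MeasurableSet.univ h).unique a
    (memLp_indicator_one MeasurableSet.univ _) ?_
  have := isBorelCalc_cfc a (continuous_const (y := 1)) h
  rw [cfc_const_one ℂ a] at this
  simpa using this

/-- The remainder after a finite set of indices is the calculus of the indicator of the union of the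
other sets; its norm is at most the square root of the ν-measure of that union, a tail of a
convergent series. -/
theorem hasSum_spectralProj {Ω : ℕ → Set ℂ} (hΩ : ∀ i, MeasurableSet (Ω i))
    (hd : Pairwise (Function.onFun Disjoint Ω)) (h : K) :
    HasSum (fun i => spectralProj a (Ω i) h) (spectralProj a (⋃ i, Ω i) h) := by
  classical
  set ν := cfcMeasure a h
  have hU := MeasurableSet.iUnion hΩ
  have key : ∀ s : Finset ℕ, IsBorelCalc a
      (fun z => (⋃ i, Ω i).indicator (fun _ => 1) z - ∑ i ∈ s, (Ω i).indicator (fun _ => 1) z) h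
      (spectralProj a (⋃ i, Ω i) h - ∑ i ∈ s, spectralProj a (Ω i) h) := by
    intro s
    induction s using Finset.induction_on with
    | empty => simpa using isBorelCalc_spectralProj a hU h
    | insert i s hi ih =>
      have := ih.add_smul a (-1) ((memLp_indicator_one hU ν).sub (memLp_finsetSum s fun i _ =>
        memLp_indicator_one (hΩ i) ν)) (memLp_indicator_one (hΩ i) ν)
        (isBorelCalc_spectralProj a (hΩ i) h)
      have e1 : (fun z => (⋃ i, Ω i).indicator (fun _ => (1 : ℂ)) z -
          ∑ i ∈ insert i s, (Ω i).indicator (fun _ => 1) z) = fun z =>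
          (⋃ i, Ω i).indicator (fun _ => 1) z - ∑ i ∈ s, (Ω i).indicator (fun _ => 1) z +
            (-1) * (Ω i).indicator (fun _ => 1) z := by
        ext z; rw [Finset.sum_insert hi]; ring
      have e2 : spectralProj a (⋃ i, Ω i) h - ∑ i ∈ insert i s, spectralProj a (Ω i) h =
          spectralProj a (⋃ i, Ω i) h - ∑ i ∈ s, spectralProj a (Ω i) h +
            (-1 : ℂ) • spectralProj a (Ω i) h := by
        rw [Finset.sum_insert hi, neg_one_smul]; abel
      rw [e1, e2]
      exact this
  have hfin : ∑' i, ν (Ω i) ≠ ∞ := by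
    rw [← measure_iUnion hd hΩ]
    finiteness
  have t := ENNReal.tendsto_tsum_compl_atTop_zero hfin
  have t' : Tendsto (fun s : Finset ℕ => (∑' b : { x // x ∉ s }, ν (Ω b)) ^ (1 / 2 : ℝ))
      atTop (𝓝 0) := by
    have := (ENNReal.continuous_rpow_const (y := 1 / 2)).tendsto 0 |>.comp t
    rwa [ENNReal.zero_rpow_of_pos (by norm_num)] at this
  rw [HasSum, SummationFilter.unconditional_filter, tendsto_iff_edist_tendsto_0]
  refine tendsto_of_tendsto_of_tendsto_of_le_of_le tendsto_const_nhds t' (fun _ => zero_le)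
    fun s => ?_
  dsimp only
  rw [edist_comm, edist_eq_enorm_sub]
  refine ((key s).enorm_le).trans ?_
  have hT : MeasurableSet (⋃ i : { x // x ∉ s }, Ω i) := MeasurableSet.iUnion fun i => hΩ i
  have e : (fun z => (⋃ i, Ω i).indicator (fun _ => (1 : ℂ)) z -
      ∑ i ∈ s, (Ω i).indicator (fun _ => 1) z) =
      (⋃ i : { x // x ∉ s }, Ω i).indicator fun _ => 1 := by
    ext z
    by_cases hz : ∃ i, z ∈ Ω i
    · obtain ⟨i, hi⟩ := hz
      have hne : ∀ j, j ≠ i → z ∉ Ω j := fun j hj hzj => Set.disjoint_left.1 (hd hj) hzj hi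
      have h1 : z ∈ ⋃ i, Ω i := Set.mem_iUnion.2 ⟨i, hi⟩
      have h2 : ∀ j, (Ω j).indicator (fun _ => (1 : ℂ)) z = if j = i then 1 else 0 := fun j => by
        by_cases hj : j = i
        · subst hj; simp [hi]
        · simp [hj, hne j hj]
      have h3 : (z ∈ ⋃ i : { x // x ∉ s }, Ω i) ↔ i ∉ s := by
        simp only [Set.mem_iUnion, Subtype.exists, exists_prop]
        constructor
        · rintro ⟨j, hj, hzj⟩
          by_contra his
          exact hne j (fun hji => hj (hji ▸ his)) hzj
        · exact fun his => ⟨i, his, hi⟩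
      simp only [h2, Finset.sum_ite_eq', Set.indicator_of_mem h1, Set.indicator_apply, h3]
      by_cases his : i ∈ s <;> simp [his]
    · have h1 : z ∉ ⋃ i, Ω i := fun h => hz (Set.mem_iUnion.1 h)
      have h2 : ∀ j, z ∉ Ω j := fun j hj => hz ⟨j, hj⟩
      simp [h2]
  have hm : ν (⋃ i : { x // x ∉ s }, Ω i) = ∑' i : { x // x ∉ s }, ν (Ω i) := measure_iUnion
    (fun i j hij => hd (fun h => hij (Subtype.ext h))) fun i => hΩ i
  rw [e, eLpNorm_indicator_const hT (by norm_num) (by norm_num), hm]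
  simp

/-- The resolution of the identity of a bounded normal operator. -/
def boundedSpectralResolution : ResolutionOfIdentity K where
  proj := spectralProj a
  isStarProjection Ω hΩ := by
    refine ⟨?_, ?_⟩
    · ext h
      change spectralProj a Ω (spectralProj a Ω h) = spectralProj a Ω h
      rw [← spectralProj_inter a hΩ hΩ, Set.inter_self]
    · rw [isSelfAdjoint_iff, ContinuousLinearMap.star_eq_adjoint]
      refine ((ContinuousLinearMap.eq_adjoint_iff _ _).2 fun h k => ?_).symm
      exact spectralProj_symm a hΩ h k
  not_measurable Ω hΩ := by
    ext h
    rw [spectralProj_apply, spectralProjFun, dif_neg hΩ]; rfl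
  empty := by
    ext h
    refine (isBorelCalc_spectralProj a MeasurableSet.empty h).unique a
      (memLp_indicator_one MeasurableSet.empty _) ?_
    have := isBorelCalc_cfc a (continuous_const (y := 0)) h
    rw [cfc_const_zero] at this
    simpa using this
  univ := by
    ext h
    exact spectralProj_univ a h
  inter Ω₁ Ω₂ h₁ h₂ := by
    ext h
    exact spectralProj_inter a h₁ h₂ h
  iUnion Ω hΩ hd h := hasSum_spectralProj a hΩ hd h

/-- Lets L² approximations with respect to `cfcMeasure` be reused for the measure of the resolution
just built. -/
theorem measure_boundedSpectralResolution_le (h : K) :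
    (boundedSpectralResolution a).measure h ≤ cfcMeasure a h := by
  refine Measure.le_intro fun Ω hΩ _ => ?_
  rw [ResolutionOfIdentity.measure_apply _ hΩ, ← ENNReal.rpow_two]
  have := (isBorelCalc_spectralProj a hΩ h).enorm_le
  rw [eLpNorm_indicator_const hΩ (by norm_num) (by norm_num), enorm_one, one_mul] at this
  calc _ ≤ (cfcMeasure a h Ω ^ (1 / ENNReal.toReal 2)) ^ (2 : ℝ) := by gcongr; exact this
    _ = _ := by rw [← ENNReal.rpow_mul]; norm_num

theorem isBorelCalc_simpleFunc (s : SimpleFunc ℂ ℂ) (h : K) :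
    IsBorelCalc a s h ((boundedSpectralResolution a).vec s h) := by
  set E := boundedSpectralResolution a
  have hs : ∀ (s : SimpleFunc ℂ ℂ) (μ : Measure ℂ) [IsFiniteMeasure μ], MemLp s 2 μ :=
    fun s μ _ => s.memLp_of_isFiniteMeasure 2 _
  induction s using SimpleFunc.induction with
  | const c hΩ =>
    rename_i Ω
    have e' : ((SimpleFunc.piecewise Ω hΩ (SimpleFunc.const ℂ c)
        (SimpleFunc.const ℂ 0)) : ℂ → ℂ) = fun x => c * Ω.indicator (fun _ => 1) x := by
      funext x
      by_cases hx : x ∈ Ω <;> simp [hx]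
    have h0 := isBorelCalc_cfc a (continuous_const (y := 0)) h
    have := h0.add_smul a c (memLp_const 0) (memLp_indicator_one hΩ _)
      (isBorelCalc_spectralProj a hΩ h)
    rw [e', E.vec_const_mul c (memLp_indicator_one hΩ _), E.vec_indicator_one hΩ]
    simp only [cfc_const_zero, zero_add, zero_apply] at this
    exact this
  | add hd h₁ h₂ =>
    rename_i f g
    have := h₁.add_smul a 1 (hs f _) (hs g _) h₂
    simp only [one_mul, one_smul] at this
    rw [← E.vec_add (hs f _) (hs g _)] at this
    exact this

theorem memLp_id_boundedSpectralResolution (h : K) :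
    MemLp (fun z => z) 2 ((boundedSpectralResolution a).measure h) := by
  refine ⟨by fun_prop, (eLpNorm_mono_measure _ (measure_boundedSpectralResolution_le a h)).trans_lt
    ?_⟩
  rw [← enorm_cfc_apply a continuous_id' h]
  simp

/-- A simple function close to the identity in L² of `cfcMeasure` gives a vector close both to a h,
by `isBorelCalc_simpleFunc`, and to ∫ z dE h, by the comparison of measures. -/
theorem vec_id_boundedSpectralResolution (h : K) :
    (boundedSpectralResolution a).vec (fun z => z) h = a h := by
  set E := boundedSpectralResolution a
  have hν : MemLp (fun z => z) 2 (cfcMeasure a h) :=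
    ⟨by fun_prop, by rw [← enorm_cfc_apply a continuous_id' h]; simp⟩
  rw [← sub_eq_zero, ← enorm_eq_zero, ← nonpos_iff_eq_zero]
  refine ENNReal.le_of_forall_pos_le_add fun ε hε _ => ?_
  have hε' : (ε / 2 : ℝ≥0∞) ≠ 0 := by simpa using hε.ne'
  obtain ⟨s, hs, -⟩ := hν.exists_simpleFunc_eLpNorm_sub_lt (by norm_num) hε'
  have h1 : ‖a h - E.vec s h‖ₑ ≤ ε / 2 := by
    have := isBorelCalc_simpleFunc a s h (fun z => z) continuous_id'
    rw [cfc_id' ℂ a] at this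
    exact this.trans hs.le
  have h2 : ‖E.vec (fun z => z - s z) h‖ₑ ≤ ε / 2 :=
    (E.enorm_vec_le _ _).trans
      ((eLpNorm_mono_measure _ (measure_boundedSpectralResolution_le a h)).trans hs.le)
  rw [E.vec_sub (memLp_id_boundedSpectralResolution a h) (s.memLp_of_isFiniteMeasure 2 _)] at h2
  have e : E.vec (fun z => z) h - a h =
      (E.vec (fun z => z) h - E.vec s h) - (a h - E.vec s h) := by abel
  rw [e, zero_add, ← ENNReal.add_halves (ε : ℝ≥0∞)]
  exact enorm_sub_le.trans (add_le_add h2 h1)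

theorem boundedSpectralResolution_commute {b : K →L[ℂ] K} (hb : Commute a b) (Ω : Set ℂ) (h : K) :
    b ((boundedSpectralResolution a).proj Ω h) = (boundedSpectralResolution a).proj Ω (b h) := by
  classical
  -- Fuglede's theorem: commuting with a normal operator implies commuting with its adjoint, and
  -- hence with its continuous calculus.
  have hb' : Commute (star a) b := (IsStarNormal.commute_star_right ha hb.symm).symm
  by_cases hΩ : MeasurableSet Ω
  · obtain ⟨f, hf⟩ := exists_seq_tendsto_spectralProjFun a hΩ {h, b h}
    refine tendsto_nhds_unique ((b.continuous.tendsto _).comp (hf h (by simp)).2) ?_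
    refine (hf (b h) (by simp)).2.congr fun n => ?_
    exact DFunLike.congr_fun (hb.cfc hb' (f n)) h
  · simp [ResolutionOfIdentity.not_measurable _ Ω hΩ]

end BoundedNormal

/-! ### Normal operators through their graphs -/

section Graph

variable {K : Type*} [NormedAddCommGroup K] [InnerProductSpace ℂ K] [CompleteSpace K]

/-- Subtracting from p ∈ G its projection onto the closure of G₀ leaves an element of G orthogonal
to G₀. The projection is taken in `WithLp 2 (K × K)`, because the product itself carries the sup
norm. -/
theorem le_topologicalClosure_of_orthogonal {G₀ G : Submodule ℂ (K × K)} (hle : G₀ ≤ G)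
    (hG : IsClosed (G : Set (K × K)))
    (h : ∀ p ∈ G, (∀ x ∈ G₀, inner ℂ p.1 x.1 + inner ℂ p.2 x.2 = 0) → p = 0) :
    G ≤ G₀.topologicalClosure := by
  let e := WithLp.prodContinuousLinearEquiv 2 ℂ K K
  let S₀ : Submodule ℂ (WithLp 2 (K × K)) := G₀.comap (e : WithLp 2 (K × K) →ₗ[ℂ] K × K)
  let T := S₀.topologicalClosure
  have hT : IsClosed (T : Set (WithLp 2 (K × K))) := S₀.isClosed_topologicalClosure
  have : CompleteSpace T := hT.completeSpace_coe
  have hTG : ∀ g ∈ T, e g ∈ G := fun g hg => by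
    have hcl : IsClosed {g | e g ∈ G} := hG.preimage e.continuous
    exact closure_minimal (s := (S₀ : Set (WithLp 2 (K × K)))) (fun g hg => hle hg) hcl hg
  intro p hp
  have hr := T.sub_starProjection_mem_orthogonal (e.symm p)
  set q := T.starProjection (e.symm p)
  have hq : q ∈ T := T.starProjection_apply_mem _
  have h0 : p - e q = 0 := by
    refine h _ (G.sub_mem hp (hTG q hq)) fun x hx => ?_
    have hx' : e.symm x ∈ T := S₀.le_topologicalClosure (by
      change e (e.symm x) ∈ G₀
      rwa [e.apply_symm_apply])
    have := Submodule.inner_left_of_mem_orthogonal hx' hr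
    rw [WithLp.prod_inner_apply] at this
    exact this
  rw [sub_eq_zero.1 h0]
  have hmap : Set.MapsTo e (closure (S₀ : Set (WithLp 2 (K × K)))) (closure (G₀ : Set (K × K))) :=
    Set.MapsTo.closure (fun g hg => hg) e.continuous
  exact hmap hq

/-- The graphs `G`, `G'` of a closed densely defined operator and its adjoint, where the operator
is normal. -/
structure IsNormalPair (G G' : Submodule ℂ (K × K)) : Prop where
  closed : IsClosed (G : Set (K × K))
  closed' : IsClosed (G' : Set (K × K))
  injective : ∀ y, ((0 : K), y) ∈ G → y = 0
  injective' : ∀ y, ((0 : K), y) ∈ G' → y = 0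
  adjoint : ∀ x y u v, (x, y) ∈ G' → (u, v) ∈ G → inner ℂ y u = inner ℂ x v
  comm : ∀ x z, (∃ y, (x, y) ∈ G ∧ (y, z) ∈ G') ↔ ∃ y, (x, y) ∈ G' ∧ (y, z) ∈ G
  surj : ∀ u, ∃ x y, (x, y) ∈ G ∧ (y, u - x) ∈ G'

namespace IsNormalPair

variable {G G' : Submodule ℂ (K × K)}

theorem symm (h : IsNormalPair G G') : IsNormalPair G' G where
  closed := h.closed'
  closed' := h.closed
  injective := h.injective'
  injective' := h.injective
  adjoint x y u v hxy huv := by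
    rw [← inner_conj_symm, ← h.adjoint u v x y huv hxy, inner_conj_symm]
  comm x z := (h.comm x z).symm
  surj u := by
    obtain ⟨x, y, hxy⟩ := h.surj u
    obtain ⟨y', hy'⟩ := (h.comm _ _).1 ⟨y, hxy⟩
    exact ⟨x, y', hy'⟩

theorem eq_of_mem (h : IsNormalPair G G') {x y y' : K} (hy : (x, y) ∈ G) (hy' : (x, y') ∈ G) :
    y = y' := by
  have := G.sub_mem hy hy'
  rw [Prod.mk_sub_mk, sub_self] at this
  exact sub_eq_zero.1 (h.injective _ this)

/-- The part of the graph of `A` over the domain of `A* A`. -/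
def coreGraph (G G' : Submodule ℂ (K × K)) : Submodule ℂ (K × K) where
  carrier := {p | p ∈ G ∧ ∃ z, (p.2, z) ∈ G'}
  zero_mem' := ⟨G.zero_mem, 0, G'.zero_mem⟩
  add_mem' := by
    rintro p q ⟨hp, z, hz⟩ ⟨hq, w, hw⟩
    exact ⟨G.add_mem hp hq, z + w, G'.add_mem hz hw⟩
  smul_mem' := by
    rintro c p ⟨hp, z, hz⟩
    exact ⟨G.smul_mem c hp, c • z, G'.smul_mem c hz⟩

/-- D(A*A) is a core for A: if (p, Ap) is orthogonal to the graph of A over it, choose x with x +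
A*Ax = p; then 0 = ⟨p, x⟩ + ⟨Ap, Ax⟩ = ⟨p, x + A*Ax⟩ = ‖p‖². -/
theorem le_closure_coreGraph (h : IsNormalPair G G') :
    G ≤ (coreGraph G G').topologicalClosure := by
  refine le_topologicalClosure_of_orthogonal (fun p hp => hp.1) h.closed ?_
  rintro ⟨p, q⟩ hpq hort
  obtain ⟨x, y, hxy, hyz⟩ := h.surj p
  have h1 := hort (x, y) ⟨hxy, _, hyz⟩
  have h2 := h.symm.adjoint p q y (p - x) hpq hyz
  dsimp only at h1
  rw [h2, inner_sub_right, add_sub_cancel, inner_self_eq_zero] at h1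
  subst h1
  rw [h.injective q hpq]
  rfl

/-- ⟨Ap, Ax⟩ = ⟨p, A*Ax⟩ = ⟨p, AA*x⟩ = ⟨A*p, A*x⟩. -/
theorem inner_eq_of_core (h : IsNormalPair G G') {x y y' z p q q' : K} (hxy : (x, y) ∈ G)
    (hyz : (y, z) ∈ G') (hxy' : (x, y') ∈ G') (hpq : (p, q) ∈ G) (hpq' : (p, q') ∈ G') :
    inner ℂ q y = inner ℂ q' y' := by
  obtain ⟨w, hw, hwz⟩ := (h.comm x z).1 ⟨y, hxy, hyz⟩
  rw [h.symm.eq_of_mem hxy' hw, h.symm.adjoint p q y z hpq hyz, h.adjoint p q' w z hpq' hwz]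

/-- On the core ‖A*x‖ = ‖Ax‖, so along a sequence in the core converging to x in the graph norm of A
the values of A* are Cauchy too; closedness of A* places x in its domain. -/
theorem exists_adjoint (h : IsNormalPair G G') {x y : K} (hxy : (x, y) ∈ G) :
    ∃ y', (x, y') ∈ G' ∧ ∀ p q q', (p, q) ∈ G → (p, q') ∈ G' → inner ℂ q y = inner ℂ q' y' := by
  have hcl : (x, y) ∈ closure (coreGraph G G' : Set (K × K)) := h.le_closure_coreGraph hxy
  obtain ⟨s, hs, hlim⟩ := mem_closure_iff_seq_limit.1 hcl
  have hex : ∀ n, ∃ w, ((s n).1, w) ∈ G' := fun n => by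
    obtain ⟨h1, z, hz⟩ := hs n
    obtain ⟨w, hw, -⟩ := (h.comm (s n).1 z).1 ⟨(s n).2, h1, hz⟩
    exact ⟨w, hw⟩
  choose w hw using hex
  have hnorm : ∀ m n, dist (w m) (w n) = dist (s m).2 (s n).2 := fun m n => by
    obtain ⟨h1, z, hz⟩ := (coreGraph G G').sub_mem (hs m) (hs n)
    have h2 : ((s m - s n).1, w m - w n) ∈ G' := G'.sub_mem (hw m) (hw n)
    have := h.inner_eq_of_core h1 hz h2 h1 h2
    rw [inner_self_eq_norm_sq_to_K, inner_self_eq_norm_sq_to_K] at this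
    have h3 : ‖(s m - s n).2‖ ^ 2 = ‖w m - w n‖ ^ 2 := by exact_mod_cast this
    rw [dist_eq_norm, dist_eq_norm]
    exact ((pow_left_inj₀ (norm_nonneg _) (norm_nonneg _) two_ne_zero).1 h3).symm
  have h2lim : Tendsto (fun n => (s n).2) atTop (𝓝 y) := (continuous_snd.tendsto _).comp hlim
  have h1lim : Tendsto (fun n => (s n).1) atTop (𝓝 x) := (continuous_fst.tendsto _).comp hlim
  have hcau : CauchySeq w := by
    have := h2lim.cauchySeq
    rw [Metric.cauchySeq_iff] at this ⊢
    simpa only [hnorm] using this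
  obtain ⟨y', hy'⟩ := cauchySeq_tendsto_of_complete hcau
  refine ⟨y', h.closed'.mem_of_tendsto (h1lim.prodMk_nhds hy') (Eventually.of_forall hw), ?_⟩
  intro p q q' hpq hpq'
  refine tendsto_nhds_unique (tendsto_const_nhds.inner h2lim)
    ((tendsto_const_nhds.inner hy').congr fun n => ?_)
  obtain ⟨h1, z, hz⟩ := hs n
  exact (h.inner_eq_of_core h1 hz (hw n) hpq hpq').symm

/-- The resolvent `(1 + A)⁻¹` of an accretive normal operator. -/
theorem exists_resolvent (h : IsNormalPair G G')
    (hfull : ∀ x y, (∀ u v, (u, v) ∈ G → inner ℂ y u = inner ℂ x v) → (x, y) ∈ G')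
    (hacc : ∀ x y, (x, y) ∈ G → 0 ≤ (inner ℂ x y).re) :
    ∃ R : K →L[ℂ] K, (∀ u, (R u, u - R u) ∈ G) ∧ ∀ x y, (x, y) ∈ G → R (x + y) = x := by
  -- Accretivity bounds 1 + A below, so 1 + A is injective with closed range.
  have hbound : ∀ x y, (x, y) ∈ G → ‖x‖ ≤ ‖x + y‖ := fun x y hxy => by
    have h1 : ‖x‖ ^ 2 ≤ ‖x‖ * ‖x + y‖ := by
      calc ‖x‖ ^ 2 ≤ (inner ℂ x (x + y)).re := by
            rw [inner_add_right, Complex.add_re]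
            have := hacc x y hxy
            have h2 : (inner ℂ x x).re = ‖x‖ ^ 2 := inner_self_eq_norm_sq (𝕜 := ℂ) x
            linarith
        _ ≤ ‖inner ℂ x (x + y)‖ := Complex.re_le_norm _
        _ ≤ _ := norm_inner_le_norm _ _
    rcases (norm_nonneg x).eq_or_lt with h0 | h0
    · rw [← h0]; positivity
    · rw [sq] at h1
      exact le_of_mul_le_mul_left h1 h0
  have : CompleteSpace G := h.closed.completeSpace_coe
  let f : G →L[ℂ] K := (ContinuousLinearMap.fst ℂ K K + ContinuousLinearMap.snd ℂ K K) ∘L G.subtypeL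
  have hf : ∀ g : G, f g = g.1.1 + g.1.2 := fun g => rfl
  have hanti : ∀ g : G, ‖g‖ ≤ (2 : ℝ≥0) * ‖f g‖ := fun g => by
    have h1 := hbound g.1.1 g.1.2 g.2
    have h2 : ‖g.1.2‖ ≤ ‖f g‖ + ‖g.1.1‖ := by
      have : g.1.2 = f g - g.1.1 := by rw [hf]; abel
      rw [this]; exact norm_sub_le _ _
    rw [← hf] at h1
    change max ‖g.1.1‖ ‖g.1.2‖ ≤ _
    refine max_le ?_ ?_ <;> push_cast <;> linarith [norm_nonneg (f g)]
  have hclosed : IsClosed (LinearMap.range (f : G →ₗ[ℂ] K) : Set K) := by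
    have := (AddMonoidHomClass.antilipschitz_of_bound f hanti).isClosed_range f.uniformContinuous
    have e : (LinearMap.range (f : G →ₗ[ℂ] K) : Set K) = Set.range f := rfl
    rw [e]
    exact this
  have hcompl : CompleteSpace (LinearMap.range (f : G →ₗ[ℂ] K)) := hclosed.completeSpace_coe
  -- If w is orthogonal to the range then A*w = -w. Normality puts w in D(A), and accretivity gives
  -- 0 ≤ Re⟨w, Aw⟩ = Re⟨A*w, w⟩ = -‖w‖².
  have htop : LinearMap.range (f : G →ₗ[ℂ] K) = ⊤ := by
    rw [← Submodule.orthogonal_eq_bot_iff, Submodule.eq_bot_iff]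
    intro w hw
    have hw' : ∀ x y, (x, y) ∈ G → inner ℂ w (x + y) = 0 := fun x y hxy =>
      Submodule.inner_left_of_mem_orthogonal (K := LinearMap.range (f : G →ₗ[ℂ] K))
        ⟨⟨(x, y), hxy⟩, rfl⟩ hw
    have h1 : (w, -w) ∈ G' := hfull _ _ fun u v huv => by
      have := hw' u v huv
      rw [inner_add_right] at this
      rw [inner_neg_left]
      exact neg_eq_of_add_eq_zero_right this
    obtain ⟨q, hq, -⟩ := h.symm.exists_adjoint h1
    have h2 := h.adjoint _ _ _ _ h1 hq
    have h3 := hacc _ _ hq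
    rw [← h2, inner_neg_left, inner_self_eq_norm_sq_to_K, Complex.neg_re] at h3
    have h4 : (0 : ℝ) ≤ -(‖w‖ ^ 2) := by exact_mod_cast h3
    have h5 : ‖w‖ ^ 2 = 0 := le_antisymm (by linarith) (by positivity)
    simpa using h5
  have hsurj : ∀ u, ∃ g : G, f g = u := fun u => by
    have : u ∈ LinearMap.range (f : G →ₗ[ℂ] K) := htop ▸ Submodule.mem_top
    exact this
  have hinj : Function.Injective f :=
    (AddMonoidHomClass.antilipschitz_of_bound f hanti).injective
  choose g hg using hsurj
  let R : K →L[ℂ] K := LinearMap.mkContinuous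
    { toFun := fun u => (g u).1.1
      map_add' := fun u v => by
        have : g (u + v) = g u + g v := hinj (by rw [map_add, hg, hg, hg])
        rw [this]; rfl
      map_smul' := fun c u => by
        have : g (c • u) = c • g u := hinj (by rw [map_smul, hg, hg])
        rw [this]; rfl } 1 fun u => by
      have := hbound _ _ (g u).2
      rw [← hf, hg] at this
      simpa using this
  refine ⟨R, fun u => ?_, fun x y hxy => ?_⟩
  · have : ((g u).1.1, u - (g u).1.1) = (g u).1 := by
      refine Prod.ext rfl ?_
      have := hg u
      rw [hf] at this
      exact sub_eq_of_eq_add' this.symm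
    change ((g u).1.1, u - (g u).1.1) ∈ G
    rw [this]
    exact (g u).2
  · have : g (x + y) = ⟨(x, y), hxy⟩ := hinj (by rw [hg]; rfl)
    change (g (x + y)).1.1 = x
    rw [this]

/-- R* = S is the resolvent (1 + A*)⁻¹. Put y₀ = SRb; it lies in D(A*), hence in D(A), and the point
is that (1 + A)y₀ = Sb, for then RSb = y₀ = SRb. -/
theorem isStarNormal_resolvent (h : IsNormalPair G G')
    (hfull : ∀ x y, (∀ u v, (u, v) ∈ G → inner ℂ y u = inner ℂ x v) → (x, y) ∈ G')
    {R : K →L[ℂ] K} (hR : ∀ u, (R u, u - R u) ∈ G) (hR' : ∀ x y, (x, y) ∈ G → R (x + y) = x) :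
    IsStarNormal R := by
  set S := ContinuousLinearMap.adjoint R
  have hS : ∀ u v, inner ℂ (S u) v = inner ℂ u (R v) := fun u v =>
    ContinuousLinearMap.adjoint_inner_left R v u
  have hSG : ∀ u, (S u, u - S u) ∈ G' := fun u => hfull _ _ fun x y hxy => by
    rw [inner_sub_left, sub_eq_iff_eq_add, ← inner_add_right, add_comm y x, hS, hR' x y hxy]
  refine ⟨ContinuousLinearMap.ext fun b => ?_⟩
  rw [ContinuousLinearMap.star_eq_adjoint]
  change S (R b) = R (S b)
  have h1 := hSG (R b)
  set y₀ := S (R b)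
  obtain ⟨q, hq, hid⟩ := h.symm.exists_adjoint h1
  -- Checked weakly against a = (1 + A)x with x = Ra. The four identities are adjointness for the
  -- pairs involved, together with ⟨A*x, A*y₀⟩ = ⟨Ax, Ay₀⟩.
  have key : y₀ + q = S b := by
    refine ext_inner_left ℂ fun a => ?_
    have ha := hR a
    obtain ⟨x', hx', -⟩ := h.exists_adjoint ha
    set x := R a
    have e1 := h.symm.adjoint _ _ _ _ ha h1
    have e2 := h.adjoint _ _ _ _ hx' hq
    have e3 := hid x x' (a - x) hx' ha
    have e4 := h.adjoint _ _ _ _ hx' (hR b)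
    have e5 : inner ℂ a (S b) = inner ℂ x b :=
      ContinuousLinearMap.adjoint_inner_right R a b
    rw [inner_sub_left] at e1 e3
    rw [inner_sub_right] at e1 e3 e4
    rw [e5, inner_add_right]
    linear_combination e1 - e2 - e3 + e4
  rw [← key, hR' y₀ q hq]

end IsNormalPair

/-- The graphs of a normal operator and of its adjoint. -/
theorem isNormalPair_graph {A : K →ₗ.[ℂ] K} (hA : UnboundedOp.IsNormal A) :
    IsNormalPair A.graph A.adjoint.graph ∧
      ∀ x y, (∀ u v, (u, v) ∈ A.graph → inner ℂ y u = inner ℂ x v) → (x, y) ∈ A.adjoint.graph := by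
  obtain ⟨hd, hcl, hcomm⟩ := hA
  have hfull : ∀ x y, (∀ u v, (u, v) ∈ A.graph → inner ℂ y u = inner ℂ x v) →
      (x, y) ∈ A.adjoint.graph := fun x y hxy => by
    have hxy' : ∀ u : A.domain, inner ℂ y (u : K) = inner ℂ x (A u) := fun u =>
      hxy _ _ (A.mem_graph u)
    have hx : x ∈ A.adjoint.domain := LinearPMap.mem_adjoint_domain_of_exists x ⟨y, hxy'⟩
    have := LinearPMap.adjoint_apply_eq hd ⟨x, hx⟩ hxy'
    rw [← this]
    exact A.adjoint.mem_graph ⟨x, hx⟩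
  have hadj : ∀ x y u v, (x, y) ∈ A.adjoint.graph → (u, v) ∈ A.graph →
      inner ℂ y u = inner ℂ x v := fun x y u v hxy huv => by
    obtain ⟨x', hx1, hx2⟩ := (LinearPMap.mem_graph_iff _).1 hxy
    obtain ⟨u', hu1, hu2⟩ := (LinearPMap.mem_graph_iff _).1 huv
    dsimp only at hx1 hx2 hu1 hu2
    rw [← hx1, ← hx2, ← hu1, ← hu2]
    exact LinearPMap.adjoint_isFormalAdjoint hd x' u'
  have hmul : ∀ (A B : K →ₗ.[ℂ] K) x z, (∃ y, (x, y) ∈ A.graph ∧ (y, z) ∈ B.graph) ↔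
      (x, z) ∈ (UnboundedOp.mul B A).graph := fun A B x z => by
    constructor
    · rintro ⟨y, hxy, hyz⟩
      obtain ⟨x', hx1, hx2⟩ := (LinearPMap.mem_graph_iff _).1 hxy
      obtain ⟨y', hy1, hy2⟩ := (LinearPMap.mem_graph_iff _).1 hyz
      obtain ⟨x', hx'⟩ := x'
      obtain ⟨y', hy'⟩ := y'
      dsimp only at hx1 hx2 hy1 hy2
      subst hx1 hy1 hx2 hy2
      have hm := (UnboundedOp.mem_mul_domain B A x').2 ⟨hx', hy'⟩
      rw [← UnboundedOp.mul_apply B A x' hm hx' hy']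
      exact LinearPMap.mem_graph _ ⟨x', hm⟩
    · intro hxz
      obtain ⟨⟨x', hx'⟩, hx1, hx2⟩ := (LinearPMap.mem_graph_iff _).1 hxz
      dsimp only at hx1 hx2
      subst hx1
      obtain ⟨h1, h2⟩ := (UnboundedOp.mem_mul_domain B A x').1 hx'
      rw [UnboundedOp.mul_apply B A x' hx' h1 h2] at hx2
      exact ⟨_, A.mem_graph ⟨x', h1⟩, by rw [← hx2]; exact B.mem_graph ⟨_, h2⟩⟩
  refine ⟨⟨hcl, A.adjoint_isClosed hd, fun y hy => A.graph_fst_eq_zero_snd hy rfl, fun y hy =>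
    A.adjoint.graph_fst_eq_zero_snd hy rfl, hadj, fun x z => ?_, fun u => ?_⟩, hfull⟩
  · rw [hmul, hmul, hcomm]
  -- Surjectivity of 1 + A*A: if (x, Ax) is the projection of (u, 0) onto the graph, orthogonality
  -- of the residue (u - x, -Ax) to the graph says A*Ax = u - x.
  · let e := WithLp.prodContinuousLinearEquiv 2 ℂ K K
    let S : Submodule ℂ (WithLp 2 (K × K)) := A.graph.comap (e : WithLp 2 (K × K) →ₗ[ℂ] K × K)
    have hS : IsClosed (S : Set (WithLp 2 (K × K))) := IsClosed.preimage e.continuous hcl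
    have : CompleteSpace S := hS.completeSpace_coe
    have hr := S.sub_starProjection_mem_orthogonal (e.symm (u, 0))
    set q := S.starProjection (e.symm (u, 0))
    have hq : q ∈ S := S.starProjection_apply_mem _
    refine ⟨(e q).1, (e q).2, hq, hfull _ _ fun x y hxy => ?_⟩
    have hx' : e.symm (x, y) ∈ S := hxy
    have := Submodule.inner_left_of_mem_orthogonal hx' hr
    rw [WithLp.prod_inner_apply] at this
    change inner ℂ (u - (e q).1) x + inner ℂ (0 - (e q).2) y = 0 at this
    rw [zero_sub, inner_neg_left] at this
    linear_combination this

end Graph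

/-! ### The spectral theorem for accretive normal operators -/

namespace ResolutionOfIdentity

variable {K : Type*} [NormedAddCommGroup K] [InnerProductSpace ℂ K] [CompleteSpace K]
  (E : ResolutionOfIdentity K)

open Classical in
/-- The image of a resolution of the identity under a Borel map. -/
def map (ρ : ℂ → ℂ) (hρ : Measurable ρ) : ResolutionOfIdentity K where
  proj Ω := if MeasurableSet Ω then E.proj (ρ ⁻¹' Ω) else 0
  isStarProjection Ω hΩ := by
    rw [if_pos hΩ]
    exact E.isStarProjection _ (hρ hΩ)
  not_measurable Ω hΩ := if_neg hΩ
  empty := by simp [E.empty]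
  univ := by simp [E.univ]
  inter Ω₁ Ω₂ h₁ h₂ := by
    rw [if_pos h₁, if_pos h₂, if_pos (h₁.inter h₂), Set.preimage_inter,
      E.inter _ _ (hρ h₁) (hρ h₂)]
  iUnion Ω hΩ hd h := by
    simp only [hΩ, if_true, MeasurableSet.iUnion hΩ, Set.preimage_iUnion]
    exact E.iUnion _ (fun i => hρ (hΩ i)) (fun i j hij => (hd hij).preimage ρ) h

variable {ρ : ℂ → ℂ} (hρ : Measurable ρ)

theorem map_proj {Ω : Set ℂ} (hΩ : MeasurableSet Ω) :
    (E.map ρ hρ).proj Ω = E.proj (ρ ⁻¹' Ω) := if_pos hΩ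

theorem map_measure (h : K) : (E.map ρ hρ).measure h = (E.measure h).map ρ := by
  ext Ω hΩ
  rw [measure_apply _ hΩ, Measure.map_apply hρ hΩ, measure_apply _ (hρ hΩ), map_proj _ _ hΩ]

theorem map_scalarMeasure (h k : K) :
    (E.map ρ hρ).scalarMeasure h k = (E.scalarMeasure h k).map ρ := by
  ext Ω hΩ
  rw [VectorMeasure.map_apply _ hρ hΩ, scalarMeasure_apply, scalarMeasure_apply, map_proj _ _ hΩ]

theorem memLp_map_iff {φ : ℂ → ℂ} (hφ : Measurable φ) (h : K) :
    MemLp φ 2 ((E.map ρ hρ).measure h) ↔ MemLp (φ ∘ ρ) 2 (E.measure h) := by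
  rw [map_measure, memLp_map_measure_iff hφ.aestronglyMeasurable hρ.aemeasurable]

theorem map_vec {φ : ℂ → ℂ} (hφm : Measurable φ) {h : K}
    (hφ : MemLp (φ ∘ ρ) 2 (E.measure h)) : (E.map ρ hρ).vec φ h = E.vec (φ ∘ ρ) h := by
  refine E.eq_vec hφ fun k => ?_
  rw [inner_vec _ ((E.memLp_map_iff hρ hφm h).2 hφ), map_scalarMeasure, complexIntegral_univ,
    complexIntegral_univ, VectorMeasure.integral_map hρ hφm.aestronglyMeasurable
    (E.integrable_variation hφ k)]
  rfl

theorem memLp_id_iff (h : K) :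
    MemLp (fun z => z) 2 (E.measure h) ↔ ∫⁻ z, ‖z‖ₑ ^ 2 ∂(E.measure h) < ∞ := by
  rw [← eLpNorm_two_sq]
  constructor
  · intro hm
    exact ENNReal.pow_lt_top hm.2
  · intro hm
    refine ⟨by fun_prop, ?_⟩
    by_contra hc
    rw [not_lt_top_iff] at hc
    simp [hc] at hm

theorem isResolutionOf_iff {A : K →ₗ.[ℂ] K} :
    E.IsResolutionOf A ↔ ∀ x y, (x, y) ∈ A.graph ↔
      MemLp (fun z => z) 2 (E.measure x) ∧ y = E.vec (fun z => z) x := by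
  constructor
  · rintro ⟨h1, h2⟩ x y
    constructor
    · intro hxy
      obtain ⟨x', hx1, hx2⟩ := (LinearPMap.mem_graph_iff _).1 hxy
      obtain ⟨x', hx'⟩ := x'
      dsimp only at hx1 hx2
      subst hx1 hx2
      have hm := (E.memLp_id_iff x').2 ((h1 x').1 hx')
      exact ⟨hm, E.eq_vec hm fun k => h2 ⟨x', hx'⟩ k⟩
    · rintro ⟨hm, rfl⟩
      have hx := (h1 x).2 ((E.memLp_id_iff x).1 hm)
      rw [← E.eq_vec hm fun k => h2 ⟨x, hx⟩ k]
      exact A.mem_graph ⟨x, hx⟩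
  · intro h
    refine ⟨fun x => ⟨fun hx => ?_, fun hx => ?_⟩, fun x k => ?_⟩
    · exact (E.memLp_id_iff x).1 ((h _ _).1 (A.mem_graph ⟨x, hx⟩)).1
    · exact A.mem_domain_of_mem_graph ((h _ _).2 ⟨(E.memLp_id_iff x).2 hx, rfl⟩)
    · obtain ⟨h1, h2⟩ := (h _ _).1 (A.mem_graph x)
      rw [h2, E.inner_vec h1]

end ResolutionOfIdentity

section Spectral

variable {K : Type*} [NormedAddCommGroup K] [InnerProductSpace ℂ K] [CompleteSpace K]

/-- A = R⁻¹ - 1 with R = (1 + A)⁻¹ bounded and normal, so the resolution of R is transported by z ↦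
z⁻¹ - 1. A bounded operator preserving the graph of A commutes with R, hence with the projections.
-/
theorem exists_isResolutionOf {A : K →ₗ.[ℂ] K} (hA : UnboundedOp.IsNormal A)
    (hacc : ∀ x y, (x, y) ∈ A.graph → 0 ≤ (inner ℂ x y).re) :
    ∃ E : ResolutionOfIdentity K, E.IsResolutionOf A ∧
      ∀ B : K →L[ℂ] K, (∀ x y, (x, y) ∈ A.graph → (B x, B y) ∈ A.graph) →
        ∀ Ω h, B (E.proj Ω h) = E.proj Ω (B h) := by
  obtain ⟨hp, hfull⟩ := isNormalPair_graph hA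
  obtain ⟨R, hR, hR'⟩ := hp.exists_resolvent hfull hacc
  have : IsStarNormal R := hp.isStarNormal_resolvent hfull hR hR'
  set E := boundedSpectralResolution R
  have hid : ∀ h, MemLp (fun z => z) 2 (E.measure h) := memLp_id_boundedSpectralResolution R
  have hvec : ∀ h, E.vec (fun z => z) h = R h := vec_id_boundedSpectralResolution R
  -- R is injective, so z = 0 carries no mass and the convention 0⁻¹ = 0 in the transporting map is
  -- harmless.
  have h0 : ∀ h, E.proj {0} h = 0 := fun h => by
    have hm : MemLp (Set.indicator {0} fun z : ℂ => z) 2 (E.measure h) :=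
      (hid h).indicator (measurableSet_singleton 0)
    have h1 := (E.vec_proj measurable_id' (measurableSet_singleton 0) hm).2
    have h2 : (Set.indicator {0} fun z : ℂ => z) = fun _ => 0 * 1 := by
      funext z
      by_cases hz : z = 0 <;> simp [hz]
    rw [h2, E.vec_const_mul 0 (memLp_const 1), zero_smul, hvec] at h1
    have h3 := hR (E.proj {0} h)
    rw [h1, sub_zero] at h3
    exact hp.injective _ h3
  have hae : ∀ h, ∀ᵐ z ∂E.measure h, z ≠ 0 := fun h => by
    rw [ae_iff]
    have : {z : ℂ | ¬ z ≠ 0} = {0} := by ext; simp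
    rw [this, E.measure_apply (measurableSet_singleton 0), h0]
    simp
  have hinv : Measurable fun z : ℂ => z⁻¹ := measurable_inv
  have hρ : Measurable fun z : ℂ => z⁻¹ - 1 := hinv.sub_const 1
  refine ⟨E.map _ hρ, (ResolutionOfIdentity.isResolutionOf_iff _).2 fun x y => ?_,
    fun B hB Ω h => ?_⟩
  swap
  · have hcomm : Commute R B := ContinuousLinearMap.ext fun u => by
      have := hR' _ _ (hB _ _ (hR u))
      rw [← map_add, add_sub_cancel] at this
      exact this
    by_cases hΩ : MeasurableSet Ω
    · rw [E.map_proj hρ hΩ]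
      exact boundedSpectralResolution_commute R hcomm _ h
    · simp [ResolutionOfIdentity.not_measurable _ Ω hΩ]
  rw [E.memLp_map_iff hρ measurable_id']
  change _ ↔ MemLp (fun z : ℂ => z⁻¹ - 1) 2 (E.measure x) ∧ _
  have hto : ∀ u, MemLp (fun z : ℂ => z⁻¹ - 1) 2 (E.measure (R u)) ∧
      E.vec (fun z : ℂ => z⁻¹ - 1) (R u) = u - R u := fun u => by
    have hcongr : (fun z : ℂ => (z⁻¹ - 1) * z) =ᵐ[E.measure u] fun z => 1 - z := by
      filter_upwards [hae u] with z hz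
      field_simp
    have hm : MemLp (fun z : ℂ => 1 - z) 2 (E.measure u) := (memLp_const 1).sub (hid u)
    have hm' := (memLp_congr_ae hcongr).2 hm
    rw [← hvec u]
    refine ⟨E.memLp_vec measurable_id' hρ (hid u) hm', ?_⟩
    rw [E.vec_vec measurable_id' hρ (hid u) hm', E.vec_congr_ae hcongr,
      E.vec_sub (memLp_const 1) (hid u), E.vec_one]
  have hmv : MemLp (fun z : ℂ => z⁻¹ - 1) 2 (E.measure x) →
      (E.map _ hρ).vec (fun z => z) x = E.vec (fun z : ℂ => z⁻¹ - 1) x := fun hm =>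
    E.map_vec hρ measurable_id' hm
  constructor
  · intro hxy
    obtain ⟨h1, h2⟩ := hto (x + y)
    rw [hR' x y hxy] at h1 h2
    refine ⟨h1, ?_⟩
    rw [hmv h1, h2]
    abel
  · rintro ⟨hm, rfl⟩
    have hm1 : MemLp (fun z : ℂ => z⁻¹) 2 (E.measure x) := by
      refine (memLp_congr_ae (ae_of_all _ fun z => ?_)).1 (hm.add (memLp_const 1))
      simp
    have hcongr : (fun z : ℂ => z * z⁻¹) =ᵐ[E.measure x] fun _ => 1 := by
      filter_upwards [hae x] with z hz
      field_simp
    have hg : R (E.vec (fun z => z⁻¹) x) = x := by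
      rw [← hvec, E.vec_vec hinv measurable_id' hm1
        ((memLp_congr_ae hcongr).2 (memLp_const 1)), E.vec_congr_ae hcongr, E.vec_one]
    have h1 := hR (E.vec (fun z => z⁻¹) x)
    have h2 := (hto (E.vec (fun z => z⁻¹) x)).2
    rw [← h2, hg] at h1
    rwa [hmv hm]

theorem ContractionSemigroup.re_inner_negGenerator_nonneg (Q : ContractionSemigroup K) (x y : K)
    (hxy : (x, y) ∈ Q.negGenerator.graph) : 0 ≤ (inner ℂ x y).re := by
  obtain ⟨x, rfl, rfl⟩ := (LinearPMap.mem_graph_iff _).1 hxy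
  have h1 := Q.negGenerator_tendsto x
  have h2 : Tendsto (fun t => (inner ℂ (x : K) (Q.diffQuot x t)).re) (𝓝[>] 0)
      (𝓝 (inner ℂ (x : K) (-Q.negGenerator x)).re) :=
    (Complex.continuous_re.tendsto _).comp (tendsto_const_nhds.inner h1)
  rw [inner_neg_right, Complex.neg_re] at h2
  have h3 : ∀ t : ℝ≥0, (inner ℂ (x : K) (Q.diffQuot x t)).re ≤ 0 := fun t => by
    rw [ContractionSemigroup.diffQuot, inner_smul_right, ← Complex.ofReal_inv,
      Complex.re_ofReal_mul]
    refine mul_nonpos_of_nonneg_of_nonpos (by positivity) ?_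
    rw [inner_sub_right, Complex.sub_re, sub_nonpos]
    calc (inner ℂ (x : K) (Q.op t x)).re ≤ ‖inner ℂ (x : K) (Q.op t x)‖ := Complex.re_le_norm _
      _ ≤ ‖(x : K)‖ * ‖Q.op t x‖ := norm_inner_le_norm _ _
      _ ≤ ‖(x : K)‖ * ‖(x : K)‖ := by
        gcongr
        exact (Q.op t).le_of_opNorm_le_of_le (Q.norm_op_le t) le_rfl |>.trans (by simp)
      _ = _ := by
        rw [← sq]
        exact (inner_self_eq_norm_sq (𝕜 := ℂ) (x : K)).symm
  have := le_of_tendsto h2 (Eventually.of_forall h3)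
  linarith

theorem isResolutionOf_spectralResolution (Q : ContractionSemigroup K)
    (hA : UnboundedOp.IsNormal Q.negGenerator) :
    (spectralResolution Q.negGenerator).IsResolutionOf Q.negGenerator :=
  Classical.epsilon_spec ((exists_isResolutionOf hA Q.re_inner_negGenerator_nonneg).imp
    fun _ h => h.1)

end Spectral

namespace ResolutionOfIdentity

variable {K : Type*} [NormedAddCommGroup K] [InnerProductSpace ℂ K] [CompleteSpace K]
  (E : ResolutionOfIdentity K)

/-! ### Bounded Borel functions of a resolution of the identity -/

/-- The bounded operator `φ(E)` for a bounded Borel function `φ`. -/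
def borel (φ : ℂ → ℂ) (hφ : Measurable φ) {C : ℝ} (hC : ∀ z, ‖φ z‖ ≤ C) : K →L[ℂ] K :=
  LinearMap.mkContinuous
    { toFun := fun h => E.vec φ h
      map_add' := fun _ _ => E.vec_add_right (E.memLp_of_bound hφ hC _) (E.memLp_of_bound hφ hC _)
        (E.memLp_of_bound hφ hC _)
      map_smul' := fun c _ => E.vec_smul_right c (E.memLp_of_bound hφ hC _)
        (E.memLp_of_bound hφ hC _) } C (E.norm_vec_le hC)

theorem borel_apply (φ : ℂ → ℂ) (hφ : Measurable φ) {C : ℝ} (hC : ∀ z, ‖φ z‖ ≤ C) (h : K) :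
    E.borel φ hφ hC h = E.vec φ h := rfl

theorem norm_borel_le (φ : ℂ → ℂ) (hφ : Measurable φ) {C : ℝ} (hC : ∀ z, ‖φ z‖ ≤ C) :
    ‖E.borel φ hφ hC‖ ≤ C :=
  ContinuousLinearMap.opNorm_le_bound _ ((norm_nonneg _).trans (hC 0)) (E.norm_vec_le hC)

theorem vec_zero_right (φ : ℂ → ℂ) : E.vec φ 0 = 0 := by
  have h0 : E.measure 0 = 0 := Measure.measure_univ_eq_zero.1 (by rw [measure_univ]; simp)
  have := E.enorm_vec_le φ 0
  rw [h0, eLpNorm_measure_zero] at this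
  simpa using this

theorem measure_eq_zero_iff {Ω : Set ℂ} (hΩ : MeasurableSet Ω) (h : K) :
    E.measure h Ω = 0 ↔ E.proj Ω h = 0 := by
  rw [E.measure_apply hΩ]
  simp

theorem proj_apply_eq_self_iff {Ω : Set ℂ} (hΩ : MeasurableSet Ω) (h : K) :
    E.proj Ω h = h ↔ E.proj Ωᶜ h = 0 := by
  have h1 : h = E.proj Ω h + E.proj Ωᶜ h := by
    rw [← E.vec_indicator_one hΩ, ← E.vec_indicator_one hΩ.compl,
      ← E.vec_add ((memLp_const 1).indicator hΩ) ((memLp_const 1).indicator hΩ.compl)]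
    refine (E.vec_one h).symm.trans (congrArg (fun φ => E.vec φ h) ?_)
    funext z
    by_cases hz : z ∈ Ω <;> simp [hz]
  constructor
  · intro h2
    rw [h2] at h1
    simpa using h1
  · intro h2
    rw [h2, add_zero] at h1
    exact h1.symm

theorem vec_of_proj_eq {φ : ℂ → ℂ} (hφ : Measurable φ) {Ω : Set ℂ} (hΩ : MeasurableSet Ω) {x : K}
    (hx : E.proj Ω x = x) {C : ℝ} (h0 : 0 ≤ C) (hC : ∀ z ∈ Ω, ‖φ z‖ ≤ C) :
    MemLp φ 2 (E.measure x) ∧ ‖E.vec φ x‖ ≤ C * ‖x‖ := by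
  have hb : ∀ z, ‖Ω.indicator φ z‖ ≤ C := fun z => by
    by_cases hz : z ∈ Ω
    · simpa [hz] using hC z hz
    · simpa [hz] using h0
  obtain ⟨h1, h2⟩ := E.vec_proj hφ hΩ (E.memLp_of_bound (hφ.indicator hΩ) hb x)
  rw [hx] at h1 h2
  exact ⟨h1, by rw [h2]; exact E.norm_vec_le hb x⟩

/-- Dominated convergence for |φ_i - ψ|² with respect to d⟨E_z h, h⟩, followed by `enorm_vec_le`. -/
theorem tendsto_vec {ι : Type*} {l : Filter ι} [l.IsCountablyGenerated] {φ : ι → ℂ → ℂ}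
    {ψ : ℂ → ℂ} {h : K} {b : ℂ → ℂ} (hφ : ∀ i, MemLp (φ i) 2 (E.measure h))
    (hψ : MemLp ψ 2 (E.measure h)) (hb : MemLp b 2 (E.measure h))
    (hle : ∀ i, ∀ᵐ z ∂E.measure h, ‖φ i z - ψ z‖ ≤ ‖b z‖)
    (hlim : ∀ᵐ z ∂E.measure h, Tendsto (fun i => φ i z) l (𝓝 (ψ z))) :
    Tendsto (fun i => E.vec (φ i) h) l (𝓝 (E.vec ψ h)) := by
  rw [tendsto_iff_edist_tendsto_0]
  have key : Tendsto (fun i => eLpNorm (fun z => φ i z - ψ z) 2 (E.measure h)) l (𝓝 0) := by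
    simp only [eLpNorm_two_eq_lintegral]
    have : Tendsto (fun i => ∫⁻ z, ‖φ i z - ψ z‖ₑ ^ 2 ∂E.measure h) l
        (𝓝 (∫⁻ z, 0 ∂E.measure h)) := by
      refine tendsto_lintegral_filter_of_dominated_convergence' (fun z => ‖b z‖ₑ ^ 2)
        (Eventually.of_forall fun i => ((hφ i).1.sub hψ.1).enorm.pow_const 2)
        (Eventually.of_forall fun i => ?_) ?_ ?_
      · filter_upwards [hle i] with z hz
        gcongr
        exact enorm_le_iff_norm_le.2 hz
      · rw [← eLpNorm_two_sq]
        exact (ENNReal.pow_lt_top hb.2).ne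
      · filter_upwards [hlim] with z hz
        have h1 : Tendsto (fun i => ‖φ i z - ψ z‖ₑ) l (𝓝 0) := by
          have := (hz.sub_const (ψ z)).enorm
          simpa using this
        have := (ENNReal.continuous_pow 2).tendsto 0 |>.comp h1
        simpa [Function.comp_def] using this
    rw [lintegral_zero] at this
    have h2 := (ENNReal.continuous_rpow_const (y := (1 / 2 : ℝ))).tendsto 0 |>.comp this
    simpa [Function.comp_def] using h2
  refine tendsto_of_tendsto_of_tendsto_of_le_of_le tendsto_const_nhds key
    (fun _ => zero_le) fun i => ?_
  change edist _ _ ≤ _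
  rw [edist_eq_enorm_sub, ← E.vec_sub (hφ i) hψ]
  exact E.enorm_vec_le _ _

/-! ### The operator of a resolution of the identity: spectrum, kernel and numerical range -/

variable {E} {A : K →ₗ.[ℂ] K}

theorem IsResolutionOf.mem_graph_iff (hE : E.IsResolutionOf A) {x y : K} : (x, y) ∈ A.graph ↔
    MemLp (fun z => z) 2 (E.measure x) ∧ y = E.vec (fun z => z) x :=
  E.isResolutionOf_iff.1 hE x y

theorem IsResolutionOf.proj_ball (hE : E.IsResolutionOf A) (z : ℂ) {r : ℝ} (hr : 0 ≤ r) {x : K}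
    (hx : E.proj (Metric.ball z r) x = x) :
    ∃ y, (x, y) ∈ A.graph ∧ ‖y - z • x‖ ≤ r * ‖x‖ := by
  have h1 := E.vec_of_proj_eq (φ := fun w => w) (C := ‖z‖ + r) measurable_id' measurableSet_ball hx
    (by positivity) fun w hw => by
      have := norm_sub_norm_le w z
      rw [mem_ball_iff_norm] at hw
      linarith
  have h2 := E.vec_of_proj_eq (φ := fun w => w - z * 1) (C := r) (by fun_prop) measurableSet_ball hx
    hr fun w hw => by
      rw [mem_ball_iff_norm] at hw
      simpa using hw.le
  refine ⟨_, hE.mem_graph_iff.2 ⟨h1.1, rfl⟩, ?_⟩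
  have h3 := h2.2
  rwa [E.vec_sub h1.1 ((memLp_const 1).const_mul z), E.vec_const_mul z (memLp_const 1),
    E.vec_one] at h3

theorem IsResolutionOf.notMem_spectrum_iff (hE : E.IsResolutionOf A) (z : ℂ) :
    z ∉ UnboundedOp.spectrum A ↔ ∃ r > 0, E.proj (Metric.ball z r) = 0 := by
  rw [UnboundedOp.spectrum, Set.notMem_compl_iff]
  constructor
  · rintro ⟨R, -, hR⟩
    have hpos : 0 < ‖R‖ + 1 := by positivity
    -- A vector x in the range of this projection is an approximate eigenvector, so ‖x‖ = ‖R(z -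
    -- A)x‖ ≤ ‖R‖(‖R‖ + 1)⁻¹‖x‖, which forces x = 0.
    refine ⟨(‖R‖ + 1)⁻¹, by positivity, ContinuousLinearMap.ext fun h => ?_⟩
    have hx := E.proj_proj_same (Metric.ball z (‖R‖ + 1)⁻¹) h
    set x := E.proj (Metric.ball z (‖R‖ + 1)⁻¹) h
    obtain ⟨y, hxy, hle⟩ := hE.proj_ball z (by positivity) hx
    obtain ⟨x', hx1, hx2⟩ := (LinearPMap.mem_graph_iff _).1 hxy
    dsimp only at hx1 hx2
    have h1 := hR x'
    rw [hx1, hx2] at h1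
    have h2 : ‖x‖ ≤ ‖R‖ * ((‖R‖ + 1)⁻¹ * ‖x‖) := by
      calc ‖x‖ = ‖R (z • x - y)‖ := by rw [h1]
        _ ≤ ‖R‖ * ‖z • x - y‖ := R.le_opNorm _
        _ ≤ _ := by rw [norm_sub_rev]; gcongr
    have h3 : ‖x‖ * (‖R‖ + 1) ≤ ‖R‖ * ‖x‖ := by
      calc ‖x‖ * (‖R‖ + 1) ≤ ‖R‖ * ((‖R‖ + 1)⁻¹ * ‖x‖) * (‖R‖ + 1) := by gcongr
        _ = _ := by field_simp
    have h4 : ‖x‖ ≤ 0 := by linarith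
    simpa using h4
  · rintro ⟨r, hr, hpr⟩
    have hms : MeasurableSet (Metric.ball z r)ᶜ := measurableSet_ball.compl
    have hae : ∀ h, ∀ᵐ w ∂E.measure h, w ∉ Metric.ball z r := fun h => by
      rw [ae_iff]
      simp only [not_not]
      change E.measure h (Metric.ball z r) = 0
      rw [E.measure_eq_zero_iff measurableSet_ball, hpr]
      rfl
    have hne : ∀ w, w ∉ Metric.ball z r → z - w ≠ 0 := fun w hw h0 => by
      rw [sub_eq_zero] at h0
      exact hw (h0 ▸ Metric.mem_ball_self hr)
    -- The resolvent at z is φ(E). Cutting off on the null ball keeps φ bounded by r⁻¹.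
    let φ : ℂ → ℂ := (Metric.ball z r)ᶜ.indicator fun w => (z - w)⁻¹
    have hφ : Measurable φ := Measurable.indicator (by fun_prop) hms
    have hb : ∀ w, ‖φ w‖ ≤ r⁻¹ := fun w => by
      by_cases hw : w ∈ Metric.ball z r
      · simp [φ, hw, hr.le]
      · have h1 : φ w = (z - w)⁻¹ := Set.indicator_of_mem hw _
        rw [h1, norm_inv]
        rw [mem_ball_iff_norm, not_lt, norm_sub_rev] at hw
        gcongr
    have hφm : ∀ h, MemLp φ 2 (E.measure h) := E.memLp_of_bound hφ hb
    have e1 : ∀ h, (fun w => (z - w) * φ w) =ᵐ[E.measure h] fun _ => 1 := fun h => by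
      filter_upwards [hae h] with w hw
      have h1 : φ w = (z - w)⁻¹ := Set.indicator_of_mem hw _
      rw [h1, mul_inv_cancel₀ (hne w hw)]
    have e2 : ∀ h, MemLp (fun w => w * φ w) 2 (E.measure h) := fun h => by
      have hm : MemLp (fun w => z * φ w - 1) 2 (E.measure h) :=
        ((hφm h).const_mul z).sub (memLp_const 1)
      refine (memLp_congr_ae ?_).1 hm
      filter_upwards [e1 h] with w hw
      linear_combination hw
    have hzw : Measurable fun w : ℂ => z - w := by fun_prop
    have hres : ∀ x, MemLp (fun w => w) 2 (E.measure x) →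
        MemLp (fun w => z - w) 2 (E.measure x) ∧
        E.vec (fun w => z - w) x = z • x - E.vec (fun w => w) x := fun x hx => by
      refine ⟨(memLp_const z).sub hx, ?_⟩
      have h1 := E.vec_sub ((memLp_const (1 : ℂ)).const_mul z) hx
      rw [E.vec_const_mul z (memLp_const 1), E.vec_one] at h1
      rw [← h1]
      simp
    refine ⟨E.borel φ hφ hb, fun x => ?_, fun y => ?_⟩
    · have h1 : MemLp (fun w => w) 2 (E.measure (E.vec φ x)) :=
        E.memLp_vec hφ measurable_id' (hφm x) (e2 x)
      have hg := hE.mem_graph_iff.2 ⟨h1, rfl⟩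
      obtain ⟨x', hx1, hx2⟩ := (LinearPMap.mem_graph_iff _).1 hg
      dsimp only at hx1 hx2
      refine ⟨x', hx1, ?_⟩
      rw [hx1, hx2, ← (hres _ h1).2, E.vec_vec hφ hzw (hφm x)
        ((memLp_congr_ae (e1 x)).2 (memLp_const 1)), E.vec_congr_ae (e1 x), E.vec_one]
    · obtain ⟨h1, h2⟩ := hE.mem_graph_iff.1 (A.mem_graph y)
      have e3 : (fun w => φ w * (z - w)) =ᵐ[E.measure (y : K)] fun _ => 1 := by
        filter_upwards [e1 y] with w hw
        rw [← hw, mul_comm]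
      rw [h2, ← (hres _ h1).2, borel_apply, E.vec_vec hzw hφ (hres _ h1).1
        ((memLp_congr_ae e3).2 (memLp_const 1)), E.vec_congr_ae e3, E.vec_one]

theorem proj_eq_zero_of_subset {Ω Ω' : Set ℂ} (h : MeasurableSet Ω) (h' : MeasurableSet Ω')
    (hs : Ω ⊆ Ω') (h0 : E.proj Ω' = 0) : E.proj Ω = 0 := by
  rw [← Set.inter_eq_left.2 hs, E.inter _ _ h h', h0, ContinuousLinearMap.comp_zero]

theorem IsResolutionOf.isClosed_spectrum (hE : E.IsResolutionOf A) :
    IsClosed (UnboundedOp.spectrum A) := by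
  rw [← isOpen_compl_iff, Metric.isOpen_iff]
  intro z hz
  obtain ⟨r, hr, h0⟩ := (hE.notMem_spectrum_iff z).1 hz
  refine ⟨r, hr, fun w hw => ?_⟩
  obtain ⟨s, hs, hsub⟩ := Metric.isOpen_iff.1 Metric.isOpen_ball w hw
  exact (hE.notMem_spectrum_iff w).2
    ⟨s, hs, proj_eq_zero_of_subset measurableSet_ball measurableSet_ball hsub h0⟩

theorem measure_eq_zero_of_balls {S : Set ℂ}
    (hS : ∀ z ∈ S, ∃ r > 0, E.proj (Metric.ball z r) = 0) (h : K) : E.measure h S = 0 :=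
  measure_null_of_locally_null S fun z hz => by
    obtain ⟨r, hr, h0⟩ := hS z hz
    refine ⟨_, mem_nhdsWithin_of_mem_nhds (Metric.ball_mem_nhds z hr), ?_⟩
    rw [E.measure_eq_zero_iff measurableSet_ball, h0]
    rfl

theorem IsResolutionOf.ae_mem_spectrum (hE : E.IsResolutionOf A) (h : K) :
    ∀ᵐ z ∂E.measure h, z ∈ UnboundedOp.spectrum A :=
  measure_eq_zero_of_balls (fun z hz => (hE.notMem_spectrum_iff z).1 hz) h

theorem IsResolutionOf.mem_graph_zero_iff (hE : E.IsResolutionOf A) {x : K} :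
    (x, 0) ∈ A.graph ↔ E.proj {0} x = x := by
  have hms := measurableSet_singleton (0 : ℂ)
  constructor
  · intro hx
    obtain ⟨h1, h2⟩ := hE.mem_graph_iff.1 hx
    have e : (fun z : ℂ => z⁻¹ * z) = ({0} : Set ℂ)ᶜ.indicator fun _ => 1 := by
      funext z
      by_cases hz : z = 0 <;> simp [hz]
    have h3 := E.vec_vec (ψ := fun z : ℂ => z⁻¹) measurable_id' measurable_inv h1
      (e ▸ (memLp_const 1).indicator hms.compl)
    rw [← h2, vec_zero_right, e, E.vec_indicator_one hms.compl] at h3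
    exact (E.proj_apply_eq_self_iff hms x).2 h3.symm
  · intro hx
    obtain ⟨h1, h2⟩ := E.vec_of_proj_eq (φ := fun w => w) measurable_id' hms hx le_rfl
      (by simp)
    rw [zero_mul, norm_le_zero_iff] at h2
    exact hE.mem_graph_iff.2 ⟨h1, h2.symm⟩

/-- The numerical-range half of the gap is the one used: the infimum over positive real parts of the
spectrum says nothing about nonzero purely imaginary points. A nonzero x in the range of E on a
small ball around an excluded z would be orthogonal to the kernel, with Re⟨Ax, x⟩ ≤ (Re z + r)‖x‖² <
γ₁‖x‖². -/
theorem IsResolutionOf.ae_eq_zero_or_gap_le (hE : E.IsResolutionOf A) {γ₁ : ℝ}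
    (hgap : UnboundedOp.IsSpectralGap A γ₁) (h : K) :
    ∀ᵐ z ∂E.measure h, z = 0 ∨ γ₁ ≤ z.re := by
  refine measure_eq_zero_of_balls (fun z hz => ?_) h
  simp only [Set.mem_compl_iff, Set.mem_ofPred_eq, not_or, not_le] at hz
  obtain ⟨hz0, hz1⟩ := hz
  -- The first bound keeps Re z + r below γ₁; the second keeps 0 outside the ball, which gives
  -- orthogonality to ker A, the range of E_{0}.
  set r := min ((γ₁ - z.re) / 2) (‖z‖ / 2)
  have hr : 0 < r := lt_min (by linarith) (by positivity)
  have hr1 : r ≤ (γ₁ - z.re) / 2 := min_le_left _ _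
  have hr2 : r ≤ ‖z‖ / 2 := min_le_right _ _
  refine ⟨r, hr, ContinuousLinearMap.ext fun h => ?_⟩
  have hx := E.proj_proj_same (Metric.ball z r) h
  set x := E.proj (Metric.ball z r) h
  by_contra hx0
  change x ≠ 0 at hx0
  obtain ⟨y, hxy, hle⟩ := hE.proj_ball z hr.le hx
  obtain ⟨x', hx1, hx2⟩ := (LinearPMap.mem_graph_iff _).1 hxy
  dsimp only at hx1 hx2
  have hpos : 0 < ‖x‖ ^ 2 := by positivity
  have hnum := hgap.2.2.1 ⟨x', by rwa [hx1], fun u hu => ?_, rfl⟩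
  · rw [hx1, hx2, le_div_iff₀ hpos] at hnum
    have h1 : (inner ℂ x y).re = z.re * ‖x‖ ^ 2 + (inner ℂ x (y - z • x)).re := by
      rw [inner_sub_right, inner_smul_right, inner_self_eq_norm_sq_to_K, Complex.sub_re]
      have : (z * (((‖x‖ : ℝ) : ℂ)) ^ 2).re = z.re * ‖x‖ ^ 2 := by
        rw [← Complex.ofReal_pow, Complex.re_mul_ofReal]
      rw [this.symm]
      simp
    have h2 : (inner ℂ x (y - z • x)).re ≤ r * ‖x‖ ^ 2 := by
      calc _ ≤ ‖inner ℂ x (y - z • x)‖ := Complex.re_le_norm _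
        _ ≤ ‖x‖ * ‖y - z • x‖ := norm_inner_le_norm _ _
        _ ≤ ‖x‖ * (r * ‖x‖) := by gcongr
        _ = _ := by ring
    nlinarith
  · rw [hx1, ← hx, ← inner_proj_left]
    have hu0 : ((u : K), (0 : K)) ∈ A.graph := hu ▸ A.mem_graph u
    have h3 := hE.mem_graph_zero_iff.1 hu0
    have h4 : Metric.ball z r ∩ {0} = ∅ := by
      rw [Set.inter_singleton_eq_empty, mem_ball_iff_norm, zero_sub, norm_neg]
      have := norm_pos_iff.2 hz0
      linarith
    rw [← h3, E.proj_proj measurableSet_ball (measurableSet_singleton 0), h4, E.empty]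
    simp

end ResolutionOfIdentity

/-! ### A contraction semigroup is determined by its generator -/

namespace ContractionSemigroup

variable {H : Type*} [NormedAddCommGroup H] [InnerProductSpace ℂ H] (P : ContractionSemigroup H)

theorem norm_op_apply_le (t : ℝ≥0) (f : H) : ‖P.op t f‖ ≤ ‖f‖ :=
  ((P.op t).le_of_opNorm_le (P.norm_op_le t) f).trans_eq (one_mul _)

theorem op_op (t s : ℝ≥0) (f : H) : P.op t (P.op s f) = P.op (t + s) f := by
  rw [P.op_add]
  rfl

theorem norm_op_sub_op_le (s t : ℝ≥0) (f : H) :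
    ‖P.op s f - P.op t f‖ ≤ ‖P.op (nndist s t) f - f‖ := by
  have key : ∀ s u : ℝ≥0, ‖P.op (s + u) f - P.op s f‖ ≤ ‖P.op u f - f‖ := fun s u => by
    rw [← op_op, ← map_sub]
    exact P.norm_op_apply_le s _
  rcases le_total s t with h | h
  · obtain ⟨u, rfl⟩ := exists_add_of_le h
    rw [norm_sub_rev, NNReal.nndist_eq, tsub_eq_zero_of_le h, add_tsub_cancel_left, max_eq_right
      zero_le]
    exact key s u
  · obtain ⟨u, rfl⟩ := exists_add_of_le h
    rw [NNReal.nndist_eq, tsub_eq_zero_of_le h, add_tsub_cancel_left, max_eq_left zero_le]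
    exact key t u

theorem continuous_op_apply : Continuous fun p : ℝ≥0 × H => P.op p.1 p.2 := by
  refine continuous_iff_continuousAt.2 fun p => ?_
  rw [ContinuousAt, tendsto_iff_norm_sub_tendsto_zero]
  have h1 : Tendsto (fun q : ℝ≥0 × H => ‖q.2 - p.2‖ + ‖P.op (nndist q.1 p.1) p.2 - p.2‖) (𝓝 p)
      (𝓝 (0 + 0)) := by
    refine Tendsto.add ?_ ?_
    · exact tendsto_iff_norm_sub_tendsto_zero.1 (continuous_snd.tendsto p)
    · have h2 : Tendsto (fun q : ℝ≥0 × H => nndist q.1 p.1) (𝓝 p) (𝓝 0) := by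
        have : Continuous fun q : ℝ≥0 × H => nndist q.1 p.1 := by fun_prop
        have := this.tendsto p
        rwa [nndist_self] at this
      exact tendsto_iff_norm_sub_tendsto_zero.1 ((P.strong_cont p.2).comp h2)
  rw [add_zero] at h1
  refine squeeze_zero (fun _ => norm_nonneg _) (fun q => ?_) h1
  have e : P.op q.1 q.2 - P.op p.1 p.2 =
      P.op q.1 (q.2 - p.2) + (P.op q.1 p.2 - P.op p.1 p.2) := by
    rw [map_sub]
    abel
  rw [e]
  exact (norm_add_le _ _).trans
    (add_le_add (P.norm_op_apply_le _ _) (P.norm_op_sub_op_le _ _ _))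

theorem op_mem_domain (s : ℝ≥0) {f : H} (hf : f ∈ P.negGenerator.domain) :
    P.op s f ∈ P.negGenerator.domain := by
  obtain ⟨g, hg⟩ := hf
  refine ⟨P.op s g, (((P.op s).continuous.tendsto g).comp hg).congr fun t => ?_⟩
  simp only [Function.comp_def, diffQuot, map_smul, map_sub, op_op, add_comm]

/-- The map s ↦ S_{t-s} P_s f has zero right derivative on [0, t) for f in the domain, so its end
values S_t f and P_t f agree. -/
theorem op_eq_of_diffQuot {P S : ContractionSemigroup H}
    (hd : Dense (P.negGenerator.domain : Set H))
    (h : ∀ g : P.negGenerator.domain, Tendsto (S.diffQuot g) (𝓝[>] 0) (𝓝 (-P.negGenerator g)))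
    (t : ℝ≥0) : P.op t = S.op t := by
  have key : ∀ f ∈ P.negGenerator.domain, P.op t f = S.op t f := fun f hf => by
    let φ : ℝ → H := fun s => S.op (t - s.toNNReal) (P.op s.toNNReal f)
    have hφ : Continuous φ := S.continuous_op_apply.comp
      (f := fun s : ℝ => (t - s.toNNReal, P.op s.toNNReal f)) (by
        refine Continuous.prodMk (by fun_prop) ?_
        exact P.continuous_op_apply.comp (f := fun s : ℝ => (s.toNNReal, f)) (by fun_prop))
    have hder : ∀ s ∈ Set.Ico (0 : ℝ) t, HasDerivWithinAt φ 0 (Set.Ici s) s := fun s hs => by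
      rw [← hasDerivWithinAt_Ioi_iff_Ici,
        hasDerivWithinAt_iff_tendsto_slope' Set.self_notMem_Ioi]
      have hg := P.op_mem_domain s.toNNReal hf
      set g := P.op s.toNNReal f with hgdef
      have hη : Tendsto (fun r : ℝ => (r - s).toNNReal) (𝓝[>] s) (𝓝[>] 0) := by
        refine tendsto_nhdsWithin_iff.2 ⟨?_, ?_⟩
        · have h1 : Continuous fun r : ℝ => (r - s).toNNReal := by fun_prop
          have := h1.tendsto s
          rw [sub_self, Real.toNNReal_zero] at this
          exact this.mono_left nhdsWithin_le_nhds
        · filter_upwards [self_mem_nhdsWithin] with r hr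
          exact Real.toNNReal_pos.2 (sub_pos.2 hr)
      have h2 := ((P.negGenerator_tendsto ⟨g, hg⟩).sub (h ⟨g, hg⟩)).comp hη
      rw [sub_self] at h2
      refine squeeze_zero_norm' ?_ (tendsto_zero_iff_norm_tendsto_zero.1 h2)
      have hmem : Set.Ioc s (t : ℝ) ∈ 𝓝[>] s := Ioc_mem_nhdsGT hs.2
      filter_upwards [hmem] with r hr
      have hsr : r.toNNReal = (r - s).toNNReal + s.toNNReal := by
        rw [← Real.toNNReal_add (sub_nonneg.2 hr.1.le) hs.1, sub_add_cancel]
      have hrt : r.toNNReal ≤ t := Real.toNNReal_le_iff_le_coe.2 hr.2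
      have hst : t - s.toNNReal = (t - r.toNNReal) + (r - s).toNNReal := by
        refine tsub_eq_of_eq_add ?_
        rw [add_assoc, ← hsr, tsub_add_cancel_of_le hrt]
      -- Both difference quotients are taken at the same vector P_s f, and S_{t-r} is a contraction,
      -- so no differentiability of S along the moving argument is required.
      have e : slope φ s r = S.op (t - r.toNNReal)
          (P.diffQuot g (r - s).toNNReal - S.diffQuot g (r - s).toNNReal) := by
        have e1 : φ r = S.op (t - r.toNNReal) (P.op (r - s).toNNReal g) := by
          rw [hgdef, op_op, ← hsr]
        have e2 : φ s = S.op (t - r.toNNReal) (S.op (r - s).toNNReal g) := by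
          rw [op_op, ← hst]
        rw [slope_def_module, e1, e2, diffQuot, diffQuot, ← smul_sub, sub_sub_sub_cancel_right,
          map_smul, map_sub, Real.coe_toNNReal _ (sub_nonneg.2 hr.1.le), ← Complex.ofReal_inv,
          Complex.coe_smul]
      rw [e]
      exact S.norm_op_apply_le _ _
    have := constant_of_has_deriv_right_zero hφ.continuousOn hder t ⟨t.2, le_rfl⟩
    simp only [φ, Real.toNNReal_coe, tsub_self, Real.toNNReal_zero, tsub_zero, S.op_zero,
      P.op_zero] at this
    exact this
  refine ContinuousLinearMap.ext fun f => ?_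
  exact congrFun (Continuous.ext_on hd (P.op t).continuous (S.op t).continuous key) f

end ContractionSemigroup

/-! ### The semigroup generated by a resolution of the identity -/

theorem Complex.norm_exp_sub_one_le_of_re_nonpos {z : ℂ} (hz : z.re ≤ 0) :
    ‖Complex.exp z - 1‖ ≤ ‖z‖ := by
  have := Convex.norm_image_sub_le_of_norm_hasDerivWithin_le (f := Complex.exp) (f' := Complex.exp)
    (C := 1) (s := {w : ℂ | w.re ≤ 0}) (x := 0) (y := z)
    (fun w _ => (Complex.hasDerivAt_exp w).hasDerivWithinAt) (fun w hw => by
      rw [Complex.norm_exp]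
      exact Real.exp_le_one_iff.2 hw) (convex_halfSpace_re_le 0) (by simp) hz
  simpa using this

/-- The function `z ↦ e^{-t z}` on the right half plane, extended by `1`. -/
def expDecay (t : ℝ) (z : ℂ) : ℂ := Complex.exp (-(t * if 0 ≤ z.re then z else 0))

theorem measurable_expDecay (t : ℝ) : Measurable (expDecay t) := by
  have : Measurable fun z : ℂ => if 0 ≤ z.re then z else 0 :=
    Measurable.ite (measurableSet_le measurable_const Complex.measurable_re) measurable_id
      measurable_const
  unfold expDecay
  fun_prop

theorem expDecay_of_nonneg (t : ℝ) {z : ℂ} (hz : 0 ≤ z.re) :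
    expDecay t z = Complex.exp (-z * t) := by
  rw [expDecay, if_pos hz]
  congr 1
  ring

theorem norm_expDecay_le (t : ℝ≥0) (z : ℂ) : ‖expDecay t z‖ ≤ 1 := by
  have h0 : 0 ≤ (if 0 ≤ z.re then z else 0).re := by split_ifs with h <;> simp [h]
  rw [expDecay, Complex.norm_exp, Real.exp_le_one_iff, Complex.neg_re, Complex.re_ofReal_mul]
  have := mul_nonneg t.2 h0
  exact neg_nonpos.2 this

namespace ResolutionOfIdentity

variable {K : Type*} [NormedAddCommGroup K] [InnerProductSpace ℂ K] [CompleteSpace K]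
  (E : ResolutionOfIdentity K)

theorem memLp_expDecay (t : ℝ≥0) (h : K) : MemLp (expDecay t) 2 (E.measure h) :=
  E.memLp_of_bound (measurable_expDecay t) (norm_expDecay_le t) h

/-- The semigroup `e^{-t A}` for `A = ∫ z dE_z`. -/
def expSemigroup : ContractionSemigroup K where
  op t := E.borel (expDecay t) (measurable_expDecay t) (norm_expDecay_le t)
  op_zero := ContinuousLinearMap.ext fun h => by
    rw [borel_apply]
    refine Eq.trans (congrArg (fun φ => E.vec φ h) ?_) (E.vec_one h)
    funext z
    simp [expDecay]
  op_add t s := ContinuousLinearMap.ext fun h => by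
    have e : expDecay (t + s : ℝ≥0) = fun z => expDecay t z * expDecay s z := by
      funext z
      rw [expDecay, expDecay, expDecay, ← Complex.exp_add]
      congr 1
      push_cast
      ring
    rw [ContinuousLinearMap.comp_apply, borel_apply, borel_apply, borel_apply,
      E.vec_vec (measurable_expDecay s) (measurable_expDecay t) (E.memLp_expDecay s h)
        (e ▸ E.memLp_expDecay (t + s) h), e]
  norm_op_le t := E.norm_borel_le _ _ _
  strong_cont f := by
    have : Tendsto (fun t : ℝ≥0 => E.vec (expDecay t) f) (𝓝 0) (𝓝 (E.vec (fun _ => 1) f)) := by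
      refine E.tendsto_vec (b := fun _ => 2) (fun t => E.memLp_expDecay t f) (memLp_const 1)
        (memLp_const 2) (fun t => ae_of_all _ fun z => ?_) (ae_of_all _ fun z => ?_)
      · refine (norm_sub_le _ _).trans ?_
        have := norm_expDecay_le t z
        simp only [norm_one, Complex.norm_ofNat]
        linarith
      · have hc : Continuous fun t : ℝ≥0 => expDecay t z := by
          unfold expDecay
          fun_prop
        have := hc.tendsto 0
        simpa [expDecay] using this
    rwa [E.vec_one] at this

/-- |e^{-tz} - 1| ≤ t|z| on the right half plane bounds the distance from the quotient to its limit
by 2|z|, which is square integrable precisely because f is in the domain. -/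
theorem tendsto_diffQuot_expSemigroup {f : K} (hf : MemLp (fun z => z) 2 (E.measure f))
    (hre : ∀ᵐ z ∂E.measure f, 0 ≤ z.re) :
    Tendsto (E.expSemigroup.diffQuot f) (𝓝[>] 0) (𝓝 (-E.vec (fun z => z) f)) := by
  have hm : ∀ t : ℝ≥0, MemLp (fun z => expDecay t z - 1) 2 (E.measure f) := fun t =>
    (E.memLp_expDecay t f).sub (memLp_const 1)
  have e1 : ∀ t, E.expSemigroup.diffQuot f t =
      E.vec (fun z => ((t : ℝ) : ℂ)⁻¹ * (expDecay t z - 1)) f := fun t => by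
    rw [E.vec_const_mul _ (hm t), E.vec_sub (E.memLp_expDecay t f) (memLp_const 1), E.vec_one]
    rfl
  have e2 : -E.vec (fun z => z) f = E.vec (fun z => -1 * z) f := by
    rw [E.vec_const_mul _ hf, neg_one_smul]
  rw [funext e1, e2]
  refine E.tendsto_vec (b := fun z => 2 * z) (fun t => (hm t).const_mul _) (hf.const_mul _)
    (hf.const_mul _) (fun t => ?_) ?_
  · filter_upwards [hre] with z hz
    have h1 : ‖((t : ℝ) : ℂ)⁻¹ * (expDecay t z - 1)‖ ≤ ‖z‖ := by
      rw [expDecay_of_nonneg _ hz, norm_mul, norm_inv, Complex.norm_real, Real.norm_of_nonneg t.coe_nonneg]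
      have h2 := Complex.norm_exp_sub_one_le_of_re_nonpos (z := -z * (t : ℝ)) (by
        rw [Complex.re_mul_ofReal, Complex.neg_re]
        have := mul_nonneg hz t.2
        change -z.re * (t : ℝ) ≤ 0
        have h3 : (0 : ℝ) ≤ z.re * (t : ℝ) := this
        linarith)
      rw [norm_mul, norm_neg, Complex.norm_real, Real.norm_of_nonneg t.coe_nonneg] at h2
      rcases eq_or_ne (t : ℝ) 0 with h0 | h0
      · change (t : ℝ)⁻¹ * _ ≤ _
        rw [h0]
        simp
      · have ht : (0 : ℝ) < t := lt_of_le_of_ne t.2 h0.symm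
        change (t : ℝ)⁻¹ * _ ≤ _
        rw [inv_mul_le_iff₀ ht, mul_comm (t : ℝ)]
        exact h2
    calc _ ≤ ‖((t : ℝ) : ℂ)⁻¹ * (expDecay t z - 1)‖ + ‖-1 * z‖ := norm_sub_le _ _
      _ ≤ ‖z‖ + ‖z‖ := by
        gcongr
        simp
      _ = ‖2 * z‖ := by
        rw [norm_mul, Complex.norm_ofNat]
        ring
  · filter_upwards [hre] with z hz
    have hd : HasDerivAt (fun t : ℝ => Complex.exp (-z * t)) (-1 * z) 0 := by
      have h1 : HasDerivAt (fun t : ℝ => -z * (t : ℂ)) (-z) 0 := by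
        simpa using (Complex.ofRealCLM.hasDerivAt (x := (0 : ℝ))).const_mul (-z)
      simpa using h1.cexp
    have h2 := hd.tendsto_slope_zero_right
    have h3 : Tendsto (fun t : ℝ≥0 => (t : ℝ)) (𝓝[>] 0) (𝓝[>] 0) :=
      tendsto_nhdsWithin_iff.2 ⟨(NNReal.continuous_coe.tendsto 0).mono_left nhdsWithin_le_nhds, by
        filter_upwards [self_mem_nhdsWithin] with t ht
        exact NNReal.coe_pos.2 ht⟩
    refine (h2.comp h3).congr fun t => ?_
    simp only [Function.comp_def, zero_add, expDecay_of_nonneg _ hz, Complex.ofReal_zero, mul_zero,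
      Complex.exp_zero, Complex.real_smul, Complex.ofReal_inv]

end ResolutionOfIdentity

open ResolutionOfIdentity in
theorem ContractionSemigroup.op_eq_vec {K : Type*} [NormedAddCommGroup K] [InnerProductSpace ℂ K]
    [CompleteSpace K] {Q : ContractionSemigroup K} {E : ResolutionOfIdentity K}
    (hE : E.IsResolutionOf Q.negGenerator) (hd : Dense (Q.negGenerator.domain : Set K))
    (hre : ∀ h, ∀ᵐ z ∂E.measure h, 0 ≤ z.re) (t : ℝ≥0) (h : K) :
    Q.op t h = E.vec (expDecay t) h := by
  rw [op_eq_of_diffQuot (S := E.expSemigroup) hd fun g => ?_]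
  · rfl
  · obtain ⟨h1, h2⟩ := hE.mem_graph_iff.1 (Q.negGenerator.mem_graph g)
    rw [h2]
    exact E.tendsto_diffQuot_expSemigroup h1 (hre g)

/-! ### Invariant vectors of contraction semigroups -/

section Equilibrium

variable {H : Type*} [NormedAddCommGroup H] [InnerProductSpace ℂ H] [CompleteSpace H]

/-- ⟨T*u, u⟩ = ‖u‖² and ‖T*u‖ ≤ ‖u‖; expanding, ‖T*u - u‖² ≤ 0. -/
theorem ContinuousLinearMap.adjoint_apply_eq_self_of_norm_le_one {T : H →L[ℂ] H} (hT : ‖T‖ ≤ 1)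
    {u : H} (hu : T u = u) : ContinuousLinearMap.adjoint T u = u := by
  set w := ContinuousLinearMap.adjoint T u
  have h1 : ‖w‖ ≤ ‖u‖ :=
    ((ContinuousLinearMap.adjoint T).le_of_opNorm_le
      (by rwa [LinearIsometryEquiv.norm_map]) u).trans_eq (one_mul _)
  have h2 : (inner ℂ w u).re = ‖u‖ ^ 2 := by
    rw [ContinuousLinearMap.adjoint_inner_left, hu]
    exact inner_self_eq_norm_sq (𝕜 := ℂ) u
  have h3 : ‖w - u‖ ^ 2 = ‖w‖ ^ 2 - 2 * (inner ℂ w u).re + ‖u‖ ^ 2 :=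
    norm_sub_sq (𝕜 := ℂ) w u
  have h4 : ‖w - u‖ ^ 2 ≤ 0 := by nlinarith [norm_nonneg w]
  have h5 : ‖w - u‖ = 0 := by nlinarith [norm_nonneg (w - u)]
  rwa [norm_sub_eq_zero_iff] at h5

/-- Invariant vectors u are fixed by the adjoints as well, so ⟨u, P_t f⟩ is constant in t. Hence f
minus the limit is orthogonal to all invariant vectors. -/
theorem ContractionSemigroup.equilibrium_apply_of_tendsto (P : ContractionSemigroup H) {f g : H}
    (hg : ∀ t, P.op t g = g) (hlim : Tendsto (fun t => P.op t f) atTop (𝓝 g)) :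
    P.equilibrium f = g := by
  refine Submodule.eq_starProjection_of_mem_of_inner_eq_zero (K := P.invariants.toSubmodule) hg
    fun u hu => ?_
  have h1 : ∀ t, inner ℂ u (P.op t f) = inner ℂ u f := fun t => by
    rw [← ContinuousLinearMap.adjoint_inner_left,
      ContinuousLinearMap.adjoint_apply_eq_self_of_norm_le_one (P.norm_op_le t) (hu t)]
  have h2 : Tendsto (fun t => inner ℂ u (P.op t f)) atTop (𝓝 (inner ℂ u g)) :=
    tendsto_const_nhds.inner hlim
  rw [funext h1] at h2
  have h3 := tendsto_nhds_unique tendsto_const_nhds h2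
  rw [← inner_conj_symm, inner_sub_right, h3, sub_self, map_zero]

theorem ContractionSemigroup.equilibrium_op (P : ContractionSemigroup H) (t : ℝ≥0) (f : H) :
    P.op t (P.equilibrium f) = P.equilibrium f :=
  Submodule.starProjection_apply_mem P.invariants.toSubmodule f t

end Equilibrium

/-! ### Bounded Borel functions and uniform norms on a set -/

section Measurability

theorem IsBoundedBorelOn.measurable_indicator {S : Set ℂ} {m : ℂ → ℂ} (h : IsBoundedBorelOn S m)
    (hS : MeasurableSet S) : Measurable (S.indicator m) := by
  refine measurable_of_restrict_of_restrict_compl hS ?_ ?_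
  · have e : S.domRestrict (S.indicator m) = S.domRestrict m := by
      funext z
      exact Set.indicator_of_mem z.2 m
    rw [e]
    exact h.1
  · have e : Sᶜ.domRestrict (S.indicator m) = fun _ => 0 := by
      funext z
      exact Set.indicator_of_notMem z.2 m
    rw [e]
    exact measurable_const

theorem norm_indicator_le_of_forall {S : Set ℂ} {m : ℂ → ℂ} {C : ℝ} (h0 : 0 ≤ C)
    (hC : ∀ z ∈ S, ‖m z‖ ≤ C) (z : ℂ) : ‖S.indicator m z‖ ≤ C := by
  by_cases hz : z ∈ S
  · simpa [hz] using hC z hz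
  · simpa [hz] using h0

theorem IsBoundedBorelOn.exists_bound {S : Set ℂ} {m : ℂ → ℂ} (h : IsBoundedBorelOn S m) :
    ∃ C : ℝ, 0 ≤ C ∧ ∀ z ∈ S, ‖m z‖ ≤ C := by
  obtain ⟨C, hC⟩ := h.2
  exact ⟨|C|, abs_nonneg C, fun z hz => (hC z hz).trans (le_abs_self C)⟩

theorem supNormOn_nonneg (S : Set ℂ) (m : ℂ → ℂ) : 0 ≤ supNormOn S m :=
  Real.iSup_nonneg fun _ => norm_nonneg _

theorem norm_le_supNormOn {S : Set ℂ} {m : ℂ → ℂ} {C : ℝ} (hC : ∀ z ∈ S, ‖m z‖ ≤ C) {z : ℂ}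
    (hz : z ∈ S) : ‖m z‖ ≤ supNormOn S m :=
  le_ciSup (f := fun γ : S => ‖m γ‖) ⟨C, by rintro _ ⟨w, rfl⟩; exact hC w w.2⟩ ⟨z, hz⟩

theorem supNormOn_le {S : Set ℂ} {m : ℂ → ℂ} {C : ℝ} (h0 : 0 ≤ C) (hC : ∀ z ∈ S, ‖m z‖ ≤ C) :
    supNormOn S m ≤ C :=
  Real.iSup_le (fun z => hC z z.2) h0

end Measurability

/-! ### Condition (a) and convergence to equilibrium -/

section Intertwining

variable {H K : Type*} [NormedAddCommGroup H] [InnerProductSpace ℂ H] [CompleteSpace H]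
  [NormedAddCommGroup K] [InnerProductSpace ℂ K] [CompleteSpace K]

theorem inducedMeasure_eq (E : ResolutionOfIdentity K) (Λ : K →L[ℂ] H)
    (f : LinearMap.range (Λ : K →ₗ[ℂ] H)) (g : H) :
    inducedMeasure E Λ f g =
      E.scalarMeasure (pseudoInverse Λ f) (ContinuousLinearMap.adjoint Λ g) := by
  ext Ω _
  rw [ResolutionOfIdentity.scalarMeasure_apply, ContinuousLinearMap.adjoint_inner_left]
  rfl

theorem IsBorelFunctionOf.apply_eq_vec {A : K →ₗ.[ℂ] K} {m : ℂ → ℂ} {M : K →L[ℂ] K}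
    (hE : (spectralResolution A).IsResolutionOf A) (hm : IsBoundedBorelOn (UnboundedOp.spectrum A) m)
    (hM : IsBorelFunctionOf A m M) (h : K) :
    M h = (spectralResolution A).vec ((UnboundedOp.spectrum A).indicator m) h := by
  have hS := hE.isClosed_spectrum.measurableSet
  obtain ⟨C, h0, hC⟩ := hm.exists_bound
  refine ResolutionOfIdentity.eq_vec _ (ResolutionOfIdentity.memLp_of_bound _
    (hm.measurable_indicator hS) (norm_indicator_le_of_forall h0 hC) h) fun k => ?_
  rw [hM, complexIntegral_eq_indicator hS]

theorem conditionA_of_isBorelFunctionOf {A : K →ₗ.[ℂ] K} {m : ℂ → ℂ} {Λ : K →L[ℂ] H}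
    {Λ' : H →L[ℂ] K} (hE : (spectralResolution A).IsResolutionOf A)
    (hm : IsBoundedBorelOn (UnboundedOp.spectrum A) m)
    (hM : IsBorelFunctionOf A m (Λ' ∘L Λ)) :
    ConditionA A Λ (fun γ => m γ / ((‖Λ‖ * ‖Λ'‖ : ℝ) : ℂ)) := by
  intro f g
  set E := spectralResolution A
  set S := UnboundedOp.spectrum A
  have hS : MeasurableSet S := hE.isClosed_spectrum.measurableSet
  obtain ⟨C, h0, hC⟩ := hm.exists_bound
  have hmm := hm.measurable_indicator hS
  set c : ℝ := ‖Λ‖ * ‖Λ'‖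
  set h := pseudoInverse Λ f
  have hL : MemLp (S.indicator m) 2 (E.measure h) :=
    E.memLp_of_bound hmm (norm_indicator_le_of_forall h0 hC) h
  have h1 := E.lintegral_variation_le_norm_vec (hmm.const_mul ((c : ℂ)⁻¹))
    (hL.const_mul ((c : ℂ)⁻¹)) (ContinuousLinearMap.adjoint Λ g)
  rw [E.vec_const_mul _ hL, ← hM.apply_eq_vec hE hm, ContinuousLinearMap.comp_apply,
    (pseudoInverse_spec Λ f).1] at h1
  rw [inducedMeasure_eq]
  calc ∫⁻ γ in S, ‖m γ / (c : ℂ)‖ₑ ∂(E.scalarMeasure h (ContinuousLinearMap.adjoint Λ g)).variation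
      ≤ ∫⁻ γ, ‖(c : ℂ)⁻¹ * S.indicator m γ‖ₑ
        ∂(E.scalarMeasure h (ContinuousLinearMap.adjoint Λ g)).variation := by
        rw [← lintegral_indicator hS]
        refine lintegral_mono fun z => ?_
        by_cases hz : z ∈ S
        · simp only [Set.indicator_of_mem hz]
          rw [div_eq_mul_inv, mul_comm]
        · simp [hz]
    _ ≤ ‖(c : ℂ)⁻¹ • Λ' (f : H)‖ₑ * ‖ContinuousLinearMap.adjoint Λ g‖ₑ := h1
    _ = ENNReal.ofReal (‖(c : ℂ)⁻¹ • Λ' (f : H)‖ * ‖ContinuousLinearMap.adjoint Λ g‖) := by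
      rw [ENNReal.ofReal_mul (norm_nonneg _), ofReal_norm, ofReal_norm]
    _ ≤ _ := by
      refine ENNReal.ofReal_le_ofReal ?_
      have h2 : ‖ContinuousLinearMap.adjoint Λ g‖ ≤ ‖Λ‖ * ‖g‖ :=
        (ContinuousLinearMap.adjoint Λ).le_of_opNorm_le (by rw [LinearIsometryEquiv.norm_map]) g
      have hc : 0 ≤ c := by positivity
      rw [norm_smul, norm_inv, Complex.norm_real, Real.norm_of_nonneg hc]
      calc c⁻¹ * ‖Λ' (f : H)‖ * ‖ContinuousLinearMap.adjoint Λ g‖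
          ≤ c⁻¹ * (‖Λ'‖ * ‖(f : H)‖) * (‖Λ‖ * ‖g‖) := by
            gcongr
            exact Λ'.le_opNorm _
        _ = (c⁻¹ * c) * (‖(f : H)‖ * ‖g‖) := by ring
        _ ≤ 1 * (‖(f : H)‖ * ‖g‖) := by
            gcongr
            -- An inequality rather than c⁻¹ c = 1, so that c = 0 is covered.
            exact inv_mul_le_one
        _ = _ := one_mul _

/-- The spectral data of a normal contraction semigroup with spectral gap `γ₁`. -/
structure HasGapResolution (Q : ContractionSemigroup K) (γ₁ : ℝ) (E : ResolutionOfIdentity K) :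
    Prop where
  pos : 0 < γ₁
  isResolutionOf : E.IsResolutionOf Q.negGenerator
  gap : ∀ h, ∀ᵐ z ∂E.measure h, z = 0 ∨ γ₁ ≤ z.re
  op_eq_vec : ∀ t h, Q.op t h = E.vec (expDecay t) h

theorem hasGapResolution {Q : ContractionSemigroup K} {γ₁ : ℝ}
    (hnormal : UnboundedOp.IsNormal Q.negGenerator)
    (hgap : UnboundedOp.IsSpectralGap Q.negGenerator γ₁) :
    HasGapResolution Q γ₁ (spectralResolution Q.negGenerator) := by
  have hE := isResolutionOf_spectralResolution Q hnormal
  refine ⟨hgap.1, hE, hE.ae_eq_zero_or_gap_le hgap, fun t h => Q.op_eq_vec hE hnormal.1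
    (fun h => ?_) t h⟩
  filter_upwards [hE.ae_eq_zero_or_gap_le hgap h] with z hz
  rcases hz with rfl | hz
  · simp
  · exact hgap.1.le.trans hz

namespace HasGapResolution

variable {Q : ContractionSemigroup K} {γ₁ : ℝ} {E : ResolutionOfIdentity K}

theorem ae_re_nonneg (h : HasGapResolution Q γ₁ E) (x : K) : ∀ᵐ z ∂E.measure x, 0 ≤ z.re := by
  filter_upwards [h.gap x] with z hz
  rcases hz with rfl | hz
  · simp
  · exact h.pos.le.trans hz

theorem op_proj_zero (h : HasGapResolution Q γ₁ E) (t : ℝ≥0) (x : K) :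
    Q.op t (E.proj {0} x) = E.proj {0} x := by
  have e : ({0} : Set ℂ).indicator (expDecay t) = ({0} : Set ℂ).indicator fun _ => 1 := by
    funext z
    by_cases hz : z = 0
    · simp [hz, expDecay]
    · simp [hz]
  rw [h.op_eq_vec, (E.vec_proj (measurable_expDecay t) (measurableSet_singleton 0)
    ((E.memLp_expDecay t x).indicator (measurableSet_singleton 0))).2, e,
    E.vec_indicator_one (measurableSet_singleton 0)]

/-- Almost every z is either 0, where e^{-tz} = 1, or has Re z ≥ γ₁ > 0, where e^{-tz} → 0. -/
theorem tendsto_op (h : HasGapResolution Q γ₁ E) (x : K) :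
    Tendsto (fun t => Q.op t x) atTop (𝓝 (E.proj {0} x)) := by
  rw [← E.vec_indicator_one (measurableSet_singleton 0)]
  simp only [h.op_eq_vec]
  refine E.tendsto_vec (b := fun _ => 2) (fun t => E.memLp_expDecay t x)
    ((memLp_const 1).indicator (measurableSet_singleton 0)) (memLp_const 2)
    (fun t => ae_of_all _ fun z => ?_) ?_
  · refine (norm_sub_le _ _).trans ?_
    have h1 := norm_expDecay_le t z
    have h2 := norm_indicator_le_of_forall (S := {0}) (m := fun _ => (1 : ℂ)) (C := 1) (by simp)
      (by simp) z
    rw [Complex.norm_ofNat]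
    linarith
  · filter_upwards [h.gap x] with z hz
    rcases hz with rfl | hz
    · simp [expDecay]
    · have hz0 : z ≠ 0 := by
        rintro rfl
        exact absurd hz (not_le.2 h.pos)
      have hre : 0 < z.re := h.pos.trans_le hz
      rw [Set.indicator_of_notMem (by simpa using hz0)]
      refine tendsto_zero_iff_norm_tendsto_zero.2 ?_
      simp only [expDecay_of_nonneg _ hre.le, Complex.norm_exp, Complex.re_mul_ofReal,
        Complex.neg_re]
      refine Real.tendsto_exp_atBot.comp ?_
      exact NNReal.tendsto_coe_atTop.2 tendsto_id |>.const_mul_atTop_of_neg (by linarith)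

variable {P : ContractionSemigroup H} {Λ : K →L[ℂ] H} {Λ' : H →L[ℂ] K}

theorem equilibrium_apply (h : HasGapResolution Q γ₁ E) (hΛ : Intertwines P Λ Q) (x : K) :
    P.equilibrium (Λ x) = Λ (E.proj {0} x) := by
  have hint : ∀ t y, P.op t (Λ y) = Λ (Q.op t y) := fun t y => congrArg (fun T => T y) (hΛ t)
  refine P.equilibrium_apply_of_tendsto (fun t => ?_) ?_
  · rw [hint, h.op_proj_zero]
  · simp only [hint]
    exact (Λ.continuous.tendsto _).comp (h.tendsto_op x)

theorem inner_op_eq_complexIntegral (h : HasGapResolution Q γ₁ E) (hΛ : Intertwines P Λ Q)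
    (t : ℝ≥0) (f : LinearMap.range (Λ : K →ₗ[ℂ] H)) (g : H) :
    inner ℂ g (P.op t f) = complexIntegral (UnboundedOp.spectrum Q.negGenerator)
      (fun γ => Complex.exp (-γ * (t : ℝ))) (inducedMeasure E Λ f g) := by
  have hS := h.isResolutionOf.isClosed_spectrum.measurableSet
  have e : P.op t (f : H) = Λ (Q.op t (pseudoInverse Λ f)) := by
    conv_lhs => rw [← (pseudoInverse_spec Λ f).1]
    exact congrArg (fun T => T (pseudoInverse Λ f)) (hΛ t)
  rw [e, ← ContinuousLinearMap.adjoint_inner_left, h.op_eq_vec, E.inner_vec (E.memLp_expDecay t _),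
    inducedMeasure_eq, complexIntegral_eq_indicator hS]
  refine complexIntegral_congr_ae ((E.variation_absolutelyContinuous _ _).ae_le ?_)
  filter_upwards [h.ae_re_nonneg (pseudoInverse Λ f),
    h.isResolutionOf.ae_mem_spectrum (pseudoInverse Λ f)] with z h1 h2
  rw [Set.indicator_of_mem h2, expDecay_of_nonneg _ h1]

/-- `P_t - P_∞ = Λ (∫ e^{-γ t} / m(γ) 1_{Re γ ≥ γ₁} dE_γ) Λ'`. -/
theorem op_sub_equilibrium (h : HasGapResolution Q γ₁ E) (hΛ : Intertwines P Λ Q)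
    (hdense : DenseRange Λ) {m : ℂ → ℂ}
    (hm : IsBoundedBorelOn (UnboundedOp.spectrum Q.negGenerator) m)
    (hM : ∀ x, Λ' (Λ x) = E.vec ((UnboundedOp.spectrum Q.negGenerator).indicator m) x)
    (hm0 : ∀ γ ∈ UnboundedOp.spectrum Q.negGenerator, m γ ≠ 0) {t : ℝ≥0} {φ : ℂ → ℂ}
    (hφ : Measurable φ) {C : ℝ} (hC : ∀ z, ‖φ z‖ ≤ C)
    (hφm : ∀ z ∈ UnboundedOp.spectrum Q.negGenerator, φ z = gapMultiplier m γ₁ t z) (f : H) :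
    P.op t f - P.equilibrium f = Λ (E.vec φ (Λ' f)) := by
  have hS := h.isResolutionOf.isClosed_spectrum.measurableSet
  have hmm := hm.measurable_indicator hS
  obtain ⟨D, hD0, hD⟩ := hm.exists_bound
  have hmL : ∀ x, MemLp ((UnboundedOp.spectrum Q.negGenerator).indicator m) 2 (E.measure x) :=
    E.memLp_of_bound hmm (norm_indicator_le_of_forall hD0 hD)
  have key : ∀ x, P.op t (Λ x) - P.equilibrium (Λ x) = Λ (E.vec φ (Λ' (Λ x))) := fun x => by
    have hint : P.op t (Λ x) = Λ (Q.op t x) := congrArg (fun T => T x) (hΛ t)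
    rw [h.equilibrium_apply hΛ, hint, ← map_sub, hM, h.op_eq_vec,
      ← E.vec_indicator_one (measurableSet_singleton 0), ← E.vec_sub (E.memLp_expDecay t x)
        ((memLp_const 1).indicator (measurableSet_singleton 0))]
    -- At z = 0 both sides vanish, the left one because 0 < γ₁ switches the multiplier off; where Re
    -- z ≥ γ₁ the factor m cancels and the indicator of {0} is zero.
    have e : (fun z => φ z * (UnboundedOp.spectrum Q.negGenerator).indicator m z)
        =ᵐ[E.measure x] fun z => expDecay t z - ({0} : Set ℂ).indicator (fun _ => 1) z := by
      filter_upwards [h.gap x, h.isResolutionOf.ae_mem_spectrum x] with z h1 h2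
      rw [Set.indicator_of_mem h2, hφm z h2, gapMultiplier]
      rcases h1 with rfl | h1
      · rw [if_neg (by simpa using h.pos)]
        simp [expDecay]
      · have hz0 : z ≠ 0 := by
          rintro rfl
          exact absurd h1 (not_le.2 h.pos)
        rw [if_pos h1, Set.indicator_of_notMem (by simpa using hz0), sub_zero,
          expDecay_of_nonneg _ (h.pos.le.trans h1), div_mul_cancel₀ _ (hm0 z h2)]
    rw [E.vec_vec hmm hφ (hmL x) ((memLp_congr_ae e).2 ((E.memLp_expDecay t x).sub
      ((memLp_const 1).indicator (measurableSet_singleton 0)))), E.vec_congr_ae e]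
  have hcont : Continuous fun f => Λ (E.vec φ (Λ' f)) :=
    (Λ ∘L E.borel φ hφ hC ∘L Λ').continuous
  refine congrFun (Continuous.ext_on hdense
    ((P.op t).continuous.sub P.equilibrium.continuous) hcont ?_) f
  rintro _ ⟨x, rfl⟩
  exact key x

/-- Normalising m by c = ‖Λ‖‖Λ'‖ multiplies the multiplier by c, exactly the cost of the outer
factors in P_t - P_∞ = Λ φ(E) Λ'. -/
theorem norm_op_sub_equilibrium_le (h : HasGapResolution Q γ₁ E) (hΛ : Intertwines P Λ Q)
    (hdense : DenseRange Λ) {m : ℂ → ℂ}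
    (hm : IsBoundedBorelOn (UnboundedOp.spectrum Q.negGenerator) m)
    (hM : ∀ x, Λ' (Λ x) = E.vec ((UnboundedOp.spectrum Q.negGenerator).indicator m) x)
    (hm0 : ∀ γ ∈ UnboundedOp.spectrum Q.negGenerator, m γ ≠ 0) {t : ℝ≥0}
    (hmt : IsBoundedBorelOn (UnboundedOp.spectrum Q.negGenerator)
      fun γ => Complex.exp (-γ * (t : ℝ)) / m γ) (f : H) :
    ‖P.op t f - P.equilibrium f‖ ≤ supNormOn (UnboundedOp.spectrum Q.negGenerator)
      (gapMultiplier (fun γ => m γ / ((‖Λ‖ * ‖Λ'‖ : ℝ) : ℂ)) γ₁ t) * ‖f - P.equilibrium f‖ := by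
  set S := UnboundedOp.spectrum Q.negGenerator
  have hS : MeasurableSet S := h.isResolutionOf.isClosed_spectrum.measurableSet
  obtain ⟨C, hC0, hC⟩ := hmt.exists_bound
  set c : ℝ := ‖Λ‖ * ‖Λ'‖
  have hc0 : 0 ≤ c := by positivity
  have hle : ∀ z ∈ S, ‖gapMultiplier m γ₁ t z‖ ≤ C := fun z hz => by
    rw [gapMultiplier]
    split_ifs
    · exact hC z hz
    · simpa using hC0
  have hcm : ∀ z, gapMultiplier (fun γ => m γ / (c : ℂ)) γ₁ t z = c * gapMultiplier m γ₁ t z :=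
    fun z => by
    rw [gapMultiplier, gapMultiplier]
    split_ifs
    · rw [div_div_eq_mul_div]
      ring
    · rw [mul_zero]
  have hle' : ∀ z ∈ S, ‖gapMultiplier (fun γ => m γ / (c : ℂ)) γ₁ t z‖ ≤ c * C := fun z hz => by
    rw [hcm, norm_mul, Complex.norm_real, Real.norm_of_nonneg hc0]
    gcongr
    exact hle z hz
  set N := supNormOn S (gapMultiplier (fun γ => m γ / (c : ℂ)) γ₁ t)
  let φ : ℂ → ℂ := {z : ℂ | γ₁ ≤ z.re}.indicator
    (S.indicator fun γ => Complex.exp (-γ * (t : ℝ)) / m γ)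
  have hφ : Measurable φ := (hmt.measurable_indicator hS).indicator
    (measurableSet_le measurable_const Complex.measurable_re)
  have hφm : ∀ z ∈ S, φ z = gapMultiplier m γ₁ t z := fun z hz => by
    by_cases h1 : γ₁ ≤ z.re <;> simp [φ, gapMultiplier, Set.indicator, h1, hz]
  have hφ0 : ∀ z, z ∉ S → φ z = 0 := fun z hz => by
    simp [φ, Set.indicator_apply, hz]
  have hφC : ∀ z, ‖φ z‖ ≤ C := fun z => by
    by_cases hz : z ∈ S
    · rw [hφm z hz]
      exact hle z hz
    · simpa [hφ0 z hz] using hC0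
  have hφN : ∀ z, ‖(c : ℂ) * φ z‖ ≤ N := fun z => by
    by_cases hz : z ∈ S
    · rw [hφm z hz, ← hcm]
      exact norm_le_supNormOn hle' hz
    · rw [hφ0 z hz, mul_zero, norm_zero]
      exact supNormOn_nonneg _ _
  have hvec : ∀ x, c * ‖E.vec φ x‖ ≤ N * ‖x‖ := fun x => by
    have := E.norm_vec_le hφN x
    rwa [E.vec_const_mul _ (E.memLp_of_bound hφ hφC x), norm_smul, Complex.norm_real,
      Real.norm_of_nonneg hc0] at this
  have hop : ∀ g, ‖Λ (E.vec φ (Λ' g))‖ ≤ N * ‖g‖ := fun g => by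
    -- If c = 0, then `Λ` or `Λ'` is zero and the left side vanishes.
    rcases eq_or_lt_of_le hc0 with h0 | h0
    · have h1 : ‖Λ (E.vec φ (Λ' g))‖ ≤ c * (C * ‖g‖) := by
        calc _ ≤ ‖Λ‖ * ‖E.vec φ (Λ' g)‖ := Λ.le_opNorm _
          _ ≤ ‖Λ‖ * (C * (‖Λ'‖ * ‖g‖)) := by
            gcongr
            refine (E.norm_vec_le hφC _).trans ?_
            gcongr
            exact Λ'.le_opNorm g
          _ = _ := by ring
      rw [← h0, zero_mul] at h1
      exact h1.trans (mul_nonneg (supNormOn_nonneg _ _) (norm_nonneg g))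
    · refine le_of_mul_le_mul_left ?_ h0
      calc c * ‖Λ (E.vec φ (Λ' g))‖ ≤ c * (‖Λ‖ * ‖E.vec φ (Λ' g)‖) := by
            gcongr
            exact Λ.le_opNorm _
        _ = ‖Λ‖ * (c * ‖E.vec φ (Λ' g)‖) := by ring
        _ ≤ ‖Λ‖ * (N * (‖Λ'‖ * ‖g‖)) := by
            refine mul_le_mul_of_nonneg_left ((hvec _).trans ?_) (norm_nonneg _)
            exact mul_le_mul_of_nonneg_left (Λ'.le_opNorm g) (supNormOn_nonneg _ _)
        _ = _ := by ring
  have hidem : P.equilibrium (P.equilibrium f) = P.equilibrium f :=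
    Submodule.starProjection_eq_self_iff.2 (Submodule.starProjection_apply_mem _ f)
  -- Applied to f - P_∞f instead of f: P_∞ kills this vector and P_t fixes P_∞f, so the left side is
  -- unchanged.
  have e := h.op_sub_equilibrium hΛ hdense hm hM hm0 hφ hφC hφm (f - P.equilibrium f)
  rw [map_sub, map_sub, P.equilibrium_op, hidem, sub_self, sub_zero] at e
  rw [e]
  exact hop _

theorem convergenceConclusions (h : HasGapResolution Q γ₁ (spectralResolution Q.negGenerator))
    (hΛ : Intertwines P Λ Q) (hdense : DenseRange Λ) {m : ℂ → ℂ}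
    (hm : IsBoundedBorelOn (UnboundedOp.spectrum Q.negGenerator) m)
    (hM : IsBorelFunctionOf Q.negGenerator m (Λ' ∘L Λ)) {T : ℝ}
    (hB : ConditionB Q.negGenerator m T) :
    ConvergenceConclusions P Q.negGenerator Λ γ₁
      (fun γ => m γ / ((‖Λ‖ * ‖Λ'‖ : ℝ) : ℂ)) T := by
  intro t ht
  have key := h.norm_op_sub_equilibrium_le hΛ hdense hm
    (hM.apply_eq_vec h.isResolutionOf hm) hB.1 (hB.2 t ht)
  refine ⟨⟨P.op t, h.inner_op_eq_complexIntegral hΛ t⟩, key, fun _ hmax f => ?_⟩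
  refine (key f).trans ?_
  gcongr
  refine (supNormOn_le (norm_nonneg _) hmax).trans_eq ?_
  rw [gapMultiplier, if_pos (by simp), norm_div, Complex.norm_exp, div_eq_mul_one_div, mul_comm]
  simp

end HasGapResolution

end Intertwining

namespace ResolutionOfIdentity

variable {K : Type*} [NormedAddCommGroup K] [InnerProductSpace ℂ K] [CompleteSpace K]

/-! ### Uniqueness of the resolution of the identity -/

section Uniqueness

variable {E F : ResolutionOfIdentity K} {A : K →ₗ.[ℂ] K}

/-- Ax would lie within r‖x‖ of zx and within s‖x‖ of wx, which is impossible for x ≠ 0 when r + s <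
|w - z|. -/
theorem eq_zero_of_proj_ball_of_proj_ball (hE : E.IsResolutionOf A) (hF : F.IsResolutionOf A)
    {z w : ℂ} {r s : ℝ} (hr : 0 ≤ r) (hs : 0 ≤ s) (hrs : r + s < ‖w - z‖) {x : K}
    (hx : E.proj (Metric.ball z r) x = x) (hx' : F.proj (Metric.ball w s) x = x) : x = 0 := by
  obtain ⟨y, hy, hle⟩ := hE.proj_ball z hr hx
  obtain ⟨y', hy', hle'⟩ := hF.proj_ball w hs hx'
  have e : y = y' := (hE.mem_graph_iff.1 hy).2.trans (hE.mem_graph_iff.1 hy').2.symm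
  subst e
  have h1 : ‖w - z‖ * ‖x‖ ≤ r * ‖x‖ + s * ‖x‖ := by
    calc ‖w - z‖ * ‖x‖ = ‖(y - z • x) - (y - w • x)‖ := by
          rw [← norm_smul, sub_smul]
          congr 1
          abel
      _ ≤ _ := (norm_sub_le _ _).trans (add_le_add hle hle')
  by_contra h0
  have h2 : 0 < ‖x‖ := norm_pos_iff.2 h0
  nlinarith

theorem measure_eq_zero_of_proj_ball (hE : E.IsResolutionOf A) (hF : F.IsResolutionOf A)
    (hcomm : ∀ Ω Ω' x, E.proj Ω (F.proj Ω' x) = F.proj Ω' (E.proj Ω x)) {z : ℂ} {r : ℝ}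
    (hr : 0 < r) {x : K} (hx : E.proj (Metric.ball z r) x = x) {S : Set ℂ}
    (hS : ∀ w ∈ S, 2 * r ≤ ‖w - z‖) : F.measure x S = 0 :=
  measure_null_of_locally_null S fun w hw => by
    refine ⟨_, mem_nhdsWithin_of_mem_nhds (Metric.ball_mem_nhds w (half_pos hr)), ?_⟩
    rw [F.measure_eq_zero_iff measurableSet_ball]
    refine eq_zero_of_proj_ball_of_proj_ball (z := z) hE hF hr.le (half_pos hr).le ?_ ?_
      (F.proj_proj_same (Metric.ball w (r / 2)) x)
    · have := hS w hw
      linarith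
    · rw [hcomm, hx]

/-- Near a point w outside C, a vector in the range of F on a small ball around w has no E-mass on
C. Commutation then makes that F-projection kill x = E_C x, so the complement of C is locally null
for F. -/
theorem proj_eq_self_of_isClosed (hE : E.IsResolutionOf A) (hF : F.IsResolutionOf A)
    (hcomm : ∀ Ω Ω' x, E.proj Ω (F.proj Ω' x) = F.proj Ω' (E.proj Ω x)) {C : Set ℂ}
    (hC : IsClosed C) {x : K} (hx : E.proj C x = x) : F.proj C x = x := by
  rw [F.proj_apply_eq_self_iff hC.measurableSet,
    ← F.measure_eq_zero_iff hC.measurableSet.compl]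
  refine measure_null_of_locally_null Cᶜ fun w hw => ?_
  obtain ⟨r, hr, hsub⟩ := Metric.isOpen_iff.1 hC.isOpen_compl w hw
  refine ⟨_, mem_nhdsWithin_of_mem_nhds (Metric.ball_mem_nhds w (half_pos hr)), ?_⟩
  rw [F.measure_eq_zero_iff measurableSet_ball]
  have h1 := measure_eq_zero_of_proj_ball hF hE (fun Ω Ω' x => (hcomm Ω' Ω x).symm) (half_pos hr)
    (F.proj_proj_same (Metric.ball w (r / 2)) x) (S := C) fun c hc => by
      have : c ∉ Metric.ball w r := fun h => hsub h hc
      rw [mem_ball_iff_norm] at this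
      linarith
  rw [E.measure_eq_zero_iff hC.measurableSet, hcomm, hx] at h1
  exact h1

theorem proj_eq_of_commute (hE : E.IsResolutionOf A) (hF : F.IsResolutionOf A)
    (hcomm : ∀ Ω Ω' x, E.proj Ω (F.proj Ω' x) = F.proj Ω' (E.proj Ω x)) {Ω : Set ℂ}
    (hΩ : MeasurableSet Ω) (x : K) : E.proj Ω x = F.proj Ω x := by
  have hclosed : ∀ C, IsClosed C → ∀ x, E.proj C x = F.proj C x := fun C hC x => by
    have h1 := proj_eq_self_of_isClosed hE hF hcomm hC (E.proj_proj_same C x)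
    have h2 := proj_eq_self_of_isClosed hF hE (fun Ω Ω' x => (hcomm Ω' Ω x).symm) hC
      (F.proj_proj_same C x)
    rw [← h1, ← hcomm, h2]
  have hmeas : ∀ x, E.measure x = F.measure x := fun x => by
    refine ext_of_generate_finite _ ?_ isPiSystem_isClosed (fun C hC => ?_) ?_
    · rw [BorelSpace.measurable_eq (α := ℂ), borel_eq_generateFrom_isClosed]
    · rw [E.measure_apply (IsClosed.measurableSet hC), F.measure_apply (IsClosed.measurableSet hC),
        hclosed C hC]
    · rw [E.measure_univ, F.measure_univ]
  -- Agreement on closed sets extends to Borel sets for the measures ‖E_Ω x‖², giving only equal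
  -- kernels; commuting projections with equal kernels coincide.
  have hzero : ∀ x, E.proj Ω x = 0 ↔ F.proj Ω x = 0 := fun x => by
    rw [← E.measure_eq_zero_iff hΩ, ← F.measure_eq_zero_iff hΩ, hmeas]
  have h1 : E.proj Ω (x - F.proj Ω x) = 0 := by
    rw [hzero, map_sub, F.proj_proj_same, sub_self]
  have h2 : F.proj Ω (x - E.proj Ω x) = 0 := by
    rw [← hzero, map_sub, E.proj_proj_same, sub_self]
  rw [map_sub, sub_eq_zero] at h1 h2
  rw [h1, hcomm, ← h2]

end Uniqueness

/-- Bounded operators commuting with an accretive normal operator commute with its resolution of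
the identity. -/
theorem IsResolutionOf.apply_proj_of_commute {E : ResolutionOfIdentity K} {A : K →ₗ.[ℂ] K}
    (hE : E.IsResolutionOf A) (hA : UnboundedOp.IsNormal A)
    (hacc : ∀ x y, (x, y) ∈ A.graph → 0 ≤ (inner ℂ x y).re) {B : K →L[ℂ] K}
    (hB : ∀ x y, (x, y) ∈ A.graph → (B x, B y) ∈ A.graph) {Ω : Set ℂ} (hΩ : MeasurableSet Ω)
    (h : K) : B (E.proj Ω h) = E.proj Ω (B h) := by
  obtain ⟨F, hF, hcomm⟩ := exists_isResolutionOf hA hacc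
  -- F, built from the resolvent, commutes with every bounded operator preserving the graph of A.
  -- The projections of E are such operators, so E and F commute and must be equal.
  have hEF : ∀ h, E.proj Ω h = F.proj Ω h := proj_eq_of_commute hE hF (fun Ω₁ Ω₂ x => by
    by_cases h₁ : MeasurableSet Ω₁
    · refine hcomm (E.proj Ω₁) (fun x y hxy => ?_) Ω₂ x
      obtain ⟨h1, rfl⟩ := hE.mem_graph_iff.1 hxy
      obtain ⟨h2, h3⟩ := E.vec_proj measurable_id' h₁ (h1.indicator h₁)
      exact hE.mem_graph_iff.2 ⟨h2, by rw [h3, E.proj_vec h1 h₁]⟩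
    · simp [E.not_measurable Ω₁ h₁]) hΩ
  rw [hEF, hEF, hcomm B hB]

/-! ### Cyclic vectors -/

section Cyclic

variable (E : ResolutionOfIdentity K)

/-- For k orthogonal to W, invariance makes the whole measure ⟨E x, k⟩ vanish. -/
theorem vec_mem_of_invariant {W : Submodule ℂ K} (hW : IsClosed (W : Set K))
    (hinv : ∀ Ω x, MeasurableSet Ω → x ∈ W → E.proj Ω x ∈ W) {φ : ℂ → ℂ} {x : K} (hx : x ∈ W)
    (hφ : MemLp φ 2 (E.measure x)) : E.vec φ x ∈ W := by
  have : CompleteSpace W := hW.completeSpace_coe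
  rw [← W.orthogonal_orthogonal]
  refine (Submodule.mem_orthogonal _ _).2 fun k hk => ?_
  have e : E.scalarMeasure x k = 0 := by
    ext Ω hΩ
    rw [scalarMeasure_apply]
    exact Submodule.inner_left_of_mem_orthogonal (hinv Ω x hΩ hx) hk
  rw [E.inner_vec hφ, e, complexIntegral_univ, VectorMeasure.integral_zero_vectorMeasure]

theorem proj_mem_orthogonal {W : Submodule ℂ K}
    (hinv : ∀ Ω x, MeasurableSet Ω → x ∈ W → E.proj Ω x ∈ W) {Ω : Set ℂ} (hΩ : MeasurableSet Ω)
    {x : K} (hx : x ∈ Wᗮ) : E.proj Ω x ∈ Wᗮ :=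
  (Submodule.mem_orthogonal _ _).2 fun u hu => by
    rw [← inner_proj_left]
    exact Submodule.inner_right_of_mem_orthogonal (hinv Ω u hΩ hu) hx

theorem tendsto_proj_ball (k : K) :
    Tendsto (fun n : ℕ => E.proj (Metric.ball 0 n) k) atTop (𝓝 k) := by
  have : Tendsto (fun n : ℕ => E.vec ((Metric.ball 0 (n : ℝ)).indicator fun _ => 1) k) atTop
      (𝓝 (E.vec (fun _ => 1) k)) := by
    refine E.tendsto_vec (b := fun _ => 2) (fun n => (memLp_const 1).indicator measurableSet_ball)
      (memLp_const 1) (memLp_const 2) (fun n => ae_of_all _ fun z => ?_) (ae_of_all _ fun z => ?_)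
    · by_cases hz : z ∈ Metric.ball 0 (n : ℝ) <;> simp [Set.indicator, hz]
    · obtain ⟨N, hN⟩ := exists_nat_gt ‖z‖
      refine tendsto_const_nhds.congr' ?_
      filter_upwards [eventually_ge_atTop N] with n hn
      have hz : z ∈ Metric.ball 0 (n : ℝ) := by
        rw [mem_ball_zero_iff]
        exact hN.trans_le (by exact_mod_cast hn)
      rw [Set.indicator_of_mem hz]
  simpa only [E.vec_indicator_one measurableSet_ball, E.vec_one] using this

variable {E}

theorem IsResolutionOf.graph_mem_of_invariant {A : K →ₗ.[ℂ] K} (hE : E.IsResolutionOf A)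
    {W : Submodule ℂ K} (hW : IsClosed (W : Set K))
    (hinv : ∀ Ω x, MeasurableSet Ω → x ∈ W → E.proj Ω x ∈ W) {x y : K} (hxy : (x, y) ∈ A.graph)
    (hx : x ∈ W) : y ∈ W := by
  obtain ⟨h1, rfl⟩ := hE.mem_graph_iff.1 hxy
  exact E.vec_mem_of_invariant hW hinv hx h1

/-- For k orthogonal to W, the truncations of k to balls lie in D(A) and in the orthogonal
complement of W, which A preserves. Hence ⟨A*x, ·⟩ vanishes on them, and they tend to k. -/
theorem IsResolutionOf.adjoint_mem_of_invariant {A : K →ₗ.[ℂ] K} (hE : E.IsResolutionOf A)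
    (hd : Dense (A.domain : Set K)) {W : Submodule ℂ K} (hW : IsClosed (W : Set K))
    (hinv : ∀ Ω x, MeasurableSet Ω → x ∈ W → E.proj Ω x ∈ W) (x : A.adjoint.domain)
    (hx : (x : K) ∈ W) : A.adjoint x ∈ W := by
  have : CompleteSpace W := hW.completeSpace_coe
  rw [← W.orthogonal_orthogonal]
  refine (Submodule.mem_orthogonal _ _).2 fun k hk => ?_
  have h1 : ∀ n : ℕ, inner ℂ (E.proj (Metric.ball 0 n) k) (A.adjoint x) = 0 := fun n => by
    obtain ⟨y, hy, -⟩ := hE.proj_ball 0 n.cast_nonneg (E.proj_proj_same (Metric.ball 0 n) k)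
    obtain ⟨u, hu1, hu2⟩ := (LinearPMap.mem_graph_iff _).1 hy
    dsimp only at hu1 hu2
    have h2 := LinearPMap.adjoint_isFormalAdjoint hd x u
    have h3 : y ∈ Wᗮ := hE.graph_mem_of_invariant W.isClosed_orthogonal
      (fun Ω x hΩ hx => E.proj_mem_orthogonal hinv hΩ hx) hy
      (E.proj_mem_orthogonal hinv measurableSet_ball hk)
    rw [hu1, hu2, Submodule.inner_right_of_mem_orthogonal hx h3] at h2
    rw [← inner_conj_symm, h2, map_zero]
  refine tendsto_nhds_unique ((E.tendsto_proj_ball k).inner tendsto_const_nhds) ?_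
  simp only [h1]
  exact tendsto_const_nhds

theorem _root_.UnboundedOp.pow_apply_mem {A : K →ₗ.[ℂ] K} {W : Submodule ℂ K}
    (hA : ∀ x : A.domain, (x : K) ∈ W → A x ∈ W) (n : ℕ) (x : (UnboundedOp.pow A n).domain)
    (hx : (x : K) ∈ W) : UnboundedOp.pow A n x ∈ W := by
  induction n with
  | zero => exact hx
  | succ n ih =>
    obtain ⟨x, hx'⟩ := x
    obtain ⟨h1, h2⟩ := (UnboundedOp.mem_mul_domain A (UnboundedOp.pow A n) x).1 hx'
    change UnboundedOp.mul A (UnboundedOp.pow A n) ⟨x, hx'⟩ ∈ W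
    rw [UnboundedOp.mul_apply A _ x hx' h1 h2]
    exact hA _ (ih ⟨x, h1⟩ hx)

/-- A vector generating `K` under `A` and `A*` generates `K` under the resolution of `A`. -/
theorem IsResolutionOf.exists_cyclic {A : K →ₗ.[ℂ] K} (hE : E.IsResolutionOf A)
    (hd : Dense (A.domain : Set K)) (hs : UnboundedOp.HasSimpleSpectrum A) :
    ∃ v, ∀ W : Submodule ℂ K, IsClosed (W : Set K) → v ∈ W →
      (∀ Ω x, MeasurableSet Ω → x ∈ W → E.proj Ω x ∈ W) → W = ⊤ := by
  obtain ⟨v, hv, htop⟩ := hs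
  refine ⟨v, fun W hW hvW hinv => ?_⟩
  rw [eq_top_iff, ← htop]
  refine Submodule.topologicalClosure_minimal _ (Submodule.span_le.2 ?_) hW
  rintro _ ⟨⟨k, l⟩, rfl⟩
  obtain ⟨h1, h2⟩ := (UnboundedOp.mem_mul_domain _ _ v).1 (hv k l)
  dsimp only
  rw [UnboundedOp.mul_apply _ _ v (hv k l) h1 h2]
  refine UnboundedOp.pow_apply_mem (fun x hx => hE.adjoint_mem_of_invariant hd hW hinv x hx) k _ ?_
  exact UnboundedOp.pow_apply_mem
    (fun x hx => hE.graph_mem_of_invariant hW hinv (A.mem_graph x) hx) l _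
    hvW

variable (E)

/-- Replaces integration against the complex measure ⟨E v, v⟩ by ordinary integration against ‖E
v‖², so that Radon–Nikodym densities can be compared with φ(E). -/
theorem inner_vec_self {φ : ℂ → ℂ} (hφ : Measurable φ) {C : ℝ} (hC : ∀ z, ‖φ z‖ ≤ C) (v : K) :
    inner ℂ v (E.vec φ v) = ∫ z, φ z ∂E.measure v := by
  have hs : ∀ s : SimpleFunc ℂ ℂ, inner ℂ v (E.vec s v) = ∫ z, s z ∂E.measure v := fun s => by
    have hm : ∀ s : SimpleFunc ℂ ℂ, MemLp s 2 (E.measure v) := fun s =>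
      s.memLp_of_isFiniteMeasure 2 _
    induction s using SimpleFunc.induction with
    | const c hΩ =>
      rename_i Ω
      have e : ⇑(SimpleFunc.piecewise Ω hΩ (SimpleFunc.const ℂ c) (SimpleFunc.const ℂ 0)) =
          fun z => c * Ω.indicator (fun _ => 1) z := by
        funext z
        by_cases hz : z ∈ Ω <;> simp [hz]
      rw [e, E.vec_const_mul c ((memLp_const 1).indicator hΩ), E.vec_indicator_one hΩ,
        inner_smul_right, integral_const_mul, integral_indicator hΩ, setIntegral_const,
        Measure.real, E.measure_apply hΩ, ← E.norm_proj_sq]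
      simp [mul_comm]
    | add hd h₁ h₂ =>
      rename_i f g
      have e : ⇑(f + g) = fun z => f z + g z := rfl
      rw [e, E.vec_add (hm f) (hm g), inner_add_right, h₁, h₂,
        integral_add ((hm f).integrable one_le_two) ((hm g).integrable one_le_two)]
  have hsm : StronglyMeasurable φ := hφ.stronglyMeasurable
  have h0 : 0 ≤ C := (norm_nonneg _).trans (hC 0)
  have h1 : Tendsto (fun n => E.vec (hsm.approxBounded C n) v) atTop (𝓝 (E.vec φ v)) := by
    refine E.tendsto_vec (b := fun _ => ((C + C : ℝ) : ℂ))
      (fun n => (hsm.approxBounded C n).memLp_of_isFiniteMeasure 2 _) (E.memLp_of_bound hφ hC v)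
      (memLp_const _) (fun n => ae_of_all _ fun z => ?_) (ae_of_all _ fun z => ?_)
    · rw [Complex.norm_real, Real.norm_of_nonneg (by positivity)]
      exact (norm_sub_le _ _).trans (add_le_add (hsm.norm_approxBounded_le h0 n z) (hC z))
    · exact hsm.tendsto_approxBounded_of_norm_le (hC z)
  have h2 : Tendsto (fun n => ∫ z, hsm.approxBounded C n z ∂E.measure v) atTop
      (𝓝 (∫ z, φ z ∂E.measure v)) := by
    refine tendsto_integral_of_dominated_convergence (fun _ => C)
      (fun n => (hsm.approxBounded C n).measurable.aestronglyMeasurable) (integrable_const C)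
      (fun n => ae_of_all _ fun z => hsm.norm_approxBounded_le h0 n z)
      (ae_of_all _ fun z => hsm.tendsto_approxBounded_of_norm_le (hC z))
  refine tendsto_nhds_unique ((tendsto_const_nhds (x := v)).inner h1) ?_
  simpa only [hs] using h2

/-! ### Bounded Radon–Nikodym densities -/

theorem abs_le_ae_of_density {μ : Measure ℂ} [IsFiniteMeasure μ] {f : ℂ → ℝ}
    (hf : Integrable f μ) {C : ℝ}
    (h : ∀ Ω, MeasurableSet Ω → |∫ z in Ω, f z ∂μ| ≤ C * μ.real Ω) : ∀ᵐ z ∂μ, |f z| ≤ C := by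
  have h1 := ae_le_of_forall_setIntegral_le hf (integrable_const C) fun Ω hΩ _ => by
    rw [setIntegral_const, smul_eq_mul, mul_comm]
    exact (le_abs_self _).trans (h Ω hΩ)
  have h2 := ae_le_of_forall_setIntegral_le (integrable_const (-C)) hf fun Ω hΩ _ => by
    rw [setIntegral_const, smul_eq_mul, mul_comm, neg_mul]
    exact (neg_le_neg (h Ω hΩ)).trans (neg_abs_le _)
  filter_upwards [h1, h2] with z hz hz'
  exact abs_le.2 ⟨hz', hz⟩

theorem exists_bounded_real_density (ν : SignedMeasure ℂ) (μ : Measure ℂ) [IsFiniteMeasure μ]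
    {C : ℝ} (h0 : 0 ≤ C) (h : ∀ Ω, MeasurableSet Ω → |ν Ω| ≤ C * μ.real Ω) :
    ∃ f : ℂ → ℝ, Measurable f ∧ (∀ z, |f z| ≤ C) ∧
      ∀ Ω, MeasurableSet Ω → ν Ω = ∫ z in Ω, f z ∂μ := by
  have hac : ν ≪ᵥ μ.toENNRealVectorMeasure := VectorMeasure.AbsolutelyContinuous.mk
    fun Ω hΩ hz => by
      rw [Measure.toENNRealVectorMeasure_apply_measurable hΩ] at hz
      have := h Ω hΩ
      rw [measureReal_def, hz] at this
      simpa using this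
  have hint := SignedMeasure.integrable_rnDeriv ν μ
  have hν : ∀ Ω, MeasurableSet Ω → ν Ω = ∫ z in Ω, ν.rnDeriv μ z ∂μ := fun Ω hΩ => by
    conv_lhs => rw [← SignedMeasure.withDensityᵥ_rnDeriv_eq ν μ hac]
    exact withDensityᵥ_apply hint hΩ
  have hae := abs_le_ae_of_density hint fun Ω hΩ => by
    rw [← hν Ω hΩ]
    exact h Ω hΩ
  -- Clamping to [-C, C] turns the almost everywhere bound into one valid everywhere without
  -- changing the integrals.
  refine ⟨fun z => max (-C) (min (ν.rnDeriv μ z) C), ?_, fun z => ?_, fun Ω hΩ => ?_⟩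
  · have := SignedMeasure.measurable_rnDeriv ν μ
    fun_prop
  · exact abs_le.2 ⟨le_max_left _ _, max_le (by linarith) (min_le_right _ _)⟩
  · rw [hν Ω hΩ]
    refine setIntegral_congr_ae hΩ ?_
    filter_upwards [hae] with z hz _
    rw [min_eq_left (abs_le.1 hz).2, max_eq_right (abs_le.1 hz).1]

theorem exists_bounded_density (ν : ComplexMeasure ℂ) (μ : Measure ℂ) [IsFiniteMeasure μ] {C : ℝ}
    (h0 : 0 ≤ C) (h : ∀ Ω, MeasurableSet Ω → ‖ν Ω‖ ≤ C * μ.real Ω) :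
    ∃ φ : ℂ → ℂ, Measurable φ ∧ (∀ z, ‖φ z‖ ≤ C + C) ∧
      ∀ Ω, MeasurableSet Ω → ν Ω = ∫ z in Ω, φ z ∂μ := by
  have hre : ∀ Ω, ComplexMeasure.re ν Ω = (ν Ω).re := fun Ω => rfl
  have him : ∀ Ω, ComplexMeasure.im ν Ω = (ν Ω).im := fun Ω => rfl
  obtain ⟨f, hf, hfC, hfν⟩ := exists_bounded_real_density (ComplexMeasure.re ν) μ h0 fun Ω hΩ =>
    (Complex.abs_re_le_norm _).trans (h Ω hΩ)
  obtain ⟨g, hg, hgC, hgν⟩ := exists_bounded_real_density (ComplexMeasure.im ν) μ h0 fun Ω hΩ =>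
    (Complex.abs_im_le_norm _).trans (h Ω hΩ)
  have hfi : Integrable f μ := Integrable.of_bound hf.aestronglyMeasurable C (ae_of_all _ hfC)
  have hgi : Integrable g μ := Integrable.of_bound hg.aestronglyMeasurable C (ae_of_all _ hgC)
  refine ⟨fun z => f z + g z * Complex.I, by fun_prop, fun z => ?_, fun Ω hΩ => ?_⟩
  · refine (norm_add_le _ _).trans (add_le_add ?_ ?_)
    · rw [Complex.norm_real]
      exact hfC z
    · rw [norm_mul, Complex.norm_I, mul_one, Complex.norm_real]
      exact hgC z
  · have e := integral_add (μ := μ.restrict Ω) (f := fun z => (f z : ℂ))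
      (g := fun z => (g z : ℂ) * Complex.I) hfi.ofReal.integrableOn
      (hgi.ofReal.mul_const _).integrableOn
    rw [e, integral_mul_const, integral_complex_ofReal, integral_complex_ofReal, ← hfν Ω hΩ,
      ← hgν Ω hΩ, hre, him, Complex.re_add_im]

/-- An operator commuting with a resolution of the identity that has a cyclic vector is a bounded
Borel function of it. -/
theorem exists_eq_vec_of_commute {M : K →L[ℂ] K}
    (hM : ∀ Ω h, MeasurableSet Ω → M (E.proj Ω h) = E.proj Ω (M h)) {v : K}
    (hv : ∀ W : Submodule ℂ K, IsClosed (W : Set K) → v ∈ W →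
      (∀ Ω x, MeasurableSet Ω → x ∈ W → E.proj Ω x ∈ W) → W = ⊤) :
    ∃ (φ : ℂ → ℂ) (C : ℝ), Measurable φ ∧ (∀ z, ‖φ z‖ ≤ C) ∧ ∀ h, M h = E.vec φ h := by
  -- ν(Ω) = ⟨M E_Ω v, v⟩. Commutation rewrites it as ⟨M E_Ω v, E_Ω v⟩, so |ν(Ω)| ≤ ‖M‖ ‖E_Ω v‖² and
  -- the density is bounded.
  let ν := E.scalarMeasure v (ContinuousLinearMap.adjoint M v)
  have hν : ∀ Ω, ν Ω = inner ℂ v (M (E.proj Ω v)) := fun Ω =>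
    ContinuousLinearMap.adjoint_inner_left M _ _
  obtain ⟨φ, hφ, hφC, hφν⟩ := exists_bounded_density ν (E.measure v) (norm_nonneg M)
    fun Ω hΩ => by
      rw [hν, ← E.proj_proj_same, hM _ _ hΩ, ← inner_proj_left, measureReal_def,
        E.measure_apply hΩ, ENNReal.toReal_pow, toReal_enorm]
      refine (norm_inner_le_norm _ _).trans ?_
      calc _ ≤ ‖E.proj Ω v‖ * (‖M‖ * ‖E.proj Ω v‖) := by
            gcongr
            exact M.le_opNorm _
        _ = _ := by ring
  refine ⟨φ, _, hφ, hφC, ?_⟩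
  set N := M - E.borel φ hφ hφC with hN
  have hNE : ∀ Ω h, MeasurableSet Ω → N (E.proj Ω h) = E.proj Ω (N h) := fun Ω h hΩ => by
    have hm := E.memLp_of_bound hφ hφC
    rw [hN, sub_apply, sub_apply, borel_apply, borel_apply, map_sub, hM _ _ hΩ,
      (E.vec_proj hφ hΩ ((hm h).indicator hΩ)).2, E.proj_vec (hm h) hΩ]
  have hinner : ∀ Ω, MeasurableSet Ω → inner ℂ v (N (E.proj Ω v)) = 0 := fun Ω hΩ => by
    have hb : ∀ z, ‖Ω.indicator φ z‖ ≤ ‖M‖ + ‖M‖ :=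
      norm_indicator_le_of_forall (by positivity) fun z _ => hφC z
    rw [hN, sub_apply, inner_sub_right, ← hν, hφν Ω hΩ, borel_apply,
      (E.vec_proj hφ hΩ ((E.memLp_of_bound hφ hφC v).indicator hΩ)).2,
      E.inner_vec_self (hφ.indicator hΩ) hb, integral_indicator hΩ, sub_self]
  -- The vectors orthogonal to every E_Ω N v form a closed invariant subspace. It contains v, since
  -- ⟨v, E_Ω N v⟩ = ⟨v, N E_Ω v⟩ = 0, so it is everything, and in particular N v is orthogonal to
  -- itself.
  have hNv : N v = 0 := by
    let W : Submodule ℂ K := ⨅ Ω : {Ω : Set ℂ // MeasurableSet Ω},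
      (ℂ ∙ E.proj Ω.1 (N v))ᗮ
    have hW : W = ⊤ := by
      refine hv W ?_ ?_ ?_
      · rw [Submodule.coe_iInf]
        exact isClosed_iInter fun Ω => Submodule.isClosed_orthogonal _
      · refine Submodule.mem_iInf _ |>.2 fun Ω => ?_
        rw [Submodule.mem_orthogonal_singleton_iff_inner_left, ← hNE _ _ Ω.2]
        exact hinner Ω.1 Ω.2
      · intro Ω x hΩ hx
        refine Submodule.mem_iInf _ |>.2 fun Ω' => ?_
        have := (Submodule.mem_iInf _).1 hx ⟨Ω ∩ Ω'.1, hΩ.inter Ω'.2⟩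
        rw [Submodule.mem_orthogonal_singleton_iff_inner_left] at this ⊢
        rw [inner_proj_left, E.proj_proj hΩ Ω'.2]
        exact this
    have hmem : N v ∈ W := hW ▸ Submodule.mem_top
    have := (Submodule.mem_iInf _).1 hmem ⟨Set.univ, MeasurableSet.univ⟩
    rw [Submodule.mem_orthogonal_singleton_iff_inner_left, E.univ] at this
    exact inner_self_eq_zero.1 this
  -- Cyclicity again: the kernel of N is closed, invariant and contains v.
  have hker := hv (LinearMap.ker (N : K →ₗ[ℂ] K)) N.isClosed_ker hNv fun Ω x hΩ hx => by
    change N x = 0 at hx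
    change N (E.proj Ω x) = 0
    rw [hNE _ _ hΩ, hx, map_zero]
  intro h
  have h1 : h ∈ LinearMap.ker (N : K →ₗ[ℂ] K) := hker ▸ Submodule.mem_top
  change N h = 0 at h1
  rwa [hN, sub_apply, sub_eq_zero] at h1

end Cyclic

end ResolutionOfIdentity

/-! ### Operators commuting with the semigroup, and the main theorem -/

theorem ContractionSemigroup.mem_graph_of_commute {K : Type*} [NormedAddCommGroup K]
    [InnerProductSpace ℂ K] {Q : ContractionSemigroup K} {M : K →L[ℂ] K}
    (hM : ∀ t x, M (Q.op t x) = Q.op t (M x)) {x y : K} (hxy : (x, y) ∈ Q.negGenerator.graph) :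
    (M x, M y) ∈ Q.negGenerator.graph := by
  obtain ⟨u, rfl, rfl⟩ := (LinearPMap.mem_graph_iff _).1 hxy
  have h1 : Tendsto (Q.diffQuot (M u)) (𝓝[>] 0) (𝓝 (-M (Q.negGenerator u))) := by
    have := (M.continuous.tendsto _).comp (Q.negGenerator_tendsto u)
    rw [map_neg] at this
    refine this.congr fun t => ?_
    simp only [Function.comp_def, diffQuot, map_smul, map_sub, hM]
  have h2 : M u ∈ Q.negGenerator.domain := ⟨_, h1⟩
  have h3 := neg_injective (tendsto_nhds_unique h1 (Q.negGenerator_tendsto ⟨M u, h2⟩))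
  rw [h3]
  exact Q.negGenerator.mem_graph ⟨M u, h2⟩

section Intertwining

variable {H K : Type*} [NormedAddCommGroup H] [InnerProductSpace ℂ H] [CompleteSpace H]
  [NormedAddCommGroup K] [InnerProductSpace ℂ K] [CompleteSpace K]

/-- Commutation passes from the semigroup to the graph of its generator and from there to the
resolution of the identity; simple spectrum supplies the cyclic vector. -/
theorem exists_isBorelFunctionOf {Q : ContractionSemigroup K}
    (hnormal : UnboundedOp.IsNormal Q.negGenerator)
    (hs : UnboundedOp.HasSimpleSpectrum Q.negGenerator) {M : K →L[ℂ] K}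
    (hM : ∀ t x, M (Q.op t x) = Q.op t (M x)) :
    ∃ m : ℂ → ℂ, IsBoundedBorelOn (UnboundedOp.spectrum Q.negGenerator) m ∧
      IsBorelFunctionOf Q.negGenerator m M := by
  have hE := isResolutionOf_spectralResolution Q hnormal
  obtain ⟨v, hv⟩ := hE.exists_cyclic hnormal.1 hs
  obtain ⟨φ, C, hφ, hC, hMφ⟩ := ResolutionOfIdentity.exists_eq_vec_of_commute _
    (fun Ω h hΩ => hE.apply_proj_of_commute hnormal Q.re_inner_negGenerator_nonneg
      (fun x y => Q.mem_graph_of_commute hM) hΩ h) hv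
  refine ⟨φ, ⟨hφ.comp measurable_subtype_coe, C, fun z _ => hC z⟩, fun h k => ?_⟩
  rw [hMφ, ResolutionOfIdentity.inner_vec _ (ResolutionOfIdentity.memLp_of_bound _ hφ hC h),
    complexIntegral_eq_indicator hE.isClosed_spectrum.measurableSet]
  refine complexIntegral_congr_ae
    ((ResolutionOfIdentity.variation_absolutelyContinuous _ h k).ae_le ?_)
  filter_upwards [hE.ae_mem_spectrum h] with z hz
  rw [Set.indicator_of_mem hz]

end Intertwining

end

theorem mainTheorem2 {H K : Type*}
    [NormedAddCommGroup H] [InnerProductSpace ℂ H] [CompleteSpace H]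
    [TopologicalSpace.SeparableSpace H]
    [NormedAddCommGroup K] [InnerProductSpace ℂ K] [CompleteSpace K]
    [TopologicalSpace.SeparableSpace K]
    (P : ContractionSemigroup H) (Q : ContractionSemigroup K)
    (Λ : K →L[ℂ] H) (Λ' : H →L[ℂ] K) (γ₁ : ℝ)
    (hΛ : Intertwines P Λ Q) (hΛ' : Intertwines Q Λ' P)
    (hnormal : UnboundedOp.IsNormal Q.negGenerator)
    (hgap : UnboundedOp.IsSpectralGap Q.negGenerator γ₁)
    (hproper : IsProper (spectralResolution Q.negGenerator) Λ)
    (hdense : DenseRange Λ') :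
    (∀ m : ℂ → ℂ, IsBoundedBorelOn (UnboundedOp.spectrum Q.negGenerator) m →
      IsBorelFunctionOf Q.negGenerator m (Λ' ∘L Λ) →
      ConditionA Q.negGenerator Λ (fun γ => m γ / ((‖Λ‖ * ‖Λ'‖ : ℝ) : ℂ))) ∧
    (UnboundedOp.HasSimpleSpectrum Q.negGenerator →
      ∃ m : ℂ → ℂ, IsBoundedBorelOn (UnboundedOp.spectrum Q.negGenerator) m ∧
        IsBorelFunctionOf Q.negGenerator m (Λ' ∘L Λ)) ∧
    (∀ m : ℂ → ℂ, IsBoundedBorelOn (UnboundedOp.spectrum Q.negGenerator) m →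
      IsBorelFunctionOf Q.negGenerator m (Λ' ∘L Λ) →
      ∀ T : ℝ, 0 < T → ConditionB Q.negGenerator m T →
      ConvergenceConclusions P Q.negGenerator Λ γ₁
        (fun γ => m γ / ((‖Λ‖ * ‖Λ'‖ : ℝ) : ℂ)) T) := by
  have h := hasGapResolution hnormal hgap
  refine ⟨fun m hm hM => conditionA_of_isBorelFunctionOf h.isResolutionOf hm hM, fun hs => ?_,
    fun m hm hM T _ hB => h.convergenceConclusions hΛ hproper.1 hm hM hB⟩
  -- The two intertwining relations together make Λ'Λ commute with every Q_t.
  refine exists_isBorelFunctionOf hnormal hs fun t x => ?_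
  have h1 : P.op t (Λ x) = Λ (Q.op t x) := congrArg (fun L => L x) (hΛ t)
  have h2 : Q.op t (Λ' (Λ x)) = Λ' (P.op t (Λ x)) := congrArg (fun L => L (Λ x)) (hΛ' t)
  rw [ContinuousLinearMap.comp_apply, ContinuousLinearMap.comp_apply, h2, h1]
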